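/- **Maps.** An *essentially 3-valent map with boundary* is given by a finite set of internal darts, a set of boundary darts, a permutation of the internal darts (the counterclockwise rotation around vertices) all of whose cycles have length 1, 2 or 3 (the vertices), and a fixpoint-free involution on all darts that exchanges each arc with its opposite. A *rooted* such map has boundary darts $x_0,x_1,\dots,x_n$, listed clockwise around the boundary with $x_0$ the root, and its open graph is connected. It is *planar* if the map obtained by closing the boundary with one external vertex has Euler characteristic $2$ (genus $0$). An orientation chooses one arc from each edge so that 3-valent vertices have two inputs and one output (*negative*) or one input and two outputs (*positive*), and 2-valent vertices have one input and one output. At a negative vertex the darts are, counterclockwise, $(\text{output},\text{argument},\text{function})$, written $T_1(T_2)$ if $T_1$ enters at the function and $T_2$ at the argument; at a positive vertex they are $(\text{root},\text{variable},\text{body})$ with the body as input, written $\lambda x.T$ if $T$ enters at the body and $x$ leaves at the variable output. A 1-valent vertex with an output is written $I$. A $\bullet$ denotes a 2-valent vertex. **Topological orientation.** It is defined by induction on the number of vertices of a rooted map, by removing the vertex incident to the root. If there is none, the map is a single edge, oriented from $x_1$ to $x_0$. A 1-valent vertex has an output to the root. A 2-valent vertex is oriented towards the root, the rest of the map being rooted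 at its input. At a 3-valent vertex, let $d_0,d_1,d_2$ be its darts counterclockwise, with $d_0$ on the root edge. If its removal disconnects the map, the vertex is negative with output $d_0$, and the two components, rooted at $d_2$ (function) and $d_1$ (argument), are oriented topologically. If not, the vertex is positive with outputs $d_0$ and $d_1$, and what remains is a map rooted at $d_2$, with $d_1$ as an additional boundary input, oriented topologically. **Moves.** A move replaces, inside an arbitrary context, an oriented map by another one with the same boundary. The *imploid moves* are: 1. removal of a 2-valent vertex; doubling of a 2-valent vertex; subdivision of all three edges at a positive vertex; the same at a negative vertex; 2. $\beta$: a positive vertex whose root output goes, through a $\bullet$, to the function input of a negative vertex is replaced by two edges with one $\bullet$ each, from the body of the former to the output of the latter and from the argument of the latter to the variable of the former, i.e. $(\lambda x.T_1)(T_2)\Rightarrow T_1[T_2/x]$; $\eta$: $T\Rightarrow\lambda x.T(x)$, which replaces an edge with a $\bullet$ by a bubble with a $\bullet$ on each of its two internal edges; 3. composition: $\lambda x.T\Rightarrow\lambda x.\lambda y.T[x(y)/x]$; $\iota$, in both directions: $I(T)\Leftrightarrow T$, where the edge on the right carries a $\bullet$; unit: $T\Rightarrow T(I)$, where the edge on the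 left carries a $\bullet$. The *symmetric moves* are $\chi$: $(T_0(T_1))(T_2)\Rightarrow(T_0(T_2))(T_1)$; $\mathrm C$: $I\Rightarrow\lambda x.\lambda y.\lambda z.(x(z))(y)$; and $\gamma$: $T_1(T_2)\Rightarrow T_2(T_1)$. **Spines.** Let $V_0=I$, let $V_{n+1}=V_n(x_{n+1})$ where $x_{n+1}$ is a new boundary input, and let $V'_n$ be $V_n$ with its root edge subdivided by one 2-valent vertex. **Theorem.** (a) Every planar rooted essentially 3-valent map, with its topological orientation, can be obtained up to isomorphism from some $V'_n$ by finitely many imploid moves. (b) For each single one $s\in\{\chi,\mathrm C,\gamma\}$ of the symmetric moves, every rooted essentially 3-valent map of arbitrary genus, with its topological orientation, can be obtained up to isomorphism from some $V'_n$ by finitely many moves, each of which is an imploid move or $s$. In particular, in both cases such a map has a topological orientation. Here $n$ is the number of non-root boundary arcs of the map. -/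

import Mathlib

namespace ImploidMoves

/-! ### Maps with boundary -/

/-- An essentially 3-valent combinatorial map with boundary `B`.  `D` is the set of internal
darts (arcs whose source is a vertex), `B` the set of boundary darts (arcs whose source lies on
the boundary).  `rot` is the counterclockwise rotation of the darts around their source vertex, so
the vertices are the cycles of `rot`, all of them of length 1, 2 or 3; `e` is the fixpoint-free
involution that sends an arc to the opposite arc.  It need not be connected. -/
structure OpenMap (B : Type) where
  D : Type
  finite : Finite D
  rot : Equiv.Perm D
  e : D ⊕ B → D ⊕ B
  e_invol : Function.Involutive e
  e_ne : ∀ x, e x ≠ x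
  deg_le : ∀ d, rot d = d ∨ rot (rot d) = d ∨ rot (rot (rot d)) = d

/-- One step between arcs: to the opposite arc, or to the next arc around an (internal) vertex. -/
inductive OpenMap.Adj {B : Type} (M : OpenMap B) : M.D ⊕ B → M.D ⊕ B → Prop
  | edge (x : M.D ⊕ B) : M.Adj x (M.e x)
  | vertex (d : M.D) : M.Adj (Sum.inl d) (Sum.inl (M.rot d))

/-- A rooted essentially 3-valent map with `n` non-root boundary arcs: the boundary darts
`0, 1, …, n` are listed in clockwise order around the boundary, starting from the root `0`.
The underlying open graph is connected (the boundary itself does not connect anything). -/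
structure RootedMap (n : ℕ) extends OpenMap (Fin (n + 1)) where
  connected : ∀ x y, Relation.EqvGen toOpenMap.Adj x y

/-- The number of orbits (cycles, counting fixed points) of a permutation. -/
noncomputable def numOrbits {α : Type} (p : Equiv.Perm α) : ℕ :=
  Nat.card (Quotient (Equiv.Perm.SameCycle.setoid p))

namespace RootedMap

variable {n : ℕ} (M : RootedMap n)

/-- The vertex permutation of the closed map obtained by closing the boundary with one external
vertex; clockwise order around the boundary is counterclockwise order around that vertex. -/
def vertexPerm : Equiv.Perm (M.D ⊕ Fin (n + 1)) :=
  Equiv.sumCongr M.rot (finRotate (n + 1))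

/-- The edge involution as a permutation. -/
def edgePerm : Equiv.Perm (M.D ⊕ Fin (n + 1)) :=
  M.e_invol.toPerm

/-- The face permutation `(e ∘ v)⁻¹`. -/
def facePerm : Equiv.Perm (M.D ⊕ Fin (n + 1)) :=
  (M.edgePerm * M.vertexPerm)⁻¹

/-- The Euler characteristic of the closed map. -/
noncomputable def eulerChar : ℤ :=
  (numOrbits M.vertexPerm : ℤ) - numOrbits M.edgePerm + numOrbits M.facePerm

/-- A rooted map is planar if it has genus `0`, where `eulerChar = 2 - 2 * genus`. -/
def IsPlanar : Prop := M.eulerChar = 2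

end RootedMap

/-! ### Orientations -/

/-- A well-orientation: the choice of one arc from every edge such that every vertex of degree at
least two has both an outgoing and an incoming arc.  So a 3-valent vertex has two inputs and one
output or one input and two outputs, and a 2-valent vertex has one input and one output.
A dart `inl d` in `pos` is an output of its source vertex; a boundary dart `inr b` in `pos` is an
arc that enters the map from the boundary. -/
structure Orientation {B : Type} (M : OpenMap B) where
  pos : Set (M.D ⊕ B)
  pos_iff : ∀ x, x ∈ pos ↔ M.e x ∉ pos
  well : ∀ d, M.rot d ≠ d → ∃ a b, M.rot.SameCycle d a ∧ M.rot.SameCycle d b ∧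
    Sum.inl a ∈ pos ∧ Sum.inl b ∉ pos

/-- A well-oriented essentially 3-valent map with boundary `B` (not necessarily connected). -/
structure OrientedMap (B : Type) extends OpenMap B where
  orient : Orientation toOpenMap

/-- The set of arcs that belong to the orientation. -/
abbrev OrientedMap.pos {B : Type} (M : OrientedMap B) : Set (M.D ⊕ B) := M.orient.pos

/-- A well-oriented rooted essentially 3-valent map. -/
structure OrientedRootedMap (n : ℕ) extends RootedMap n where
  orient : Orientation toOpenMap

/-- Forget that the map is connected. -/
def OrientedRootedMap.toOrientedMap {n : ℕ} (M : OrientedRootedMap n) :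
    OrientedMap (Fin (n + 1)) :=
  { M.toOpenMap with orient := M.orient }

/-! ### The topological orientation -/

/-- `TopologicalAt M O S r B'`: the set `O` of arcs is the topological orientation of the rooted
submap of `M` that has the vertices made of the darts in `S`, the root `r`, and the non-root
boundary arcs `B'` (`r` and `B'` consist of arcs whose source lies outside the submap).
The definition is by recursion on the number of vertices, removing the vertex `d, rot d, …`
incident to the root, where `d = e r`:
* `edge`: there is no such vertex, and the submap is a single edge from a boundary arc to the root;
* `unit`: the submap is a single 1-valent vertex, with an output to the root;
* `glue`: the vertex is 2-valent, and oriented towards the root;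
* `lam`: the vertex is 3-valent and its removal leaves one rooted map, with root at the third arc
  (the input), of which the second arc becomes an additional boundary input;
* `app`: the vertex is 3-valent and its removal leaves two disjoint rooted maps, with
  roots at the third and at the second arc. -/
inductive TopologicalAt {B : Type} (M : OpenMap B) (O : Set (M.D ⊕ B)) :
    Set M.D → M.D ⊕ B → Set (M.D ⊕ B) → Prop
  | edge (r : M.D ⊕ B) : M.e r ∈ O → TopologicalAt M O ∅ r {M.e r}
  | unit (r : M.D ⊕ B) (d : M.D) :
      M.e r = Sum.inl d → M.rot d = d → Sum.inl d ∈ O →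
      TopologicalAt M O {d} r ∅
  | glue (r : M.D ⊕ B) (d : M.D) (S : Set M.D) (B' : Set (M.D ⊕ B)) :
      M.e r = Sum.inl d → M.rot d ≠ d → M.rot (M.rot d) = d →
      Sum.inl d ∈ O → Sum.inl (M.rot d) ∉ O →
      Disjoint {d, M.rot d} S →
      TopologicalAt M O S (Sum.inl (M.rot d)) B' →
      TopologicalAt M O ({d, M.rot d} ∪ S) r B'
  | lam (r : M.D ⊕ B) (d : M.D) (S : Set M.D) (B' : Set (M.D ⊕ B)) :
      M.e r = Sum.inl d → M.rot d ≠ d → M.rot (M.rot (M.rot d)) = d →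
      Sum.inl d ∈ O → Sum.inl (M.rot d) ∈ O → Sum.inl (M.rot (M.rot d)) ∉ O →
      Disjoint {d, M.rot d, M.rot (M.rot d)} S → Sum.inl (M.rot d) ∉ B' →
      TopologicalAt M O S (Sum.inl (M.rot (M.rot d))) (insert (Sum.inl (M.rot d)) B') →
      TopologicalAt M O ({d, M.rot d, M.rot (M.rot d)} ∪ S) r B'
  | app (r : M.D ⊕ B) (d : M.D) (S₁ S₂ : Set M.D) (B₁ B₂ : Set (M.D ⊕ B)) :
      M.e r = Sum.inl d → M.rot d ≠ d → M.rot (M.rot (M.rot d)) = d →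
      Sum.inl d ∈ O → Sum.inl (M.rot d) ∉ O → Sum.inl (M.rot (M.rot d)) ∉ O →
      Disjoint {d, M.rot d, M.rot (M.rot d)} (S₁ ∪ S₂) → Disjoint S₁ S₂ → Disjoint B₁ B₂ →
      TopologicalAt M O S₁ (Sum.inl (M.rot (M.rot d))) B₁ →
      TopologicalAt M O S₂ (Sum.inl (M.rot d)) B₂ →
      TopologicalAt M O ({d, M.rot d, M.rot (M.rot d)} ∪ (S₁ ∪ S₂)) r (B₁ ∪ B₂)

/-- `o` is the topological orientation of the rooted map `M`. -/
def RootedMap.IsTopological {n : ℕ} (M : RootedMap n) (o : Orientation M.toOpenMap) : Prop :=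
  TopologicalAt M.toOpenMap o.pos Set.univ (Sum.inr 0) {x | ∃ i : Fin (n + 1), i ≠ 0 ∧ x = Sum.inr i}

/-! ### Gluing a map into a context, isomorphism -/

section Gluing

variable {B H : Type} (C : OrientedMap (B ⊕ H)) (P : OrientedMap H)

/-- The darts of a context `C` with hole `H`, as ends of edges in the union of `C` and `P`. -/
def embContext : C.D ⊕ (B ⊕ H) → ((C.D ⊕ P.D) ⊕ B) ⊕ H
  | Sum.inl d => Sum.inl (Sum.inl (Sum.inl d))
  | Sum.inr (Sum.inl b) => Sum.inl (Sum.inr b)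
  | Sum.inr (Sum.inr h) => Sum.inr h

/-- The darts of a map `P` with boundary `H`, as ends of edges in the union of `C` and `P`. -/
def embPattern : P.D ⊕ H → ((C.D ⊕ P.D) ⊕ B) ⊕ H
  | Sum.inl d => Sum.inl (Sum.inl (Sum.inr d))
  | Sum.inr h => Sum.inr h

/-- Being joined by an edge of the context `C` or by an edge of `P`. -/
inductive Link : ((C.D ⊕ P.D) ⊕ B) ⊕ H → ((C.D ⊕ P.D) ⊕ B) ⊕ H → Prop
  | context (x : C.D ⊕ (B ⊕ H)) : Link (embContext C P x) (embContext C P (C.e x))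
  | pattern (x : P.D ⊕ H) : Link (embPattern C P x) (embPattern C P (P.e x))

/-- `M` is (up to isomorphism) the map obtained by gluing `P` into the hole `H` of the context `C`:
it has the vertices of both, with their rotations and orientations, and two distinct darts form
an edge of `M` if they are the ends of a path obtained by concatenating edges of `C` and of `P`
across `H`.  The orientations have to match along `H`. -/
def IsGluing (M : OrientedMap B) : Prop :=
  ∃ φ : C.D ⊕ P.D ≃ M.D,
    (∀ d, M.rot (φ (Sum.inl d)) = φ (Sum.inl (C.rot d))) ∧
    (∀ d, M.rot (φ (Sum.inr d)) = φ (Sum.inr (P.rot d))) ∧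
    (∀ d, Sum.inl (φ (Sum.inl d)) ∈ M.pos ↔ Sum.inl d ∈ C.pos) ∧
    (∀ d, Sum.inl (φ (Sum.inr d)) ∈ M.pos ↔ Sum.inl d ∈ P.pos) ∧
    (∀ b, Sum.inr b ∈ M.pos ↔ Sum.inr (Sum.inl b) ∈ C.pos) ∧
    (∀ h, Sum.inr (Sum.inr h) ∈ C.pos ↔ Sum.inr h ∉ P.pos) ∧
    (∀ x y : (C.D ⊕ P.D) ⊕ B, M.e (Sum.map φ id x) = Sum.map φ id y ↔
      x ≠ y ∧ Relation.EqvGen (Link C P) (Sum.inl x) (Sum.inl y))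

/-- Isomorphism of well-oriented maps, fixing the boundary. -/
def Isomorphic (M N : OrientedMap B) : Prop :=
  ∃ φ : M.D ≃ N.D,
    (∀ d, N.rot (φ d) = φ (M.rot d)) ∧
    (∀ x, N.e (Sum.map φ id x) = Sum.map φ id (M.e x)) ∧
    (∀ x, Sum.map φ id x ∈ N.pos ↔ x ∈ M.pos)

end Gluing

/-! ### Concrete maps given by lists of edges -/

/-- The kinds of vertices that occur in the moves: positive 3-valent, negative 3-valent, 2-valent,
and 1-valent with an output. -/
inductive Kind
  | lam | app | glue | unit

/-- The darts of a vertex of each kind.  A positive vertex has the input `body` and the outputs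
`var` and `root`; a negative vertex has the inputs `fn` and `arg` and the output `cont`. -/
inductive Port : Kind → Type
  | root : Port Kind.lam
  | var : Port Kind.lam
  | body : Port Kind.lam
  | cont : Port Kind.app
  | arg : Port Kind.app
  | fn : Port Kind.app
  | tgt : Port Kind.glue
  | src : Port Kind.glue
  | out : Port Kind.unit
  deriving DecidableEq

namespace Port

instance fintype : (k : Kind) → Fintype (Port k)
  | Kind.lam => ⟨{root, var, body}, fun x => by cases x <;> decide⟩
  | Kind.app => ⟨{cont, arg, fn}, fun x => by cases x <;> decide⟩
  | Kind.glue => ⟨{tgt, src}, fun x => by cases x <;> decide⟩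
  | Kind.unit => ⟨{out}, fun x => by cases x; decide⟩

/-- The next dart in counterclockwise order. -/
def next : {k : Kind} → Port k → Port k
  | _, root => var
  | _, var => body
  | _, body => root
  | _, cont => arg
  | _, arg => fn
  | _, fn => cont
  | _, tgt => src
  | _, src => tgt
  | _, out => out

/-- The previous dart in counterclockwise order. -/
def prev : {k : Kind} → Port k → Port k
  | _, root => body
  | _, var => root
  | _, body => var
  | _, cont => fn
  | _, arg => cont
  | _, fn => arg
  | _, tgt => src
  | _, src => tgt
  | _, out => out

/-- The counterclockwise rotation of the darts of a vertex. -/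
def rot (k : Kind) : Equiv.Perm (Port k) where
  toFun := next
  invFun := prev
  left_inv x := by cases x <;> rfl
  right_inv x := by cases x <;> rfl

/-- Whether a dart is an output of its vertex. -/
def isOut : {k : Kind} → Port k → Bool
  | _, root => true
  | _, var => true
  | _, body => false
  | _, cont => true
  | _, arg => false
  | _, fn => false
  | _, tgt => true
  | _, src => false
  | _, out => true

end Port

section Net

variable {m k : ℕ}

/-- The darts of the vertices of kinds `κ 0, …, κ (m - 1)`, and `k` boundary darts. -/
abbrev NetDart (κ : Fin m → Kind) (k : ℕ) : Type := ((i : Fin m) × Port (κ i)) ⊕ Fin k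

/-- The dart `p` of vertex `i`. -/
abbrev port {κ : Fin m → Kind} (i : Fin m) (p : Port (κ i)) : NetDart κ k := Sum.inl ⟨i, p⟩

/-- The boundary dart `h`. -/
abbrev leg {κ : Fin m → Kind} (h : Fin k) : NetDart κ k := Sum.inr h

/-- The other end of the edge of `w` with one end at `x`. -/
def partner {α : Type} [DecidableEq α] : List (α × α) → α → α
  | [], x => x
  | (a, b) :: w, x => if x = a then b else if x = b then a else partner w x

/-- `w` lists edges from outputs to inputs, such that each dart is an end of exactly one edge. -/
def ValidNet (κ : Fin m → Kind) (w : List (NetDart κ k × NetDart κ k)) : Prop :=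
  (∀ x, partner w (partner w x) = x) ∧ (∀ x, partner w x ≠ x) ∧
  (∀ x, x ∈ w.map Prod.fst ↔ partner w x ∉ w.map Prod.fst) ∧
  (∀ i p, port i p ∈ w.map Prod.fst ↔ Port.isOut p = true)

instance (κ : Fin m → Kind) (w : List (NetDart κ k × NetDart κ k)) : Decidable (ValidNet κ w) := by
  have : ∀ (x : NetDart κ k) (l : List (NetDart κ k)), Decidable (x ∈ l) := fun x l =>
    @List.instDecidableMemOfLawfulBEq _ instBEqOfDecidableEq inferInstance x l
  unfold ValidNet; infer_instance

/-- The well-oriented map with vertices of kinds `κ 0, …, κ (m - 1)`, boundary darts `0, …, k - 1`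
and the list of edges `w`, where an edge `(a, b)` connects the darts `a` and `b` and is oriented
away from the source of `a`. -/
def net (κ : Fin m → Kind) (w : List (NetDart κ k × NetDart κ k)) (hw : ValidNet κ w) :
    OrientedMap (Fin k) where
  D := (i : Fin m) × Port (κ i)
  finite := inferInstance
  rot := Equiv.sigmaCongrRight fun i => Port.rot (κ i)
  e := partner w
  e_invol := hw.1
  e_ne := hw.2.1
  deg_le := by
    rintro ⟨i, p⟩
    have h : p.next = p ∨ p.next.next = p ∨ p.next.next.next = p := by
      generalize κ i = c at p
      cases p <;> simp [Port.next]
    rcases h with h | h | h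
    · exact Or.inl (congrArg (Sigma.mk i) h)
    · exact Or.inr (Or.inl (congrArg (Sigma.mk i) h))
    · exact Or.inr (Or.inr (congrArg (Sigma.mk i) h))
  orient :=
    { pos := {x | x ∈ w.map Prod.fst}
      pos_iff := hw.2.2.1
      well := by
        rintro ⟨i, p⟩ hp
        have h1 : ∀ {c : Kind} (p : Port c), p.next ≠ p → ∃ a b : ℕ,
            (Port.next^[a] p).isOut = true ∧ ¬ (Port.next^[b] p).isOut = true := by
          intro c p h
          cases p
          · exact ⟨0, 2, rfl, by decide⟩
          · exact ⟨0, 1, rfl, by decide⟩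
          · exact ⟨1, 0, rfl, by decide⟩
          · exact ⟨0, 1, rfl, by decide⟩
          · exact ⟨2, 0, rfl, by decide⟩
          · exact ⟨1, 0, rfl, by decide⟩
          · exact ⟨0, 1, rfl, by decide⟩
          · exact ⟨1, 0, rfl, by decide⟩
          · exact absurd rfl h
        have h2 : ∀ a : ℕ, ((Equiv.sigmaCongrRight fun i => Port.rot (κ i)) ^ a) ⟨i, p⟩ =
            (⟨i, Port.next^[a] p⟩ : (i : Fin m) × Port (κ i)) := by
          intro a
          induction a with
          | zero => rfl
          | succ a ih => rw [pow_succ', Equiv.Perm.mul_apply, ih, Function.iterate_succ_apply']; rfl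
        obtain ⟨a, b, ha, hb⟩ := h1 p (fun h => hp (congrArg (Sigma.mk i) h))
        refine ⟨_, _, ⟨a, rfl⟩, ⟨b, rfl⟩, ?_, ?_⟩
        · rw [zpow_natCast, h2]; exact (hw.2.2.2 _ _).2 ha
        · rw [zpow_natCast, h2]; exact fun h => hb ((hw.2.2.2 _ _).1 h) }

end Net

/-! ### The moves -/

/-- A transformation `lhs ⇒ rhs` between well-oriented maps with the same boundary. -/
structure Move where
  k : ℕ
  lhs : OrientedMap (Fin k)
  rhs : OrientedMap (Fin k)

/-- A single edge from boundary dart `0` to boundary dart `1`. -/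
def edgeNet : OrientedMap (Fin 2) :=
  net ![] [(leg 0, leg 1)] (by decide)

/-- An edge from boundary dart `0` to boundary dart `1`, subdivided by one 2-valent vertex. -/
def glueNet : OrientedMap (Fin 2) :=
  net ![.glue] [(leg 0, port 0 .src), (port 0 .tgt, leg 1)] (by decide)

/-- A positive vertex, with boundary darts `0` at its input, `1` and `2` at its outputs. -/
def lamNet : OrientedMap (Fin 3) :=
  net ![.lam] [(leg 0, port 0 .body), (port 0 .var, leg 1), (port 0 .root, leg 2)] (by decide)

/-- A negative vertex, with boundary darts `0` and `1` at its inputs, `2` at its output. -/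
def appNet : OrientedMap (Fin 3) :=
  net ![.app] [(leg 0, port 0 .fn), (leg 1, port 0 .arg), (port 0 .cont, leg 2)] (by decide)

/-- A 1-valent vertex with an output to boundary dart `0`. -/
def unitNet : OrientedMap (Fin 1) :=
  net ![.unit] [(port 0 .out, leg 0)] (by decide)

/-- A subdivision vertex is removed. -/
def moveGlueElim : Move where
  k := 2
  lhs := glueNet
  rhs := edgeNet

/-- A subdivision vertex is doubled. -/
def moveGlueDup : Move where
  k := 2
  lhs := glueNet
  rhs := net ![.glue, .glue]
    [(leg 0, port 0 .src), (port 0 .tgt, port 1 .src), (port 1 .tgt, leg 1)] (by decide)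

/-- The three edges at a positive vertex are subdivided. -/
def moveLamGlue : Move where
  k := 3
  lhs := lamNet
  rhs := net ![.lam, .glue, .glue, .glue]
    [(leg 0, port 1 .src), (port 1 .tgt, port 0 .body),
     (port 0 .var, port 2 .src), (port 2 .tgt, leg 1),
     (port 0 .root, port 3 .src), (port 3 .tgt, leg 2)] (by decide)

/-- The three edges at a negative vertex are subdivided. -/
def moveAppGlue : Move where
  k := 3
  lhs := appNet
  rhs := net ![.app, .glue, .glue, .glue]
    [(leg 0, port 1 .src), (port 1 .tgt, port 0 .fn),
     (leg 1, port 2 .src), (port 2 .tgt, port 0 .arg),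
     (port 0 .cont, port 3 .src), (port 3 .tgt, leg 2)] (by decide)

/-- Unzipping: `(λ x. T₁) T₂ ⇒ T₁[T₂ / x]`.  Boundary: `0` body, `1` variable, `2` argument,
`3` result. -/
def moveBeta : Move where
  k := 4
  lhs := net ![.lam, .app, .glue]
    [(leg 0, port 0 .body), (port 0 .var, leg 1),
     (port 0 .root, port 2 .src), (port 2 .tgt, port 1 .fn),
     (leg 2, port 1 .arg), (port 1 .cont, leg 3)] (by decide)
  rhs := net ![.glue, .glue]
    [(leg 0, port 0 .src), (port 0 .tgt, leg 3),
     (leg 2, port 1 .src), (port 1 .tgt, leg 1)] (by decide)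

/-- Bubbling: `T ⇒ λ x. T x`. -/
def moveEta : Move where
  k := 2
  lhs := glueNet
  rhs := net ![.app, .lam, .glue, .glue]
    [(leg 0, port 0 .fn),
     (port 0 .cont, port 2 .src), (port 2 .tgt, port 1 .body),
     (port 1 .var, port 3 .src), (port 3 .tgt, port 0 .arg),
     (port 1 .root, leg 1)] (by decide)

/-- Composition: `λ x. T ⇒ λ x. λ y. T[x y / x]`. -/
def moveComp : Move where
  k := 3
  lhs := lamNet
  rhs := net ![.lam, .lam, .app]
    [(port 0 .root, leg 2), (port 1 .root, port 0 .body), (leg 0, port 1 .body),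
     (port 0 .var, port 2 .fn), (port 1 .var, port 2 .arg), (port 2 .cont, leg 1)] (by decide)

/-- A negative vertex whose first input comes from a 1-valent vertex. -/
def idNet : OrientedMap (Fin 2) :=
  net ![.app, .unit]
    [(port 1 .out, port 0 .fn), (leg 0, port 0 .arg), (port 0 .cont, leg 1)] (by decide)

/-- The move `ι`, left to right. -/
def moveIota : Move where
  k := 2
  lhs := idNet
  rhs := glueNet

/-- The move `ι`, right to left. -/
def moveIotaInv : Move where
  k := 2
  lhs := glueNet
  rhs := idNet

/-- The unit move: a 1-valent vertex is attached to an edge as the second input of a negative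
vertex. -/
def moveUnit : Move where
  k := 2
  lhs := glueNet
  rhs := net ![.app, .unit]
    [(leg 0, port 0 .fn), (port 1 .out, port 0 .arg), (port 0 .cont, leg 1)] (by decide)

/-- The (planar) imploid moves. -/
def imploidMoves : Set Move :=
  {moveGlueElim, moveGlueDup, moveLamGlue, moveAppGlue, moveBeta, moveEta, moveComp,
    moveIota, moveIotaInv, moveUnit}

/-- The move `χ`: `(T₀ T₁) T₂ ⇒ (T₀ T₂) T₁`. -/
def moveChi : Move where
  k := 4
  lhs := net ![.app, .app]
    [(leg 0, port 0 .fn), (port 0 .cont, port 1 .fn), (port 1 .cont, leg 3),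
     (leg 1, port 0 .arg), (leg 2, port 1 .arg)] (by decide)
  rhs := net ![.app, .app]
    [(leg 0, port 0 .fn), (port 0 .cont, port 1 .fn), (port 1 .cont, leg 3),
     (leg 2, port 0 .arg), (leg 1, port 1 .arg)] (by decide)

/-- The move `C`: a 1-valent vertex is replaced by the crossed tetrahedron
`λ x. λ y. λ z. (x z) y`. -/
def moveC : Move where
  k := 1
  lhs := unitNet
  rhs := net ![.lam, .lam, .lam, .app, .app]
    [(port 0 .root, leg 0), (port 1 .root, port 0 .body), (port 2 .root, port 1 .body),
     (port 3 .cont, port 2 .body), (port 4 .cont, port 3 .fn), (port 0 .var, port 4 .fn),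
     (port 2 .var, port 4 .arg), (port 1 .var, port 3 .arg)] (by decide)

/-- The move `γ`: `T₀ T₁ ⇒ T₁ T₀`. -/
def moveGamma : Move where
  k := 3
  lhs := appNet
  rhs := net ![.app]
    [(leg 1, port 0 .fn), (leg 0, port 0 .arg), (port 0 .cont, leg 2)] (by decide)

/-- The symmetric imploid moves. -/
def symmetricMoves : Set Move := {moveChi, moveC, moveGamma}

/-- `M'` is obtained from `M` by one application of one of the given moves, inside any context. -/
def Step (moves : Set Move) {n : ℕ} (M M' : OrientedRootedMap n) : Prop :=
  ∃ mv ∈ moves, ∃ C : OrientedMap (Fin (n + 1) ⊕ Fin mv.k),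
    IsGluing C mv.lhs M.toOrientedMap ∧ IsGluing C mv.rhs M'.toOrientedMap

/-! ### Spines -/

section Spine

variable {n : ℕ} {D : Type}

/-- The darts of `T` in the map `T(x)`: the root of `T` becomes the first input of a new negative
vertex, whose darts are `0` (output), `1` (second input) and `2` (first input). -/
def appLift : D ⊕ Fin (n + 1) → (D ⊕ Fin 3) ⊕ Fin (n + 2)
  | Sum.inl d => Sum.inl (Sum.inl d)
  | Sum.inr i => if i = 0 then Sum.inl (Sum.inr 2) else Sum.inr i.castSucc

/-- The opposite arcs in the map `T(x)`, where `e` gives those of `T`: the output of the new vertex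
is joined to the root `0`, its second input to the new boundary dart `n + 1`. -/
def appE (e : D ⊕ Fin (n + 1) → D ⊕ Fin (n + 1)) :
    (D ⊕ Fin 3) ⊕ Fin (n + 2) → (D ⊕ Fin 3) ⊕ Fin (n + 2)
  | Sum.inl (Sum.inl d) => appLift (e (Sum.inl d))
  | Sum.inl (Sum.inr 0) => Sum.inr 0
  | Sum.inl (Sum.inr 1) => Sum.inr (Fin.last (n + 1))
  | Sum.inl (Sum.inr 2) => appLift (e (Sum.inr 0))
  | Sum.inr i =>
      if i = 0 then Sum.inl (Sum.inr 0)
      else if h : i = Fin.last (n + 1) then Sum.inl (Sum.inr 1)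
      else appLift (e (Sum.inr (i.castPred h)))

theorem appE_lift (e : D ⊕ Fin (n + 1) → D ⊕ Fin (n + 1)) (x) :
    appE e (appLift x) = appLift (e x) := by
  rcases x with d | i
  · rfl
  · by_cases h : i = 0
    · subst h; simp [appLift, appE]
    · simp [appLift, appE, h, Fin.castSucc_ne_last]

theorem appE_zero (e : D ⊕ Fin (n + 1) → D ⊕ Fin (n + 1)) :
    appE e (Sum.inr 0) = Sum.inl (Sum.inr 0) := by simp [appE]

theorem appE_last (e : D ⊕ Fin (n + 1) → D ⊕ Fin (n + 1)) :
    appE e (Sum.inr (Fin.last (n + 1))) = Sum.inl (Sum.inr 1) := by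
  simp [appE]

theorem appLift_injective : Function.Injective (appLift : D ⊕ Fin (n + 1) → _) := by
  rintro (d | i) (d' | j) h
  · simpa [appLift] using h
  · by_cases hj : j = 0 <;> simp [appLift, hj] at h
  · by_cases hi : i = 0 <;> simp [appLift, hi] at h
  · by_cases hi : i = 0 <;> by_cases hj : j = 0 <;> simp [appLift, hi, hj] at h ⊢
    exact h

theorem appLift_cases (x : (D ⊕ Fin 3) ⊕ Fin (n + 2)) :
    (∃ y, x = appLift y) ∨ x = Sum.inl (Sum.inr 0) ∨ x = Sum.inl (Sum.inr 1) ∨ x = Sum.inr 0 ∨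
      x = Sum.inr (Fin.last (n + 1)) := by
  rcases x with (d | j) | i
  · exact Or.inl ⟨Sum.inl d, rfl⟩
  · fin_cases j
    · simp
    · simp
    · exact Or.inl ⟨Sum.inr 0, by simp [appLift]⟩
  · by_cases h0 : i = 0
    · simp [h0]
    · by_cases hl : i = Fin.last (n + 1)
      · simp [hl]
      · refine Or.inl ⟨Sum.inr (i.castPred hl), ?_⟩
        have : i.castPred hl ≠ 0 := by
          intro h; apply h0; rw [← Fin.castSucc_castPred i hl, h]; rfl
        simp [appLift, this]

theorem appLift_ne (y : D ⊕ Fin (n + 1)) :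
    appLift y ≠ Sum.inl (Sum.inr 0) ∧ appLift y ≠ Sum.inl (Sum.inr 1) ∧
      appLift y ≠ Sum.inr 0 ∧ appLift y ≠ Sum.inr (Fin.last (n + 1)) := by
  rcases y with d | i
  · simp [appLift]
  · by_cases h : i = 0
    · simp [appLift, h]
    · simp [appLift, h, Fin.castSucc_ne_last]

/-- The map `T(x)`, obtained by attaching the root of `T` and a new last boundary arc `x` to the two
inputs of a new negative vertex. -/
def appOpen (T : OpenMap (Fin (n + 1))) : OpenMap (Fin (n + 2)) where
  D := T.D ⊕ Fin 3
  finite := by have := T.finite; infer_instance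
  rot := Equiv.sumCongr T.rot (finRotate 3)
  e := appE T.e
  e_invol := by
    intro x
    rcases appLift_cases x with ⟨y, rfl⟩ | rfl | rfl | rfl | rfl
    · rw [appE_lift, appE_lift, T.e_invol]
    · exact appE_zero _
    · exact appE_last _
    · rw [appE_zero]; rfl
    · rw [appE_last]; rfl
  e_ne := by
    intro x
    rcases appLift_cases x with ⟨y, rfl⟩ | rfl | rfl | rfl | rfl
    · rw [appE_lift]; exact fun h => T.e_ne y (appLift_injective h)
    · simp [appE]
    · simp [appE]
    · simp [appE]
    · rw [appE_last]; simp
  deg_le := by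
    rintro (d | j)
    · simpa using T.deg_le d
    · right; right; fin_cases j <;> rfl

theorem appOpen_connected (T : OpenMap (Fin (n + 1)))
    (hT : ∀ x y, Relation.EqvGen T.Adj x y) (x y : (appOpen T).D ⊕ Fin (n + 2)) :
    Relation.EqvGen (appOpen T).Adj x y := by
  have hl : ∀ x y, Relation.EqvGen T.Adj x y →
      Relation.EqvGen (appOpen T).Adj (appLift x) (appLift y) := by
    intro x y h
    induction h with
    | rel x y h =>
      cases h with
      | edge x =>
        rw [← appE_lift]
        exact .rel _ _ (.edge (M := appOpen T) _)
      | vertex d => exact .rel _ _ (.vertex (M := appOpen T) (Sum.inl d))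
    | refl x => exact .refl _
    | symm x y _ ih => exact .symm _ _ ih
    | trans x y z _ _ ih1 ih2 => exact .trans _ _ _ ih1 ih2
  have hv : ∀ j : Fin 3, Relation.EqvGen (appOpen T).Adj (Sum.inl (Sum.inr j))
      (Sum.inl (Sum.inr (j + 1))) := fun j => by
    have := OpenMap.Adj.vertex (M := appOpen T) (Sum.inr j)
    have h2 : (appOpen T).rot (Sum.inr j) = Sum.inr (j + 1) := by
      fin_cases j <;> rfl
    rw [h2] at this
    exact .rel _ _ this
  have hf : (appLift (Sum.inr 0) : (T.D ⊕ Fin 3) ⊕ Fin (n + 2)) = Sum.inl (Sum.inr 2) := by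
    simp [appLift]
  have h0 : Relation.EqvGen (appOpen T).Adj (Sum.inl (Sum.inr 0)) (appLift (Sum.inr 0)) := by
    rw [hf]; exact .trans _ _ _ (hv 0) (hv 1)
  have h1 : Relation.EqvGen (appOpen T).Adj (Sum.inl (Sum.inr 1)) (appLift (Sum.inr 0)) := by
    rw [hf]; exact hv 1
  have hall : ∀ x, Relation.EqvGen (appOpen T).Adj x (appLift (Sum.inr 0)) := by
    intro x
    rcases appLift_cases x with ⟨y, rfl⟩ | rfl | rfl | rfl | rfl
    · exact hl _ _ (hT _ _)
    · exact h0
    · exact h1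
    · have h := OpenMap.Adj.edge (M := appOpen T) (Sum.inr 0)
      have h' : (appOpen T).e (Sum.inr 0) = Sum.inl (Sum.inr 0) := appE_zero T.e
      rw [h'] at h
      exact .trans _ _ _ (.rel _ _ h) h0
    · have h := OpenMap.Adj.edge (M := appOpen T) (Sum.inr (Fin.last (n + 1)))
      have h' : (appOpen T).e (Sum.inr (Fin.last (n + 1))) = Sum.inl (Sum.inr 1) := appE_last T.e
      rw [h'] at h
      exact .trans _ _ _ (.rel _ _ h) h1
  exact .trans _ _ _ (hall x) (.symm _ _ (hall y))

theorem sameCycle_sum_inl {D E : Type} (p : Equiv.Perm D) (q : Equiv.Perm E) {a b : D}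
    (h : p.SameCycle a b) :
    Equiv.Perm.SameCycle (Equiv.sumCongr p q) (Sum.inl a) (Sum.inl b) := by
  obtain ⟨k, rfl⟩ := h
  refine ⟨k, ?_⟩
  have : (Equiv.sumCongr p q : Equiv.Perm (D ⊕ E)) = Equiv.Perm.sumCongrHom D E (p, q) := rfl
  rw [this, ← map_zpow]
  rfl

/-- The orientation of `T(x)` that extends the orientation `O` of `T`. -/
def appPos (O : Set (D ⊕ Fin (n + 1))) : Set ((D ⊕ Fin 3) ⊕ Fin (n + 2)) :=
  {x | (∃ y ∈ O, appLift y = x) ∨ x = Sum.inl (Sum.inr 0) ∨ x = Sum.inr (Fin.last (n + 1))}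

theorem appPos_lift (O : Set (D ⊕ Fin (n + 1))) (y) : appLift y ∈ appPos O ↔ y ∈ O := by
  constructor
  · rintro (⟨z, hz, h⟩ | h | h)
    · exact appLift_injective h ▸ hz
    · exact absurd h (appLift_ne y).1
    · exact absurd h (appLift_ne y).2.2.2
  · exact fun h => Or.inl ⟨y, h, rfl⟩

theorem appPos_cont (O : Set (D ⊕ Fin (n + 1))) : Sum.inl (Sum.inr 0) ∈ appPos O := by
  simp [appPos]

theorem appPos_last (O : Set (D ⊕ Fin (n + 1))) : Sum.inr (Fin.last (n + 1)) ∈ appPos O := by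
  simp [appPos]

theorem appPos_arg (O : Set (D ⊕ Fin (n + 1))) : Sum.inl (Sum.inr 1) ∉ appPos O := by
  simp [appPos, (appLift_ne _).2.1]

theorem appPos_zero (O : Set (D ⊕ Fin (n + 1))) : Sum.inr 0 ∉ appPos O := by
  simp [appPos, (appLift_ne _).2.2.1, Fin.ext_iff]

theorem appPos_iff (e : D ⊕ Fin (n + 1) → D ⊕ Fin (n + 1)) (O : Set (D ⊕ Fin (n + 1)))
    (h : ∀ x, x ∈ O ↔ e x ∉ O) (x) : x ∈ appPos O ↔ appE e x ∉ appPos O := by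
  rcases appLift_cases x with ⟨y, rfl⟩ | rfl | rfl | rfl | rfl
  · rw [appE_lift, appPos_lift, appPos_lift]; exact h y
  · exact iff_of_true (appPos_cont O) (appPos_zero O)
  · exact iff_of_false (appPos_arg O) (not_not.2 (appPos_last O))
  · rw [appE_zero]; exact iff_of_false (appPos_zero O) (not_not.2 (appPos_cont O))
  · rw [appE_last]; exact iff_of_true (appPos_last O) (appPos_arg O)

/-- The orientation of `T(x)` that extends an orientation of `T`. -/
def appOrient (T : OpenMap (Fin (n + 1))) (o : Orientation T) : Orientation (appOpen T) where
  pos := appPos o.pos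
  pos_iff := appPos_iff T.e o.pos o.pos_iff
  well := by
    rintro (d | j) hd
    · obtain ⟨a, b, ha, hb, ha', hb'⟩ := o.well d (fun h => hd (congrArg Sum.inl h))
      exact ⟨Sum.inl a, Sum.inl b, sameCycle_sum_inl _ _ ha, sameCycle_sum_inl _ _ hb,
        (appPos_lift o.pos (Sum.inl a)).2 ha', fun h => hb' ((appPos_lift o.pos (Sum.inl b)).1 h)⟩
    · have hc : ∀ i j : Fin 3, (appOpen T).rot.SameCycle (Sum.inr i) (Sum.inr j) := by
        intro i j
        refine ⟨((j - i : Fin 3) : ℕ), ?_⟩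
        rw [zpow_natCast]
        fin_cases i <;> fin_cases j <;> rfl
      exact ⟨Sum.inr 0, Sum.inr 1, hc _ _, hc _ _, appPos_cont o.pos, appPos_arg o.pos⟩

/-- The darts of `T` in the map obtained by subdividing the root edge of `T` by a 2-valent vertex,
whose darts are `0` (output) and `1` (input). -/
def glueLift : D ⊕ Fin (n + 1) → (D ⊕ Fin 2) ⊕ Fin (n + 1)
  | Sum.inl d => Sum.inl (Sum.inl d)
  | Sum.inr i => if i = 0 then Sum.inl (Sum.inr 1) else Sum.inr i

/-- The opposite arcs in the map obtained by subdividing the root edge. -/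
def glueE (e : D ⊕ Fin (n + 1) → D ⊕ Fin (n + 1)) :
    (D ⊕ Fin 2) ⊕ Fin (n + 1) → (D ⊕ Fin 2) ⊕ Fin (n + 1)
  | Sum.inl (Sum.inl d) => glueLift (e (Sum.inl d))
  | Sum.inl (Sum.inr 0) => Sum.inr 0
  | Sum.inl (Sum.inr 1) => glueLift (e (Sum.inr 0))
  | Sum.inr i => if i = 0 then Sum.inl (Sum.inr 0) else glueLift (e (Sum.inr i))

theorem glueE_lift (e : D ⊕ Fin (n + 1) → D ⊕ Fin (n + 1)) (x) :
    glueE e (glueLift x) = glueLift (e x) := by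
  rcases x with d | i
  · rfl
  · by_cases h : i = 0
    · subst h; simp [glueLift, glueE]
    · simp [glueLift, glueE, h]

theorem glueE_zero (e : D ⊕ Fin (n + 1) → D ⊕ Fin (n + 1)) :
    glueE e (Sum.inr 0) = Sum.inl (Sum.inr 0) := by simp [glueE]

theorem glueLift_injective : Function.Injective (glueLift : D ⊕ Fin (n + 1) → _) := by
  rintro (d | i) (d' | j) h
  · simpa [glueLift] using h
  · by_cases hj : j = 0 <;> simp [glueLift, hj] at h
  · by_cases hi : i = 0 <;> simp [glueLift, hi] at h
  · by_cases hi : i = 0 <;> by_cases hj : j = 0 <;> simp [glueLift, hi, hj] at h ⊢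
    exact h

theorem glueLift_cases (x : (D ⊕ Fin 2) ⊕ Fin (n + 1)) :
    (∃ y, x = glueLift y) ∨ x = Sum.inl (Sum.inr 0) ∨ x = Sum.inr 0 := by
  rcases x with (d | j) | i
  · exact Or.inl ⟨Sum.inl d, rfl⟩
  · fin_cases j
    · simp
    · exact Or.inl ⟨Sum.inr 0, by simp [glueLift]⟩
  · by_cases h0 : i = 0
    · simp [h0]
    · exact Or.inl ⟨Sum.inr i, by simp [glueLift, h0]⟩

theorem glueLift_ne (y : D ⊕ Fin (n + 1)) :
    glueLift y ≠ Sum.inl (Sum.inr 0) ∧ glueLift y ≠ Sum.inr 0 := by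
  rcases y with d | i
  · simp [glueLift]
  · by_cases h : i = 0 <;> simp [glueLift, h]

/-- The map obtained by subdividing the root edge of `T`. -/
def glueOpen (T : OpenMap (Fin (n + 1))) : OpenMap (Fin (n + 1)) where
  D := T.D ⊕ Fin 2
  finite := by have := T.finite; infer_instance
  rot := Equiv.sumCongr T.rot (finRotate 2)
  e := glueE T.e
  e_invol := by
    intro x
    rcases glueLift_cases x with ⟨y, rfl⟩ | rfl | rfl
    · rw [glueE_lift, glueE_lift, T.e_invol]
    · exact glueE_zero _
    · rw [glueE_zero]; rfl
  e_ne := by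
    intro x
    rcases glueLift_cases x with ⟨y, rfl⟩ | rfl | rfl
    · rw [glueE_lift]; exact fun h => T.e_ne y (glueLift_injective h)
    · simp [glueE]
    · simp [glueE]
  deg_le := by
    rintro (d | j)
    · simpa using T.deg_le d
    · right; left; fin_cases j <;> rfl

theorem glueOpen_connected (T : OpenMap (Fin (n + 1)))
    (hT : ∀ x y, Relation.EqvGen T.Adj x y) (x y : (glueOpen T).D ⊕ Fin (n + 1)) :
    Relation.EqvGen (glueOpen T).Adj x y := by
  have hl : ∀ x y, Relation.EqvGen T.Adj x y →
      Relation.EqvGen (glueOpen T).Adj (glueLift x) (glueLift y) := by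
    intro x y h
    induction h with
    | rel x y h =>
      cases h with
      | edge x =>
        rw [← glueE_lift]
        exact .rel _ _ (.edge (M := glueOpen T) _)
      | vertex d => exact .rel _ _ (.vertex (M := glueOpen T) (Sum.inl d))
    | refl x => exact .refl _
    | symm x y _ ih => exact .symm _ _ ih
    | trans x y z _ _ ih1 ih2 => exact .trans _ _ _ ih1 ih2
  have hf : (glueLift (Sum.inr 0) : (T.D ⊕ Fin 2) ⊕ Fin (n + 1)) = Sum.inl (Sum.inr 1) := by
    simp [glueLift]
  have h0 : Relation.EqvGen (glueOpen T).Adj (Sum.inl (Sum.inr 0)) (glueLift (Sum.inr 0)) := by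
    rw [hf]; exact .rel _ _ (OpenMap.Adj.vertex (M := glueOpen T) (Sum.inr 0))
  have hall : ∀ x, Relation.EqvGen (glueOpen T).Adj x (glueLift (Sum.inr 0)) := by
    intro x
    rcases glueLift_cases x with ⟨y, rfl⟩ | rfl | rfl
    · exact hl _ _ (hT _ _)
    · exact h0
    · have h := OpenMap.Adj.edge (M := glueOpen T) (Sum.inr 0)
      have h' : (glueOpen T).e (Sum.inr 0) = Sum.inl (Sum.inr 0) := glueE_zero T.e
      rw [h'] at h
      exact .trans _ _ _ (.rel _ _ h) h0
  exact .trans _ _ _ (hall x) (.symm _ _ (hall y))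

/-- The orientation of the subdivided map that extends the orientation `O` of `T`. -/
def gluePos (O : Set (D ⊕ Fin (n + 1))) : Set ((D ⊕ Fin 2) ⊕ Fin (n + 1)) :=
  {x | (∃ y ∈ O, glueLift y = x) ∨ x = Sum.inl (Sum.inr 0)}

theorem gluePos_lift (O : Set (D ⊕ Fin (n + 1))) (y) : glueLift y ∈ gluePos O ↔ y ∈ O := by
  constructor
  · rintro (⟨z, hz, h⟩ | h)
    · exact glueLift_injective h ▸ hz
    · exact absurd h (glueLift_ne y).1
  · exact fun h => Or.inl ⟨y, h, rfl⟩

theorem gluePos_tgt (O : Set (D ⊕ Fin (n + 1))) : Sum.inl (Sum.inr 0) ∈ gluePos O := by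
  simp [gluePos]

theorem gluePos_zero (O : Set (D ⊕ Fin (n + 1))) : Sum.inr 0 ∉ gluePos O := by
  simp [gluePos, (glueLift_ne _).2]

theorem gluePos_src (O : Set (D ⊕ Fin (n + 1))) (h0 : Sum.inr 0 ∉ O) :
    Sum.inl (Sum.inr 1) ∉ gluePos O := by
  have h : glueLift (Sum.inr 0 : D ⊕ Fin (n + 1)) = Sum.inl (Sum.inr 1) := by simp [glueLift]
  rw [← h, gluePos_lift]; exact h0

theorem gluePos_iff (e : D ⊕ Fin (n + 1) → D ⊕ Fin (n + 1)) (O : Set (D ⊕ Fin (n + 1)))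
    (h : ∀ x, x ∈ O ↔ e x ∉ O) (x) : x ∈ gluePos O ↔ glueE e x ∉ gluePos O := by
  rcases glueLift_cases x with ⟨y, rfl⟩ | rfl | rfl
  · rw [glueE_lift, gluePos_lift, gluePos_lift]; exact h y
  · exact iff_of_true (gluePos_tgt O) (gluePos_zero O)
  · rw [glueE_zero]; exact iff_of_false (gluePos_zero O) (not_not.2 (gluePos_tgt O))

/-- The orientation of the subdivided map that extends an orientation of `T` with the root
as an output. -/
def glueOrient (T : OpenMap (Fin (n + 1))) (o : Orientation T) (h0 : Sum.inr 0 ∉ o.pos) :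
    Orientation (glueOpen T) where
  pos := gluePos o.pos
  pos_iff := gluePos_iff T.e o.pos o.pos_iff
  well := by
    rintro (d | j) hd
    · obtain ⟨a, b, ha, hb, ha', hb'⟩ := o.well d (fun h => hd (congrArg Sum.inl h))
      exact ⟨Sum.inl a, Sum.inl b, sameCycle_sum_inl _ _ ha, sameCycle_sum_inl _ _ hb,
        (gluePos_lift o.pos (Sum.inl a)).2 ha', fun h => hb' ((gluePos_lift o.pos (Sum.inl b)).1 h)⟩
    · have hc : ∀ i j : Fin 2, (glueOpen T).rot.SameCycle (Sum.inr i) (Sum.inr j) := by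
        intro i j
        refine ⟨((j - i : Fin 2) : ℕ), ?_⟩
        rw [zpow_natCast]
        fin_cases i <;> fin_cases j <;> rfl
      exact ⟨Sum.inr 0, Sum.inr 1, hc _ _, hc _ _, gluePos_tgt o.pos, gluePos_src o.pos h0⟩

/-- The spine `V_n`: `V_0` is a 1-valent vertex joined to the root, and `V_{n+1}` is `V_n(x)`. -/
def spine : (n : ℕ) → OrientedMap (Fin (n + 1))
  | 0 => unitNet
  | n + 1 =>
    { appOpen (spine n).toOpenMap with
      orient := appOrient (spine n).toOpenMap (spine n).orient }

theorem spine_connected (n : ℕ) (x y) : Relation.EqvGen (spine n).Adj x y := by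
  induction n with
  | zero =>
    have h : ∀ z : unitNet.D ⊕ Fin 1, Relation.EqvGen unitNet.Adj z (Sum.inr 0) := by
      rintro (⟨i, p⟩ | i)
      · fin_cases i
        cases p
        exact .rel _ _ (.edge (M := unitNet.toOpenMap) (Sum.inl ⟨0, .out⟩))
      · fin_cases i
        exact .refl _
    exact .trans _ _ _ (h x) (.symm _ _ (h y))
  | succ n ih => exact appOpen_connected _ ih x y

theorem spine_root (n : ℕ) : Sum.inr 0 ∉ (spine n).pos := by
  cases n with
  | zero =>
    change ¬ (leg 0 ∈ List.map Prod.fst [(_, leg 0)])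
    simp
  | succ n => exact appPos_zero (spine n).pos

/-- The map `V'_n`, the spine `V_n` with its root edge subdivided by one 2-valent vertex. -/
def spine' (n : ℕ) : OrientedRootedMap n where
  toOpenMap := glueOpen (spine n).toOpenMap
  connected := glueOpen_connected _ (spine_connected n)
  orient := glueOrient (spine n).toOpenMap (spine n).orient (spine_root n)

end Spine

/-- `M` can be obtained, up to isomorphism, from the `V'_n` by finitely many of the given moves. -/
def GeneratedBy (moves : Set Move) {n : ℕ} (M : OrientedRootedMap n) : Prop :=
  ∃ S : OrientedRootedMap n, Isomorphic (spine' n).toOrientedMap S.toOrientedMap ∧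
    Relation.ReflTransGen (Step moves) S M

/-- The rooted map `M` with the orientation `o`. -/
def RootedMap.withOrientation {n : ℕ} (M : RootedMap n) (o : Orientation M.toOpenMap) :
    OrientedRootedMap n :=
  { M with orient := o }

end ImploidMoves

/-! A topologically oriented map is a term: the recursion that removes the root vertex reads a
1-valent vertex as `I`, a 2-valent vertex as a bullet, a connected remainder as an abstraction and a
disconnected one as an application, while a bare edge is a variable. In such a term every variable
is used exactly once. For a planar map the variables are moreover used in the order of the boundary;
for arbitrary genus only up to permutation. So it suffices to derive terms from spines.

The moves are read backwards, from the given map towards the spine. Edges receive names, a map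
becomes a multiset of vertices whose ports carry names (`Net`), and a move becomes local rewriting
of such multisets. The conditions for a multiset to describe a map are linear inequalities in the
numbers of occurrences of each name (`Valid`, `proper_iff_valid`). `simulates_move` and
`simulates_elim` translate a rewriting step into an actual gluing of maps; the remaining work is
carried out with the predicate `Back`.

The combinatorial core is `Back.spine_of_term`: a term below a bullet comes from a spine below a
bullet. A variable x comes from I(x) by ι. An abstraction λx.V(x) of a spine comes from V by η. An
application V(W) of two spines comes from a single spine (`Back.split`): by the unit move V becomes
V(I), and (A(B))(x) ⇒ A(B(x)) is derivable from η, composition and β (`Back.assoc`), so the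
arguments of W can be moved inside one at a time. Bullets are inserted wherever a move demands them
by undoing their elimination, and superfluous ones are absorbed by doubling or by subdivision around
a negative vertex. The exchange of two neighbouring arguments of a spine, needed in the nonplanar
case, follows from any one of χ, γ and C (`CanSwap`).

Two facts about maps remain. A topological orientation exists by induction on the set of darts,
according to what can be reached after the root vertex is removed (`exists_topologicalAt`). In genus
zero the decomposition respects the order of the boundary (`TopologicalAt.topList_of_drawn`). For
the latter, the submap under consideration is kept inside an ambient pair of permutations satisfying
Euler's formula; removal of the root vertex becomes contraction of the root edge
(`GenusZero.contract`), which splices the other darts of the vertex into the boundary cycle. At an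
application, the boundary cycle must consist of one interval for each component
(`GenusZero.split_path`): cutting a vertex at two corners of one face increases both vertices and
faces by one, and since the genus cannot be negative (`numOrbits_add_le`), it disconnects the map.
This is the combinatorial Jordan curve argument. -/

namespace ImploidMoves

/-! ### Labelled darts and their realizations -/

/-- Darts with a rotation, a set of outputs, and for every dart the name of its edge. -/
structure Pre where
  D : Type
  rot : Equiv.Perm D
  out : D → Prop
  lab : D → ℕ

namespace Pre

/-- The disjoint union. -/
abbrev sum (p q : Pre) : Pre :=
  ⟨p.D ⊕ q.D, Equiv.sumCongr p.rot q.rot, Sum.elim p.out q.out, Sum.elim p.lab q.lab⟩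

/-- The edge names of darts and boundary darts. -/
abbrev labB {B : Type} (p : Pre) (β : B → ℕ) : p.D ⊕ B → ℕ := Sum.elim p.lab β

/-- The orientation of darts and boundary darts. -/
abbrev outB {B : Type} (p : Pre) (pol : B → Prop) : p.D ⊕ B → Prop := Sum.elim p.out pol

/-- The conditions on vertices in a well-oriented map. -/
structure Good (p : Pre) : Prop where
  finite : Finite p.D
  deg_le : ∀ d, p.rot d = d ∨ p.rot (p.rot d) = d ∨ p.rot (p.rot (p.rot d)) = d
  well : ∀ d, p.rot d ≠ d → ∃ a b, p.rot.SameCycle d a ∧ p.rot.SameCycle d b ∧ p.out a ∧ ¬ p.out b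

/-- Every edge name that occurs is the name of exactly one output and one input. -/
structure Proper {B : Type} (p : Pre) (β : B → ℕ) (pol : B → Prop) : Prop where
  ex : ∀ x, ∃ y, p.labB β y = p.labB β x ∧ (p.outB pol y ↔ ¬ p.outB pol x)
  uniq : ∀ x y, p.labB β x = p.labB β y → (p.outB pol x ↔ p.outB pol y) → x = y

/-- The well-oriented map in which darts with the same name form an edge. -/
noncomputable def toMap {B : Type} (p : Pre) (hp : p.Good) (β : B → ℕ) (pol : B → Prop)
    (h : p.Proper β pol) : OrientedMap B where
  D := p.D
  finite := hp.finite
  rot := p.rot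
  e x := (h.ex x).choose
  e_invol x := by
    have h1 := (h.ex x).choose_spec
    have h2 := (h.ex (h.ex x).choose).choose_spec
    -- The partner of the partner has the name and the polarity of the original dart.
    exact h.uniq _ _ (h2.1.trans h1.1) (by rw [h2.2, h1.2, not_not])
  e_ne x hx := by
    have h1 := (h.ex x).choose_spec
    rw [hx] at h1
    tauto
  deg_le := hp.deg_le
  orient :=
    { pos := {x | p.outB pol x}
      pos_iff x := by
        have h1 := (h.ex x).choose_spec
        change p.outB pol x ↔ ¬ p.outB pol (h.ex x).choose
        rw [h1.2, not_not]
      well := hp.well }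

theorem toMap_e {B : Type} (p : Pre) (hp : p.Good) (β : B → ℕ) (pol : B → Prop)
    (h : p.Proper β pol) (x) : p.labB β ((p.toMap hp β pol h).e x) = p.labB β x :=
  (h.ex x).choose_spec.1

end Pre

/-- `M` is a map with darts `p` and boundary names `β`, where the boundary darts in `pol` are
directed into the map. -/
structure Realization {B : Type} (M : OrientedMap B) (p : Pre) (β : B → ℕ) (pol : B → Prop) where
  φ : p.D ≃ M.D
  rot : ∀ d, M.rot (φ d) = φ (p.rot d)
  pos : ∀ x, Sum.map φ id x ∈ M.pos ↔ p.outB pol x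
  lab : ∀ x y, M.e (Sum.map φ id x) = Sum.map φ id y → p.labB β y = p.labB β x

theorem sum_map_surj {X Y B : Type} (φ : X ≃ Y) (y : Y ⊕ B) : ∃ x, Sum.map φ id x = y := by
  rcases y with d | b
  · exact ⟨Sum.inl (φ.symm d), by simp⟩
  · exact ⟨Sum.inr b, rfl⟩

theorem sum_map_inj {X Y B : Type} (φ : X ≃ Y) {x y : X ⊕ B}
    (h : Sum.map φ id x = Sum.map φ id y) : x = y :=
  Sum.map_injective.2 ⟨φ.injective, Function.injective_id⟩ h

namespace Realization

variable {B : Type} {M : OrientedMap B} {p : Pre} {β : B → ℕ} {pol : B → Prop}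

/-- A realization only asks names to be constant on edges. Since a proper naming leaves room for one
output and one input per name, and opposite arcs differ in polarity, the names then determine the
whole edge involution. -/
theorem e_iff (R : Realization M p β pol) (h : p.Proper β pol) (x y) :
    M.e (Sum.map R.φ id x) = Sum.map R.φ id y ↔ x ≠ y ∧ p.labB β x = p.labB β y := by
  constructor
  · intro hxy
    refine ⟨?_, (R.lab x y hxy).symm⟩
    rintro rfl
    exact M.e_ne _ hxy
  · rintro ⟨hne, hl⟩
    obtain ⟨z, hz⟩ := sum_map_surj R.φ (M.e (Sum.map R.φ id x))
    have h1 := R.lab x z hz.symm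
    have h2 := M.orient.pos_iff (Sum.map R.φ id x)
    rw [← hz] at h2
    have h3 : ¬ (p.outB pol x ↔ p.outB pol y) := fun h' => hne (h.uniq _ _ hl h')
    have h4 := R.pos x
    have h5 := R.pos z
    have : z = y := h.uniq _ _ (h1.trans hl) (by unfold OrientedMap.pos at h4 h5; tauto)
    rw [← this, hz]

/-- The realization of a map by itself. -/
noncomputable def self (p : Pre) (hp : p.Good) (h : p.Proper β pol) :
    Realization (p.toMap hp β pol h) p β pol where
  φ := Equiv.refl _
  rot _ := rfl
  pos x := by
    rcases x with d | b <;> exact Iff.rfl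
  lab x y hxy := by
    have h1 := p.toMap_e hp β pol h x
    have hx : Sum.map (Equiv.refl p.D) (id : B → B) x = x := by rcases x with d | b <;> rfl
    have hy : Sum.map (Equiv.refl p.D) (id : B → B) y = y := by rcases y with d | b <;> rfl
    erw [hx, hy] at hxy
    rw [← h1, hxy]

/-- Both edge involutions are determined by the same names through `e_iff`, so matching the labelled
darts matches everything. -/
theorem isomorphic {N : OrientedMap B} (R : Realization M p β pol) (R' : Realization N p β pol)
    (h : p.Proper β pol) : Isomorphic M N := by
  have hm : ∀ x, Sum.map (R.φ.symm.trans R'.φ) id (Sum.map R.φ (id : B → B) x) =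
      Sum.map R'.φ id x := by
    rintro (d | b) <;> simp
  refine ⟨R.φ.symm.trans R'.φ, fun d => ?_, fun x => ?_, fun x => ?_⟩
  · obtain ⟨d, rfl⟩ := R.φ.surjective d
    rw [R.rot]
    simp [R'.rot]
  · obtain ⟨x, rfl⟩ := sum_map_surj R.φ x
    obtain ⟨y, hy⟩ := sum_map_surj R.φ (M.e (Sum.map R.φ id x))
    rw [← hy, hm, hm, R'.e_iff h, ← R.e_iff h, hy]
  · obtain ⟨x, rfl⟩ := sum_map_surj R.φ x
    rw [hm, R.pos, R'.pos]

/-- Transport along an isomorphism of labelled darts. -/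
def congr {q : Pre} (R : Realization M p β pol) (f : q.D ≃ p.D)
    (hrot : ∀ d, p.rot (f d) = f (q.rot d)) (hout : ∀ d, p.out (f d) ↔ q.out d)
    (hlab : ∀ d, p.lab (f d) = q.lab d) : Realization M q β pol where
  φ := f.trans R.φ
  rot d := by simp [R.rot, hrot]
  pos x := by
    rcases x with d | b
    · exact (R.pos (Sum.inl (f d))).trans (hout d)
    · exact R.pos (Sum.inr b)
  lab x y hxy := by
    have hs : ∀ z : q.D ⊕ B, Sum.map (f.trans R.φ) id z = Sum.map R.φ id (Sum.map f id z) := by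
      rintro (d | b) <;> rfl
    have hl : ∀ z : q.D ⊕ B, p.labB β (Sum.map f id z) = q.labB β z := by
      rintro (d | b)
      · exact hlab d
      · rfl
    rw [hs, hs] at hxy
    have := R.lab _ _ hxy
    rwa [hl, hl] at this

end Realization

theorem Pre.Proper.congr {B : Type} {p q : Pre} {β : B → ℕ} {pol : B → Prop}
    (h : p.Proper β pol) (f : q.D ≃ p.D) (hout : ∀ d, p.out (f d) ↔ q.out d)
    (hlab : ∀ d, p.lab (f d) = q.lab d) : q.Proper β pol := by
  have hl : ∀ z : q.D ⊕ B, p.labB β (Sum.map f id z) = q.labB β z := by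
    rintro (d | b)
    · exact hlab d
    · rfl
  have ho : ∀ z : q.D ⊕ B, p.outB pol (Sum.map f id z) ↔ q.outB pol z := by
    rintro (d | b)
    · exact hout d
    · exact Iff.rfl
  refine ⟨fun x => ?_, fun x y h1 h2 => ?_⟩
  · obtain ⟨y, hy⟩ := h.ex (Sum.map f id x)
    obtain ⟨y, rfl⟩ := sum_map_surj f y
    exact ⟨y, by rw [← hl, ← hl, hy.1], by rw [← ho, ← ho, hy.2]⟩
  · exact sum_map_inj f (h.uniq _ _ (by rw [hl, hl, h1]) (by rw [ho, ho, h2]))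

/-! ### Gluing in terms of edge names -/

section Glue

variable {B H : Type}

/-- The darts of `P` with edge names `g`. -/
abbrev ofMap (P : OrientedMap H) (g : P.D ⊕ H → ℕ) : Pre :=
  ⟨P.D, P.rot, fun d => Sum.inl d ∈ P.pos, fun d => g (Sum.inl d)⟩

/-- The position in a glued map of an end of an edge of the context, where `att h` is the dart of
the pattern at the leg `h`. -/
def theta {X Y : Type} (att : H → Y) : X ⊕ (B ⊕ H) → (X ⊕ Y) ⊕ B
  | Sum.inl d => Sum.inl (Sum.inl d)
  | Sum.inr (Sum.inl b) => Sum.inr b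
  | Sum.inr (Sum.inr h) => Sum.inl (Sum.inr (att h))

variable (pc : Pre) (P : OrientedMap H) (g : P.D ⊕ H → ℕ) (β : B → ℕ) (pol : B → Prop)
  (att : H → P.D)

/-- Names at the boundary of the context. -/
abbrev ctxLab : B ⊕ H → ℕ := Sum.elim β fun h => g (Sum.inr h)

/-- Orientation of the boundary of the context. -/
abbrev ctxPol : B ⊕ H → Prop := Sum.elim pol fun h => Sum.inr h ∉ P.pos

variable {pc P g β pol att}

theorem theta_lab (hg : ∀ x, g (P.e x) = g x) (hatt : ∀ h, P.e (Sum.inr h) = Sum.inl (att h))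
    (z : pc.D ⊕ (B ⊕ H)) :
    (pc.sum (ofMap P g)).labB β (theta att z) = pc.labB (ctxLab P g β) z := by
  rcases z with d | b | h
  · rfl
  · rfl
  · change g (Sum.inl (att h)) = g (Sum.inr h)
    rw [← hatt, hg]

theorem theta_out (hatt : ∀ h, P.e (Sum.inr h) = Sum.inl (att h)) (z : pc.D ⊕ (B ⊕ H)) :
    (pc.sum (ofMap P g)).outB pol (theta att z) ↔ pc.outB (ctxPol P pol) z := by
  rcases z with d | b | h
  · rfl
  · rfl
  · change Sum.inl (att h) ∈ P.pos ↔ Sum.inr h ∉ P.pos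
    rw [← hatt]
    have := P.orient.pos_iff (Sum.inr h)
    unfold OrientedMap.pos
    tauto

theorem theta_inj (hatt : ∀ h, P.e (Sum.inr h) = Sum.inl (att h)) {X : Type} :
    Function.Injective (theta (X := X) (B := B) att) := by
  have hi : Function.Injective att := fun a b hab => by
    have : P.e (Sum.inr a) = P.e (Sum.inr b) := by rw [hatt, hatt, hab]
    simpa using P.e_invol.injective this
  rintro (d | b | h) (d' | b' | h') hh <;> simp_all [theta]
  exact hi hh

/-- A dart of the glued map ends either an edge of the context or an edge that lies entirely inside
the pattern. The last clause makes the alternatives exclusive: the partner of an inner dart is not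
attached to a leg. -/
theorem theta_cases (hatt : ∀ h, P.e (Sum.inr h) = Sum.inl (att h)) {X : Type}
    (x : (X ⊕ P.D) ⊕ B) :
    (∃ z, x = theta att z) ∨
      ∃ d d', x = Sum.inl (Sum.inr d) ∧ P.e (Sum.inl d) = Sum.inl d' ∧
        ∀ z : X ⊕ (B ⊕ H), theta att z ≠ Sum.inl (Sum.inr d') := by
  rcases x with (d | d) | b
  · exact Or.inl ⟨Sum.inl d, rfl⟩
  · rcases hd : P.e (Sum.inl d) with d' | h
    · refine Or.inr ⟨d, d', rfl, hd, ?_⟩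
      rintro (z | b | h) hz
      · simp [theta] at hz
      · simp [theta] at hz
      · simp only [theta, Sum.inl.injEq, Sum.inr.injEq] at hz
        have := hatt h
        rw [hz, ← hd, ] at this
        simpa using P.e_invol.injective this
    · refine Or.inl ⟨Sum.inr (Sum.inr h), ?_⟩
      have := hatt h
      rw [← hd, P.e_invol] at this
      simp [theta, ← Sum.inl.inj this]
  · exact Or.inl ⟨Sum.inr (Sum.inl b), rfl⟩

theorem Pre.Proper.context (h : (pc.sum (ofMap P g)).Proper β pol) (hg : ∀ x, g (P.e x) = g x)
    (hatt : ∀ h, P.e (Sum.inr h) = Sum.inl (att h)) :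
    pc.Proper (ctxLab P g β) (ctxPol P pol) := by
  refine ⟨fun z => ?_, fun z z' h1 h2 => ?_⟩
  · obtain ⟨y, hy1, hy2⟩ := h.ex (theta att z)
    rcases theta_cases hatt y with ⟨z', rfl⟩ | ⟨d, d', rfl, hd, hz⟩
    · exact ⟨z', (theta_lab hg hatt z').symm.trans (hy1.trans (theta_lab hg hatt z)),
        (theta_out hatt z').symm.trans (hy2.trans (not_congr (theta_out hatt z)))⟩
    -- The inner partner `d'` of `d` would be a second dart with the name and polarity of `theta att
    -- z`.
    · exfalso
      apply hz z
      refine h.uniq _ _ (hy1.symm.trans ?_) ?_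
      · change g (Sum.inl d) = g (Sum.inl d')
        rw [← hd, hg]
      · have h1 : Sum.inl d ∈ P.pos ↔ ¬ (pc.sum (ofMap P g)).outB pol (theta att z) := hy2
        have h2 := P.orient.pos_iff (Sum.inl d)
        rw [hd] at h2
        change _ ↔ Sum.inl d' ∈ P.pos
        unfold OrientedMap.pos at h1 ⊢
        tauto
  · apply theta_inj hatt
    exact h.uniq _ _ ((theta_lab hg hatt z).trans (h1.trans (theta_lab hg hatt z').symm))
      ((theta_out hatt z).trans (h2.trans (theta_out hatt z').symm))

/-- Names are constant along links, so linked ends have equal names. Conversely, no edge of the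
pattern joins two legs, so a path across the hole is a context edge prolonged at its legs to the
attached darts; together with the inner edges of the pattern these account for all pairs of equal
names. -/
theorem isGluing_of_realization (hc : pc.Good) (hp : pc.Proper (ctxLab P g β) (ctxPol P pol))
    (h : (pc.sum (ofMap P g)).Proper β pol) (hg : ∀ x, g (P.e x) = g x)
    (hatt : ∀ h, P.e (Sum.inr h) = Sum.inl (att h)) {M : OrientedMap B}
    (R : Realization M (pc.sum (ofMap P g)) β pol) :
    IsGluing (pc.toMap hc _ _ hp) P M := by
  let C := pc.toMap hc _ _ hp
  let L : ((pc.D ⊕ P.D) ⊕ B) ⊕ H → ℕ :=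
    Sum.elim ((pc.sum (ofMap P g)).labB β) fun h => g (Sum.inr h)
  have hLc : ∀ x : pc.D ⊕ (B ⊕ H), L (embContext C P x) = pc.labB (ctxLab P g β) x := by
    rintro (d | b | h) <;> rfl
  have hLp : ∀ x : P.D ⊕ H, L (embPattern C P x) = g x := by
    rintro (d | h) <;> rfl
  have hlink : ∀ x y, Relation.EqvGen (Link C P) x y → L x = L y := by
    intro x y hxy
    induction hxy with
    | rel x y h =>
      cases h with
      | context x =>
        exact (hLc x).trans ((pc.toMap_e hc _ _ hp x).symm.trans (hLc (C.e x)).symm)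
      | pattern x => rw [hLp, hLp, hg]
    | refl => rfl
    | symm _ _ _ ih => exact ih.symm
    | trans _ _ _ _ _ ih1 ih2 => exact ih1.trans ih2
  have htheta : ∀ z : pc.D ⊕ (B ⊕ H),
      Relation.EqvGen (Link C P) (embContext C P z) (Sum.inl (theta att z)) := by
    rintro (d | b | h)
    · exact .refl _
    · exact .refl _
    · have := Link.pattern (C := C) (P := P) (Sum.inr h)
      rw [hatt] at this
      exact .rel _ _ this
  refine ⟨R.φ, fun d => R.rot (Sum.inl d), fun d => R.rot (Sum.inr d),
    fun d => R.pos (Sum.inl (Sum.inl d)), fun d => R.pos (Sum.inl (Sum.inr d)),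
    fun b => R.pos (Sum.inr b), fun h => Iff.rfl, fun x y => ?_⟩
  refine (R.e_iff h x y).trans (and_congr_right fun hne => ⟨fun hxy => ?_, fun hxy => ?_⟩)
  · rcases theta_cases hatt x with ⟨z, rfl⟩ | ⟨d, d', rfl, hd, -⟩
    · have h1 : M.e (Sum.map R.φ id (theta att z)) = Sum.map R.φ id (theta att (C.e z)) := by
        rw [R.e_iff h]
        refine ⟨fun hz => C.e_ne z (theta_inj hatt hz).symm, ?_⟩
        exact (theta_lab hg hatt z).trans ((pc.toMap_e hc _ _ hp z).symm.trans
          (theta_lab hg hatt (C.e z)).symm)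
      obtain rfl := sum_map_inj R.φ (((R.e_iff h _ _).2 ⟨hne, hxy⟩).symm.trans h1)
      exact .trans _ _ _ (.symm _ _ (htheta z)) (.trans _ _ _ (.rel _ _ (.context z))
        (htheta (C.e z)))
    · have h1 : M.e (Sum.map R.φ id (Sum.inl (Sum.inr d))) =
          Sum.map R.φ id (Sum.inl (Sum.inr d')) := by
        rw [R.e_iff h]
        refine ⟨fun hz => ?_, ?_⟩
        · simp only [Sum.inl.injEq, Sum.inr.injEq] at hz
          exact P.e_ne (Sum.inl d) (hd.trans (by rw [hz]))
        · change g (Sum.inl d) = g (Sum.inl d')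
          rw [← hd, hg]
      obtain rfl := sum_map_inj R.φ (((R.e_iff h _ _).2 ⟨hne, hxy⟩).symm.trans h1)
      have := Link.pattern (C := C) (P := P) (Sum.inl d)
      rw [hd] at this
      exact .rel _ _ this
  · exact hlink _ _ hxy

end Glue

end ImploidMoves


namespace ImploidMoves

/-! ### Replacing a connected pattern preserves connectedness -/

/-- Adjacency of darts inside a map, without passing through the boundary. -/
def InnerAdj {H : Type} (P : OrientedMap H) (d d' : P.D) : Prop :=
  P.rot d = d' ∨ P.e (Sum.inl d) = Sum.inl d'

section Connected

variable {B H : Type} {pc : Pre} {P P' : OrientedMap H} {g : P.D ⊕ H → ℕ} {g' : P'.D ⊕ H → ℕ}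
  {β : B → ℕ} {pol : B → Prop} {att : H → P.D} {att' : H → P'.D}

theorem Realization.adj_theta (h : (pc.sum (ofMap P g)).Proper β pol) (hg : ∀ x, g (P.e x) = g x)
    (hatt : ∀ h, P.e (Sum.inr h) = Sum.inl (att h)) {M : OrientedMap B}
    (R : Realization M (pc.sum (ofMap P g)) β pol) {z z' : pc.D ⊕ (B ⊕ H)} (hz : z ≠ z')
    (hl : pc.labB (ctxLab P g β) z = pc.labB (ctxLab P g β) z') :
    M.Adj (Sum.map R.φ id (theta att z)) (Sum.map R.φ id (theta att z')) := by
  have h1 : M.e (Sum.map R.φ id (theta att z)) = Sum.map R.φ id (theta att z') := by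
    rw [R.e_iff h]
    exact ⟨fun h' => hz (theta_inj hatt h'),
      (theta_lab hg hatt z).trans (hl.trans (theta_lab hg hatt z').symm)⟩
  rw [← h1]
  exact .edge _

theorem Realization.inner (h : (pc.sum (ofMap P g)).Proper β pol) (hg : ∀ x, g (P.e x) = g x)
    {M : OrientedMap B} (R : Realization M (pc.sum (ofMap P g)) β pol) {d d' : P.D}
    (hd : InnerAdj P d d') :
    M.Adj (Sum.map R.φ id (Sum.inl (Sum.inr d))) (Sum.map R.φ id (Sum.inl (Sum.inr d'))) := by
  rcases hd with rfl | hd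
  · have := OpenMap.Adj.vertex (M := M.toOpenMap) (R.φ (Sum.inr d))
    rw [R.rot] at this
    exact this
  · have h1 : M.e (Sum.map R.φ id (Sum.inl (Sum.inr d))) =
        Sum.map R.φ id (Sum.inl (Sum.inr d')) := by
      rw [R.e_iff h]
      refine ⟨fun h' => ?_, ?_⟩
      · simp only [Sum.inl.injEq, Sum.inr.injEq] at h'
        exact P.e_ne _ (hd.trans (by rw [h']))
      · change g (Sum.inl d) = g (Sum.inl d')
        rw [← hd, hg]
    rw [← h1]
    exact .edge _

/-- Rooted maps are connected by definition, so a source map built for a backward move has to be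
shown connected. Collapsing the pattern of the target to a single dart of the other pattern carries
paths to paths, because that pattern is connected without help from its boundary. -/
theorem connected_of_realization
    (h : (pc.sum (ofMap P g)).Proper β pol) (h' : (pc.sum (ofMap P' g')).Proper β pol)
    (hg : ∀ x, g (P.e x) = g x) (hg' : ∀ x, g' (P'.e x) = g' x)
    (hatt : ∀ h, P.e (Sum.inr h) = Sum.inl (att h))
    (hatt' : ∀ h, P'.e (Sum.inr h) = Sum.inl (att' h))
    (hleg : ∀ h, g (Sum.inr h) = g' (Sum.inr h))
    (p₀ : P.D) (hP : ∀ d, Relation.EqvGen (InnerAdj P) p₀ d) (p₁ : P'.D)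
    {M M' : OrientedMap B} (R : Realization M (pc.sum (ofMap P g)) β pol)
    (R' : Realization M' (pc.sum (ofMap P' g')) β pol)
    (hM' : ∀ x y, Relation.EqvGen M'.Adj x y) (x y) : Relation.EqvGen M.Adj x y := by
  -- The collapse: all darts of `P'` go to `p₀`, the rest is unchanged.
  let f : (pc.D ⊕ P'.D) ⊕ B → (pc.D ⊕ P.D) ⊕ B := Sum.map (Sum.map id fun _ => p₀) id
  have hin' : ∀ a b, Relation.EqvGen (InnerAdj P) a b → Relation.EqvGen M.Adj
      (Sum.map R.φ id (Sum.inl (Sum.inr a))) (Sum.map R.φ id (Sum.inl (Sum.inr b))) := by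
    intro a b hab
    induction hab with
    | rel a b hab => exact .rel _ _ (R.inner h hg hab)
    | refl => exact .refl _
    | symm _ _ _ ih => exact .symm _ _ ih
    | trans _ _ _ _ _ ih1 ih2 => exact .trans _ _ _ ih1 ih2
  have hin := fun d => hin' p₀ d (hP d)
  have hf : ∀ z : pc.D ⊕ (B ⊕ H), Relation.EqvGen M.Adj (Sum.map R.φ id (f (theta att' z)))
      (Sum.map R.φ id (theta att z)) := by
    rintro (d | b | k)
    · exact .refl _
    · exact .refl _
    · exact hin _
  have hctx : ctxLab P g β = ctxLab P' g' β := by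
    funext z
    rcases z with b | k
    · rfl
    · exact hleg k
  have key : ∀ x y, M'.Adj (Sum.map R'.φ id x) (Sum.map R'.φ id y) →
      Relation.EqvGen M.Adj (Sum.map R.φ id (f x)) (Sum.map R.φ id (f y)) := by
    intro x y hxy
    generalize hX : Sum.map R'.φ id x = X at hxy
    generalize hY : Sum.map R'.φ id y = Y at hxy
    cases hxy with
    | edge =>
      rw [← hX] at hY
      have hY' := (R'.e_iff h' _ _).1 hY.symm
      rcases theta_cases hatt' x with ⟨z, rfl⟩ | ⟨d, d', rfl, hd, -⟩
      · rcases theta_cases hatt' y with ⟨z', rfl⟩ | ⟨d, d', rfl, hd, hz⟩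
        · have hl := (theta_lab hg' hatt' z).symm.trans (hY'.2.trans (theta_lab hg' hatt' z'))
          rw [← hctx] at hl
          exact .trans _ _ _ (hf z) (.trans _ _ _ (.rel _ _ (R.adj_theta h hg hatt
            (fun hzz => hY'.1 (by rw [hzz])) hl)) (.symm _ _ (hf z')))
        · exfalso
          apply hz z
          have h1 : M'.e (Sum.map R'.φ id (Sum.inl (Sum.inr d))) =
              Sum.map R'.φ id (Sum.inl (Sum.inr d')) := by
            rw [R'.e_iff h']
            refine ⟨fun hh => ?_, ?_⟩
            · simp only [Sum.inl.injEq, Sum.inr.injEq] at hh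
              exact P'.e_ne _ (hd.trans (by rw [hh]))
            · change g' (Sum.inl d) = g' (Sum.inl d')
              rw [← hd, hg']
          rw [hY, M'.e_invol] at h1
          exact sum_map_inj R'.φ h1
      · have h1 : M'.e (Sum.map R'.φ id (Sum.inl (Sum.inr d))) =
            Sum.map R'.φ id (Sum.inl (Sum.inr d')) := by
          rw [R'.e_iff h']
          refine ⟨fun hh => ?_, ?_⟩
          · simp only [Sum.inl.injEq, Sum.inr.injEq] at hh
            exact P'.e_ne _ (hd.trans (by rw [hh]))
          · change g' (Sum.inl d) = g' (Sum.inl d')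
            rw [← hd, hg']
        obtain rfl := sum_map_inj R'.φ (hY.trans h1)
        exact .refl _
    | vertex d =>
      rcases x with x | b
      · simp only [Sum.map_inl, Sum.inl.injEq] at hX
        rw [← hX, R'.rot] at hY
        have hy : y = Sum.inl ((pc.sum (ofMap P' g')).rot x) := sum_map_inj R'.φ hY
        rw [hy]
        rcases x with x | x
        · have := OpenMap.Adj.vertex (M := M.toOpenMap) (R.φ (Sum.inl x))
          rw [R.rot] at this
          exact .rel _ _ this
        · exact .refl _
      · simp at hX
  have key2 : ∀ x y, Relation.EqvGen M.Adj (Sum.map R.φ id (f x)) (Sum.map R.φ id (f y)) := by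
    intro x y
    have hxy := hM' (Sum.map R'.φ id x) (Sum.map R'.φ id y)
    generalize hX : Sum.map R'.φ id x = X at hxy
    generalize hY : Sum.map R'.φ id y = Y at hxy
    induction hxy generalizing x y with
    | rel a b hab => exact key x y (hX ▸ hY ▸ hab)
    | refl a =>
      rw [sum_map_inj R'.φ (hX.trans hY.symm)]
      exact .refl _
    | symm _ _ _ ih => exact .symm _ _ (ih y x hY hX)
    | trans a b c _ _ ih1 ih2 =>
      obtain ⟨z, hz⟩ := sum_map_surj R'.φ b
      exact .trans _ _ _ (ih1 x z hX hz) (ih2 z y hz hY)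
  have hall : ∀ x, ∃ x', Relation.EqvGen M.Adj x (Sum.map R.φ id (f x')) := by
    intro x
    obtain ⟨x, rfl⟩ := sum_map_surj R.φ x
    rcases x with (d | d) | b
    · exact ⟨Sum.inl (Sum.inl d), .refl _⟩
    -- Any dart of `P'` serves here; it ensures that `p₀` is in the image of `f`.
    · exact ⟨Sum.inl (Sum.inr p₁), .symm _ _ (hin d)⟩
    · exact ⟨Sum.inr b, .refl _⟩
  obtain ⟨x', hx⟩ := hall x
  obtain ⟨y', hy⟩ := hall y
  exact .trans _ _ _ hx (.trans _ _ _ (key2 x' y') (.symm _ _ hy))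

end Connected

/-! ### Removal of a subdivision vertex -/

/-- Renaming of edges. -/
abbrev Pre.map (p : Pre) (σ : ℕ → ℕ) : Pre := ⟨p.D, p.rot, p.out, fun d => σ (p.lab d)⟩

/-- The names of the darts of a 2-valent vertex with input `s` and output `t`. -/
def glueWire (s t : ℕ) : glueNet.D ⊕ Fin 2 → ℕ
  | Sum.inl ⟨0, .src⟩ => s
  | Sum.inl ⟨0, .tgt⟩ => t
  | Sum.inr 0 => s
  | Sum.inr 1 => t

theorem glueWire_e (s t : ℕ) (x) : glueWire s t (glueNet.e x) = glueWire s t x := by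
  rcases x with ⟨i, p⟩ | i
  · fin_cases i
    cases p <;> rfl
  · fin_cases i <;> rfl

/-- The darts of the 2-valent vertex at its legs. -/
def glueAtt : Fin 2 → glueNet.D
  | 0 => ⟨0, .src⟩
  | 1 => ⟨0, .tgt⟩

theorem glueAtt_e (i) : glueNet.e (Sum.inr i) = Sum.inl (glueAtt i) := by
  fin_cases i <;> rfl

/-! ### Decidable conditions on concrete nets -/

section NetData

variable {m k : ℕ}

/-- The position in `w` of the edge with an end at `x`. -/
def edgeIdx {α : Type} [DecidableEq α] : List (α × α) → α → ℕ
  | [], _ => 0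
  | (a, b) :: w, x => if x = a ∨ x = b then 0 else edgeIdx w x + 1

/-- The boundary darts in `Q` are those directed into the net. -/
def LegSpec (κ : Fin m → Kind) (w : List (NetDart κ k × NetDart κ k)) (Q : Fin k → Bool) : Prop :=
  ∀ i, leg i ∈ w.map Prod.fst ↔ Q i = true

instance (κ : Fin m → Kind) (w : List (NetDart κ k × NetDart κ k)) (Q : Fin k → Bool) :
    Decidable (LegSpec κ w Q) := by
  have : ∀ (x : NetDart κ k) (l : List (NetDart κ k)), Decidable (x ∈ l) := fun x l =>
    @List.instDecidableMemOfLawfulBEq _ instBEqOfDecidableEq inferInstance x l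
  unfold LegSpec; infer_instance

/-- No edge joins two boundary darts, and `edgeIdx` does not depend on the end of the edge. -/
def EdgeSpec (κ : Fin m → Kind) (w : List (NetDart κ k × NetDart κ k)) : Prop :=
  (∀ i, (partner w (leg i)).isLeft = true) ∧ ∀ x, edgeIdx w (partner w x) = edgeIdx w x

instance (κ : Fin m → Kind) (w : List (NetDart κ k × NetDart κ k)) : Decidable (EdgeSpec κ w) := by
  unfold EdgeSpec; infer_instance

/-- Reachability by at most `n` steps along rotations and inner edges. -/
def netReach (κ : Fin m → Kind) (w : List (NetDart κ k × NetDart κ k)) :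
    ℕ → ((i : Fin m) × Port (κ i)) → ((i : Fin m) × Port (κ i)) → Bool
  | 0, a, b => decide (a = b)
  | n + 1, a, b => decide (a = b) || netReach κ w n ⟨a.1, a.2.next⟩ b ||
    match partner w (Sum.inl a) with
    | Sum.inl a' => netReach κ w n a' b
    | Sum.inr _ => false

/-- Lets the inner connectedness of a concrete pattern be settled by `decide`. -/
theorem netReach_spec {κ : Fin m → Kind} {w : List (NetDart κ k × NetDart κ k)}
    (hw : ValidNet κ w) (n : ℕ) (a b : (i : Fin m) × Port (κ i)) (h : netReach κ w n a b = true) :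
    Relation.EqvGen (InnerAdj (net κ w hw)) a b := by
  induction n generalizing a with
  | zero =>
    obtain rfl : a = b := by simpa [netReach] using h
    exact .refl _
  | succ n ih =>
    simp only [netReach, Bool.or_eq_true, decide_eq_true_eq] at h
    rcases h with (rfl | h) | h
    · exact .refl _
    · exact .trans _ _ _ (.rel _ _ (Or.inl rfl)) (ih _ h)
    · rcases ha : partner w (Sum.inl a) with a' | i
      · rw [ha] at h
        exact .trans _ _ _ (.rel _ _ (Or.inr ha)) (ih a' h)
      · rw [ha] at h
        simp at h

/-- Every dart is reachable from the first one. -/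
def ReachSpec (κ : Fin m → Kind) (w : List (NetDart κ k × NetDart κ k)) (n : ℕ)
    (p₀ : (i : Fin m) × Port (κ i)) : Prop :=
  ∀ d, netReach κ w n p₀ d = true

instance (κ : Fin m → Kind) (w : List (NetDart κ k × NetDart κ k)) (n : ℕ)
    (p₀ : (i : Fin m) × Port (κ i)) : Decidable (ReachSpec κ w n p₀) := by
  unfold ReachSpec; infer_instance

theorem net_pos {κ : Fin m → Kind} {w : List (NetDart κ k × NetDart κ k)}
    {hw : ValidNet κ w} (x : NetDart κ k) : x ∈ (net κ w hw).pos ↔ x ∈ w.map Prod.fst := Iff.rfl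

end NetData

theorem glueNet_leg (i : Fin 2) : Sum.inr i ∈ glueNet.pos ↔ decide (i = 0) = true :=
  (by decide : LegSpec ![.glue] [(leg 0, port 0 .src), (port 0 .tgt, leg 1)]
    fun i => decide (i = 0)) i

theorem edgeNet_leg (i : Fin 2) : Sum.inr i ∈ edgeNet.pos ↔ decide (i = 0) = true :=
  (by decide : LegSpec ![] [(leg 0, leg 1)] fun i => decide (i = 0)) i

instance : IsEmpty edgeNet.D := ⟨fun d => d.1.elim0⟩

/-! ### Elimination of a 2-valent vertex as identification of two edge names -/

section Elim

variable {B : Type} {pc : Pre} {β : B → ℕ} {pol : B → Prop} {σ : ℕ → ℕ} {s t : ℕ}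

/-- The pattern `edgeNet` has an edge between its two legs, so the general gluing lemma does not
cover it. Here the context is the one used for `glueNet`, and joining its legs identifies the names
`s` and `t`; `hσ` says that `σ` identifies no others. -/
theorem isGluing_edgeNet (hc : pc.Good)
    (hp : pc.Proper (ctxLab glueNet (glueWire s t) β) (ctxPol glueNet pol))
    (h' : (pc.map σ).Proper (fun b => σ (β b)) pol) (hst : σ s = σ t)
    (hσ : ∀ a b, σ a = σ b → a = b ∨ a = s ∧ b = t ∨ a = t ∧ b = s)
    {M' : OrientedMap B} (R' : Realization M' (pc.map σ) (fun b => σ (β b)) pol) :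
    IsGluing (pc.toMap hc _ _ hp) edgeNet M' := by
  let C := pc.toMap hc _ _ hp
  -- Both legs carry the common value of `σ` at `s` and `t`, hence names remain constant along the
  -- edge between them.
  let L : ((pc.D ⊕ edgeNet.D) ⊕ B) ⊕ Fin 2 → ℕ
    | Sum.inl (Sum.inl (Sum.inl d)) => σ (pc.lab d)
    | Sum.inl (Sum.inl (Sum.inr _)) => 0
    | Sum.inl (Sum.inr b) => σ (β b)
    | Sum.inr _ => σ s
  have hLc : ∀ x : pc.D ⊕ (B ⊕ Fin 2), L (embContext C edgeNet x) =
      σ (pc.labB (ctxLab glueNet (glueWire s t) β) x) := by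
    rintro (d | b | i)
    · rfl
    · rfl
    · fin_cases i
      · rfl
      · exact hst
  have hLp : ∀ x, L (embPattern C edgeNet x) = σ s := by
    rintro (d | i)
    · exact isEmptyElim d
    · rfl
  have hlink : ∀ x y, Relation.EqvGen (Link C edgeNet) x y → L x = L y := by
    intro x y hxy
    induction hxy with
    | rel x y h =>
      cases h with
      | context x =>
        exact (hLc x).trans ((congrArg σ (pc.toMap_e hc _ _ hp x).symm).trans (hLc (C.e x)).symm)
      | pattern x => exact (hLp _).trans (hLp _).symm
    | refl => rfl
    | symm _ _ _ ih => exact ih.symm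
    | trans _ _ _ _ _ ih1 ih2 => exact ih1.trans ih2
  have hCe : ∀ x y : pc.D ⊕ (B ⊕ Fin 2), x ≠ y →
      pc.labB (ctxLab glueNet (glueWire s t) β) x = pc.labB (ctxLab glueNet (glueWire s t) β) y →
      Relation.EqvGen (Link C edgeNet) (embContext C edgeNet x) (embContext C edgeNet y) := by
    intro x y hne hl
    have h1 := Link.context (C := C) (P := edgeNet) x
    have h2 : C.e x = y := by
      have h3 := ((Realization.self pc hc hp).e_iff hp x y).2 ⟨hne, hl⟩
      have hi : ∀ z, Sum.map (Realization.self pc hc hp).φ (id : B ⊕ Fin 2 → _) z = z := by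
        rintro (d | b) <;> rfl
      rw [hi, hi] at h3
      exact h3
    rw [h2] at h1
    exact .rel _ _ h1
  let emb : pc.D ⊕ B → (pc.D ⊕ edgeNet.D) ⊕ B := Sum.map Sum.inl id
  let up : pc.D ⊕ B → pc.D ⊕ (B ⊕ Fin 2) := Sum.map id Sum.inl
  have hemb : ∀ x, ∃ y, emb y = x := by
    rintro ((d | d) | b)
    · exact ⟨Sum.inl d, rfl⟩
    · exact isEmptyElim d
    · exact ⟨Sum.inr b, rfl⟩
  have hembi : Function.Injective emb :=
    Sum.map_injective.2 ⟨Sum.inl_injective, Function.injective_id⟩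
  have hec : ∀ x, embContext C edgeNet (up x) = Sum.inl (emb x) := by
    rintro (d | b) <;> rfl
  have hLemb : ∀ x, L (Sum.inl (emb x)) = (pc.map σ).labB (fun b => σ (β b)) x := by
    rintro (d | b) <;> rfl
  have hlu : ∀ x, (pc.map σ).labB (fun b => σ (β b)) x =
      σ (pc.labB (ctxLab glueNet (glueWire s t) β) (up x)) := by
    rintro (d | b) <;> rfl
  have hup : ∀ x i, up x ≠ Sum.inr (Sum.inr i) := by
    rintro (d | b) i <;> simp [up]
  have hlegs : Relation.EqvGen (Link C edgeNet) (Sum.inr 0) (Sum.inr 1) :=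
    .rel _ _ (Link.pattern (C := C) (P := edgeNet) (Sum.inr 0))
  -- From an end named `s` the path runs to leg 0, along the edge of `edgeNet` to leg 1, and on to
  -- an end named `t`.
  have hpath : ∀ x y, pc.labB (ctxLab glueNet (glueWire s t) β) (up x) = s →
      pc.labB (ctxLab glueNet (glueWire s t) β) (up y) = t →
      Relation.EqvGen (Link C edgeNet) (Sum.inl (emb x)) (Sum.inl (emb y)) := by
    intro x y hx hy
    have h1 := hCe (up x) (Sum.inr (Sum.inr 0)) (hup x 0) hx
    have h2 := hCe (up y) (Sum.inr (Sum.inr 1)) (hup y 1) hy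
    rw [hec] at h1 h2
    exact .trans _ _ _ h1 (.trans _ _ _ hlegs (.symm _ _ h2))
  refine ⟨(Equiv.sumEmpty pc.D edgeNet.D).trans R'.φ, fun d => R'.rot d,
    fun d => isEmptyElim d, fun d => R'.pos (Sum.inl d), fun d => isEmptyElim d,
    fun b => R'.pos (Sum.inr b), fun i => ?_, fun x y => ?_⟩
  · change (Sum.inr i ∉ glueNet.pos) ↔ Sum.inr i ∉ edgeNet.pos
    rw [glueNet_leg, edgeNet_leg]
  · obtain ⟨x, rfl⟩ := hemb x
    obtain ⟨y, rfl⟩ := hemb y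
    have hm : ∀ z, Sum.map ((Equiv.sumEmpty pc.D edgeNet.D).trans R'.φ) id (emb z) =
        Sum.map R'.φ id z := by
      rintro (d | b) <;> rfl
    refine (Iff.of_eq (congrArg₂ (fun a b => M'.e a = b) (hm x) (hm y))).trans ?_
    rw [R'.e_iff h']
    refine and_congr (not_congr hembi.eq_iff.symm) ⟨fun hl => ?_, fun hl => ?_⟩
    · rw [hlu, hlu] at hl
      by_cases hxy : x = y
      · rw [hxy]
        exact .refl _
      rcases hσ _ _ hl with h1 | ⟨h1, h2⟩ | ⟨h1, h2⟩
      · have := hCe (up x) (up y) (fun h => hxy (Sum.map_injective.2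
          ⟨Function.injective_id, Sum.inl_injective⟩ h)) h1
        rwa [hec, hec] at this
      · exact hpath x y h1 h2
      · exact .symm _ _ (hpath y x h2 h1)
    · rw [← hLemb, ← hLemb]
      exact hlink _ _ hl

/-- An edge of the smaller map either survives or is replaced by a path through the 2-valent vertex,
so connectedness lifts as soon as that vertex is attached to something else. -/
theorem connected_of_elim (h : (pc.sum (ofMap glueNet (glueWire s t))).Proper β pol)
    (h' : (pc.map σ).Proper (fun b => σ (β b)) pol) (hne : s ≠ t)
    (hσ : ∀ a b, σ a = σ b → a = b ∨ a = s ∧ b = t ∨ a = t ∧ b = s)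
    {M M' : OrientedMap B} (R : Realization M (pc.sum (ofMap glueNet (glueWire s t))) β pol)
    (R' : Realization M' (pc.map σ) (fun b => σ (β b)) pol)
    (hM' : ∀ x y, Relation.EqvGen M'.Adj x y) (x y) : Relation.EqvGen M.Adj x y := by
  let f : pc.D ⊕ B → (pc.D ⊕ glueNet.D) ⊕ B := Sum.map Sum.inl id
  let src : (pc.D ⊕ glueNet.D) ⊕ B := Sum.inl (Sum.inr ⟨0, .src⟩)
  let tgt : (pc.D ⊕ glueNet.D) ⊕ B := Sum.inl (Sum.inr ⟨0, .tgt⟩)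
  have hfi : Function.Injective f :=
    Sum.map_injective.2 ⟨Sum.inl_injective, Function.injective_id⟩
  have hfs : ∀ x d, f x ≠ Sum.inl (Sum.inr d) := by
    rintro (x | x) d <;> simp [f]
  have hedge : ∀ x y, x ≠ y →
      (pc.sum (ofMap glueNet (glueWire s t))).labB β x =
        (pc.sum (ofMap glueNet (glueWire s t))).labB β y →
      Relation.EqvGen M.Adj (Sum.map R.φ id x) (Sum.map R.φ id y) := by
    intro x y hxy hl
    rw [← (R.e_iff h x y).2 ⟨hxy, hl⟩]
    exact .rel _ _ (.edge _)
  have hst : Relation.EqvGen M.Adj (Sum.map R.φ id src) (Sum.map R.φ id tgt) := by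
    have := OpenMap.Adj.vertex (M := M.toOpenMap) (R.φ (Sum.inr ⟨0, .src⟩))
    rw [R.rot] at this
    exact .rel _ _ this
  have hlab : ∀ x, (pc.map σ).labB (fun b => σ (β b)) x =
      σ ((pc.sum (ofMap glueNet (glueWire s t))).labB β (f x)) := by
    rintro (d | b) <;> rfl
  have hpath : ∀ x y, (pc.sum (ofMap glueNet (glueWire s t))).labB β (f x) = s →
      (pc.sum (ofMap glueNet (glueWire s t))).labB β (f y) = t →
      Relation.EqvGen M.Adj (Sum.map R.φ id (f x)) (Sum.map R.φ id (f y)) := by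
    intro x y hx hy
    exact .trans _ _ _ (hedge _ src (hfs x _) hx)
      (.trans _ _ _ hst (.symm _ _ (hedge _ tgt (hfs y _) hy)))
  have key : ∀ x y, M'.Adj (Sum.map R'.φ id x) (Sum.map R'.φ id y) →
      Relation.EqvGen M.Adj (Sum.map R.φ id (f x)) (Sum.map R.φ id (f y)) := by
    intro x y hxy
    generalize hX : Sum.map R'.φ id x = X at hxy
    generalize hY : Sum.map R'.φ id y = Y at hxy
    cases hxy with
    | edge =>
      rw [← hX] at hY
      obtain ⟨hxy, hl⟩ := (R'.e_iff h' _ _).1 hY.symm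
      rw [hlab, hlab] at hl
      rcases hσ _ _ hl with h1 | ⟨h1, h2⟩ | ⟨h1, h2⟩
      · exact hedge _ _ (fun h => hxy (hfi h)) h1
      · exact hpath x y h1 h2
      · exact .symm _ _ (hpath y x h2 h1)
    | vertex d =>
      rcases x with x | b
      · simp only [Sum.map_inl, Sum.inl.injEq] at hX
        rw [← hX, R'.rot] at hY
        have hy : y = Sum.inl (pc.rot x) := sum_map_inj R'.φ hY
        rw [hy]
        have := OpenMap.Adj.vertex (M := M.toOpenMap) (R.φ (Sum.inl x))
        rw [R.rot] at this
        exact .rel _ _ this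
      · simp at hX
  have key2 : ∀ x y, Relation.EqvGen M.Adj (Sum.map R.φ id (f x)) (Sum.map R.φ id (f y)) := by
    intro x y
    have hxy := hM' (Sum.map R'.φ id x) (Sum.map R'.φ id y)
    generalize hX : Sum.map R'.φ id x = X at hxy
    generalize hY : Sum.map R'.φ id y = Y at hxy
    induction hxy generalizing x y with
    | rel a b hab => exact key x y (hX ▸ hY ▸ hab)
    | refl a =>
      rw [sum_map_inj R'.φ (hX.trans hY.symm)]
      exact .refl _
    | symm _ _ _ ih => exact .symm _ _ (ih y x hY hX)
    | trans a b c _ _ ih1 ih2 =>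
      obtain ⟨z, hz⟩ := sum_map_surj R'.φ b
      exact .trans _ _ _ (ih1 x z hX hz) (ih2 z y hz hY)
  -- The condition `s ≠ t` enters here: it excludes a 2-valent vertex closed up on itself, which
  -- would be a component of its own.
  have htgt : ∃ x', Relation.EqvGen M.Adj (Sum.map R.φ id tgt) (Sum.map R.φ id (f x')) := by
    obtain ⟨z, hz⟩ := sum_map_surj R.φ (M.e (Sum.map R.φ id tgt))
    obtain ⟨h1, h2⟩ := (R.e_iff h _ _).1 hz.symm
    have h3 : Relation.EqvGen M.Adj (Sum.map R.φ id tgt) (Sum.map R.φ id z) := hedge _ _ h1 h2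
    rcases z with (d | ⟨i, p⟩) | b
    · exact ⟨Sum.inl d, h3⟩
    · fin_cases i
      cases p with
      | tgt => exact absurd rfl h1
      | src => exact absurd h2.symm hne
    · exact ⟨Sum.inr b, h3⟩
  obtain ⟨x₀, hx₀⟩ := htgt
  have hall : ∀ x, ∃ x', Relation.EqvGen M.Adj x (Sum.map R.φ id (f x')) := by
    intro x
    obtain ⟨x, rfl⟩ := sum_map_surj R.φ x
    rcases x with (d | ⟨i, p⟩) | b
    · exact ⟨Sum.inl d, .refl _⟩
    · fin_cases i
      cases p with
      | tgt => exact ⟨x₀, hx₀⟩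
      | src => exact ⟨x₀, .trans _ _ _ hst hx₀⟩
    · exact ⟨Sum.inr b, .refl _⟩
  obtain ⟨x', hx⟩ := hall x
  obtain ⟨y', hy⟩ := hall y
  exact .trans _ _ _ hx (.trans _ _ _ (key2 x' y') (.symm _ _ hy))

end Elim

end ImploidMoves


namespace ImploidMoves

/-! ### Nets: multisets of vertices with named edges -/

/-- A vertex with the names of the edges at its darts. -/
structure Vtx where
  kind : Kind
  wire : Port kind → ℕ

/-- A finite multiset of vertices. -/
abbrev Net := Multiset Vtx

/-- The indicator of `w = u`. -/
def delta (w u : ℕ) : ℕ := if w = u then 1 else 0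

namespace Vtx

/-- The number of outputs with the name `w`. -/
def oc (v : Vtx) (w : ℕ) : ℕ := ∑ p, if Port.isOut p = true then delta w (v.wire p) else 0

/-- The number of inputs with the name `w`. -/
def ic (v : Vtx) (w : ℕ) : ℕ := ∑ p, if Port.isOut p = true then 0 else delta w (v.wire p)

/-- A positive vertex. -/
def lam (r x b : ℕ) : Vtx := ⟨.lam, fun | .root => r | .var => x | .body => b⟩

/-- A negative vertex. -/
def app (c a f : ℕ) : Vtx := ⟨.app, fun | .cont => c | .arg => a | .fn => f⟩

/-- A 2-valent vertex. -/
def glue (t s : ℕ) : Vtx := ⟨.glue, fun | .tgt => t | .src => s⟩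

/-- A 1-valent vertex. -/
def unit (o : ℕ) : Vtx := ⟨.unit, fun | .out => o⟩

/-- Vertices computed from the nets of the moves carry names as functions of the port; this and its
analogues bring them to the form in which the rewriting rules are stated. -/
theorem mk_lam (w : Port .lam → ℕ) : (⟨.lam, w⟩ : Vtx) = lam (w .root) (w .var) (w .body) := by
  unfold lam; congr; funext p; cases p <;> rfl

theorem mk_app (w : Port .app → ℕ) : (⟨.app, w⟩ : Vtx) = app (w .cont) (w .arg) (w .fn) := by
  unfold app; congr; funext p; cases p <;> rfl

theorem mk_glue (w : Port .glue → ℕ) : (⟨.glue, w⟩ : Vtx) = glue (w .tgt) (w .src) := by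
  unfold glue; congr; funext p; cases p <;> rfl

theorem mk_unit (w : Port .unit → ℕ) : (⟨.unit, w⟩ : Vtx) = unit (w .out) := by
  unfold unit; congr; funext p; cases p; rfl

theorem oc_lam (r x b w : ℕ) : (lam r x b).oc w = delta w r + delta w x := by
  change (∑ p ∈ ({.root, .var, .body} : Finset (Port .lam)), _) = _
  simp [lam, Port.isOut]

theorem ic_lam (r x b w : ℕ) : (lam r x b).ic w = delta w b := by
  change (∑ p ∈ ({.root, .var, .body} : Finset (Port .lam)), _) = _
  simp [lam, Port.isOut]

theorem oc_app (c a f w : ℕ) : (app c a f).oc w = delta w c := by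
  change (∑ p ∈ ({.cont, .arg, .fn} : Finset (Port .app)), _) = _
  simp [app, Port.isOut]

theorem ic_app (c a f w : ℕ) : (app c a f).ic w = delta w a + delta w f := by
  change (∑ p ∈ ({.cont, .arg, .fn} : Finset (Port .app)), _) = _
  simp [app, Port.isOut]

theorem oc_glue (t s w : ℕ) : (glue t s).oc w = delta w t := by
  change (∑ p ∈ ({.tgt, .src} : Finset (Port .glue)), _) = _
  simp [glue, Port.isOut]

theorem ic_glue (t s w : ℕ) : (glue t s).ic w = delta w s := by
  change (∑ p ∈ ({.tgt, .src} : Finset (Port .glue)), _) = _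
  simp [glue, Port.isOut]

theorem oc_unit (o w : ℕ) : (unit o).oc w = delta w o := by
  change (∑ p ∈ ({.out} : Finset (Port .unit)), _) = _
  simp [unit, Port.isOut]

theorem ic_unit (o w : ℕ) : (unit o).ic w = 0 := by
  change (∑ p ∈ ({.out} : Finset (Port .unit)), _) = _
  simp [Port.isOut]

/-- Renaming of edges. -/
def map (σ : ℕ → ℕ) (v : Vtx) : Vtx := ⟨v.kind, fun p => σ (v.wire p)⟩

theorem map_lam (σ : ℕ → ℕ) (r x b : ℕ) : (lam r x b).map σ = lam (σ r) (σ x) (σ b) := mk_lam _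

theorem map_app (σ : ℕ → ℕ) (r x b : ℕ) : (app r x b).map σ = app (σ r) (σ x) (σ b) := mk_app _

theorem map_glue (σ : ℕ → ℕ) (r x : ℕ) : (glue r x).map σ = glue (σ r) (σ x) := mk_glue _

end Vtx

/-- The number of outputs of vertices with the name `w`. -/
def oc (N : Net) (w : ℕ) : ℕ := (N.map fun v => v.oc w).sum

/-- The number of inputs of vertices with the name `w`. -/
def ic (N : Net) (w : ℕ) : ℕ := (N.map fun v => v.ic w).sum

theorem oc_add (N N' : Net) (w : ℕ) : oc (N + N') w = oc N w + oc N' w := by simp [oc]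

theorem ic_add (N N' : Net) (w : ℕ) : ic (N + N') w = ic N w + ic N' w := by simp [ic]

theorem oc_singleton (v : Vtx) (w : ℕ) : oc {v} w = v.oc w := by simp [oc]

theorem ic_singleton (v : Vtx) (w : ℕ) : ic {v} w = v.ic w := by simp [ic]

section Boundary

variable {n : ℕ}

/-- The number of non-root boundary darts with the name `w`. -/
def bo (β : Fin (n + 1) → ℕ) (w : ℕ) : ℕ := ∑ i : Fin n, delta w (β i.succ)

/-- Every edge name that occurs is the name of exactly one output and one input. -/
def Valid (N : Net) (β : Fin (n + 1) → ℕ) : Prop :=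
  ∀ w, oc N w + bo β w = ic N w + delta w (β 0) ∧ oc N w + bo β w ≤ 1

/-- The labelled darts of a family of vertices. -/
abbrev famPre {ι : Type} (v : ι → Vtx) : Pre where
  D := (i : ι) × Port (v i).kind
  rot := Equiv.sigmaCongrRight fun i => Port.rot (v i).kind
  out d := Port.isOut d.2 = true
  lab d := (v d.1).wire d.2

theorem famPre_good {ι : Type} [Finite ι] (v : ι → Vtx) : (famPre v).Good where
  finite := inferInstance
  deg_le := by
    rintro ⟨i, p⟩
    have h : p.next = p ∨ p.next.next = p ∨ p.next.next.next = p := by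
      generalize (v i).kind = c at p
      cases p <;> simp [Port.next]
    rcases h with h | h | h
    · exact Or.inl (congrArg (Sigma.mk i) h)
    · exact Or.inr (Or.inl (congrArg (Sigma.mk i) h))
    · exact Or.inr (Or.inr (congrArg (Sigma.mk i) h))
  well := by
    rintro ⟨i, p⟩ hp
    -- The witnesses `a` and `b` are numbers of rotation steps from `p` to an output and to an
    -- input.
    have h1 : ∀ {c : Kind} (p : Port c), p.next ≠ p → ∃ a b : ℕ,
        (Port.next^[a] p).isOut = true ∧ ¬ (Port.next^[b] p).isOut = true := by
      intro c p h
      cases p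
      · exact ⟨0, 2, rfl, by decide⟩
      · exact ⟨0, 1, rfl, by decide⟩
      · exact ⟨1, 0, rfl, by decide⟩
      · exact ⟨0, 1, rfl, by decide⟩
      · exact ⟨2, 0, rfl, by decide⟩
      · exact ⟨1, 0, rfl, by decide⟩
      · exact ⟨0, 1, rfl, by decide⟩
      · exact ⟨1, 0, rfl, by decide⟩
      · exact absurd rfl h
    have h2 : ∀ a : ℕ, ((famPre v).rot ^ a) ⟨i, p⟩ =
        (⟨i, Port.next^[a] p⟩ : (i : ι) × Port (v i).kind) := by
      intro a
      induction a with
      | zero => rfl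
      | succ a ih => rw [pow_succ', Equiv.Perm.mul_apply, ih, Function.iterate_succ_apply']; rfl
    obtain ⟨a, b, ha, hb⟩ := h1 p (fun h => hp (congrArg (Sigma.mk i) h))
    exact ⟨_, _, ⟨a, by rw [zpow_natCast, h2]⟩, ⟨b, by rw [zpow_natCast, h2]⟩, ha, hb⟩

/-- The non-root boundary darts. -/
abbrev nonroot (i : Fin (n + 1)) : Prop := i ≠ 0

-- Uniqueness bounds the number of outputs and of inputs with a given name by one; existence of
-- partners says that one number is positive exactly when the other is. For numbers at most one this
-- is equality.
open Classical in
theorem proper_iff_card {B : Type} [Fintype B] (p : Pre) [Fintype p.D] (β : B → ℕ)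
    (pol : B → Prop) : p.Proper β pol ↔
      ∀ w, (Finset.univ.filter fun x => p.outB pol x ∧ p.labB β x = w).card =
        (Finset.univ.filter fun x => ¬ p.outB pol x ∧ p.labB β x = w).card ∧
      (Finset.univ.filter fun x => p.outB pol x ∧ p.labB β x = w).card ≤ 1 := by
  constructor
  · intro h w
    have h1 : (Finset.univ.filter fun x => p.outB pol x ∧ p.labB β x = w).card ≤ 1 := by
      rw [Finset.card_le_one]
      intro a ha b hb
      simp only [Finset.mem_filter, Finset.mem_univ, true_and] at ha hb
      exact h.uniq _ _ (ha.2.trans hb.2.symm) (by tauto)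
    have h2 : (Finset.univ.filter fun x => ¬ p.outB pol x ∧ p.labB β x = w).card ≤ 1 := by
      rw [Finset.card_le_one]
      intro a ha b hb
      simp only [Finset.mem_filter, Finset.mem_univ, true_and] at ha hb
      exact h.uniq _ _ (ha.2.trans hb.2.symm) (by tauto)
    have h3 : 0 < (Finset.univ.filter fun x => p.outB pol x ∧ p.labB β x = w).card ↔
        0 < (Finset.univ.filter fun x => ¬ p.outB pol x ∧ p.labB β x = w).card := by
      rw [Finset.card_pos, Finset.card_pos]
      constructor
      · rintro ⟨x, hx⟩
        simp only [Finset.mem_filter, Finset.mem_univ, true_and] at hx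
        obtain ⟨y, hy1, hy2⟩ := h.ex x
        exact ⟨y, by simp only [Finset.mem_filter, Finset.mem_univ, true_and]
                     exact ⟨by tauto, hy1.trans hx.2⟩⟩
      · rintro ⟨x, hx⟩
        simp only [Finset.mem_filter, Finset.mem_univ, true_and] at hx
        obtain ⟨y, hy1, hy2⟩ := h.ex x
        exact ⟨y, by simp only [Finset.mem_filter, Finset.mem_univ, true_and]
                     exact ⟨by tauto, hy1.trans hx.2⟩⟩
    omega
  · intro h
    refine ⟨fun x => ?_, fun x y hl ho => ?_⟩
    · obtain ⟨h1, -⟩ := h (p.labB β x)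
      by_cases hx : p.outB pol x
      · have : 0 < (Finset.univ.filter fun y => p.outB pol y ∧ p.labB β y = p.labB β x).card :=
          Finset.card_pos.2 ⟨x, by simp [hx]⟩
        rw [h1, Finset.card_pos] at this
        obtain ⟨y, hy⟩ := this
        simp only [Finset.mem_filter, Finset.mem_univ, true_and] at hy
        exact ⟨y, hy.2, by tauto⟩
      · have : 0 < (Finset.univ.filter fun y => ¬ p.outB pol y ∧ p.labB β y = p.labB β x).card :=
          Finset.card_pos.2 ⟨x, by simp [hx]⟩
        rw [← h1, Finset.card_pos] at this
        obtain ⟨y, hy⟩ := this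
        simp only [Finset.mem_filter, Finset.mem_univ, true_and] at hy
        exact ⟨y, hy.2, by tauto⟩
    · obtain ⟨h1, h2⟩ := h (p.labB β x)
      by_cases hx : p.outB pol x
      · exact Finset.card_le_one.1 h2 x (by simp [hx]) y (by simp [ho.1 hx, hl])
      · rw [h1] at h2
        exact Finset.card_le_one.1 h2 x (by simp [hx]) y
          (by simp [show ¬ p.outB pol y by tauto, hl])

/-- Turns properness into linear conditions on counts that are additive in the multiset of vertices.
Validity after a rewriting step thereby becomes a matter for `omega`, one name at a time. -/
theorem proper_iff_valid {ι : Type} [Fintype ι] (v : ι → Vtx) (β : Fin (n + 1) → ℕ) :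
    (famPre v).Proper β nonroot ↔ Valid (Finset.univ.val.map v) β := by
  classical
  rw [proper_iff_card]
  refine forall_congr' fun w => ?_
  have h1 : (Finset.univ.filter fun x => (famPre v).outB (nonroot (n := n)) x ∧
      (famPre v).labB β x = w).card = oc (Finset.univ.val.map v) w + bo β w := by
    rw [Finset.card_filter, Fintype.sum_sum_type, Fintype.sum_sigma, Fin.sum_univ_succ]
    simp only [Sum.elim_inl, Sum.elim_inr, nonroot, oc, Multiset.map_map, bo]
    congr 1
    · refine Finset.sum_congr rfl fun i _ => Finset.sum_congr rfl fun p _ => ?_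
      have e : ((v i).wire p = w) = (w = (v i).wire p) := propext eq_comm
      simp only [delta, e]
      by_cases hp : p.isOut = true <;> simp [hp]
    · simp [delta, eq_comm]
  have h2 : (Finset.univ.filter fun x => ¬ (famPre v).outB (nonroot (n := n)) x ∧
      (famPre v).labB β x = w).card = ic (Finset.univ.val.map v) w + delta w (β 0) := by
    rw [Finset.card_filter, Fintype.sum_sum_type, Fintype.sum_sigma, Fin.sum_univ_succ]
    simp only [Sum.elim_inl, Sum.elim_inr, nonroot, ic, Multiset.map_map]
    congr 1
    · refine Finset.sum_congr rfl fun i _ => Finset.sum_congr rfl fun p _ => ?_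
      have e : ((v i).wire p = w) = (w = (v i).wire p) := propext eq_comm
      simp only [delta, e]
      by_cases hp : p.isOut = true <;> simp [hp]
    · simp [delta, eq_comm]
  rw [h1, h2]

theorem exists_family (N : Net) : ∃ (m : ℕ) (v : Fin m → Vtx), Finset.univ.val.map v = N := by
  induction N using Quotient.inductionOn with
  | h l => exact ⟨l.length, l.get, by rw [Fin.univ_val_map, List.ofFn_get]; rfl⟩

/-- Equal multisets have fibres of equal size over every vertex; bijections of the fibres assemble
into a reindexing. -/
theorem exists_reindex {ι ι' : Type} [Fintype ι] [Fintype ι'] (v : ι → Vtx) (v' : ι' → Vtx)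
    (h : (Finset.univ.val.map v) = Finset.univ.val.map v') : ∃ σ : ι ≃ ι', ∀ i, v' (σ i) = v i := by
  classical
  have hc : ∀ c, Nonempty ({i // v i = c} ≃ {i // v' i = c}) := by
    intro c
    have := congrArg (Multiset.count c) h
    rw [Multiset.count_map, Multiset.count_map] at this
    rw [← Fintype.card_eq, Fintype.card_subtype, Fintype.card_subtype]
    simp only [eq_comm (b := c)]
    exact this
  let f := fun c => Classical.choice (hc c)
  exact ⟨Equiv.ofFiberEquiv f, fun i => Equiv.ofFiberEquiv_map f i⟩

/-- `M` is a map with the vertices `N` and boundary names `β`. -/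
def Realizes (M : OrientedMap (Fin (n + 1))) (N : Net) (β : Fin (n + 1) → ℕ) : Prop :=
  ∃ (m : ℕ) (v : Fin m → Vtx), Finset.univ.val.map v = N ∧
    Nonempty (Realization M (famPre v) β nonroot)

theorem realization_reindex {ι ι' : Type} [Fintype ι] [Fintype ι'] {v : ι → Vtx} {v' : ι' → Vtx}
    (h : Finset.univ.val.map v = Finset.univ.val.map v') {M : OrientedMap (Fin (n + 1))}
    {β : Fin (n + 1) → ℕ} (R : Realization M (famPre v) β nonroot) :
    Nonempty (Realization M (famPre v') β nonroot) := by
  obtain ⟨σ, hσ⟩ := exists_reindex v' v h.symm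
  obtain rfl : v' = fun i => v (σ i) := by funext i; rw [hσ]
  exact ⟨R.congr (Equiv.sigmaCongrLeft (β := fun i => Port (v i).kind) σ) (fun _ => rfl)
    (fun _ => Iff.rfl) (fun _ => rfl)⟩

theorem Realizes.family {ι : Type} [Fintype ι] {v : ι → Vtx} {M : OrientedMap (Fin (n + 1))}
    {β : Fin (n + 1) → ℕ} (h : Realizes M (Finset.univ.val.map v) β) :
    Nonempty (Realization M (famPre v) β nonroot) := by
  obtain ⟨m, v', hv, ⟨R⟩⟩ := h
  exact realization_reindex hv R

theorem Realization.realizes {ι : Type} [Fintype ι] {v : ι → Vtx} {M : OrientedMap (Fin (n + 1))}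
    {β : Fin (n + 1) → ℕ} (R : Realization M (famPre v) β nonroot) :
    Realizes M (Finset.univ.val.map v) β := by
  obtain ⟨m, v', hv⟩ := exists_family (Finset.univ.val.map v)
  exact ⟨m, v', hv, realization_reindex hv.symm R⟩

theorem Realizes.isomorphic {M M' : OrientedMap (Fin (n + 1))} {N : Net} {β : Fin (n + 1) → ℕ}
    (h : Realizes M N β) (h' : Realizes M' N β) (hv : Valid N β) : Isomorphic M M' := by
  obtain ⟨m, v, rfl, ⟨R⟩⟩ := h
  obtain ⟨R'⟩ := h'.family
  exact R.isomorphic R' ((proper_iff_valid v β).2 hv)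

end Boundary

end ImploidMoves


namespace ImploidMoves

/-! ### Nets of the moves, and simulation -/

section NetVerts

variable {m k : ℕ}

/-- The vertices of a net, where `f i` is the name of the `i`-th edge. -/
def netVerts (κ : Fin m → Kind) (w : List (NetDart κ k × NetDart κ k)) (f : ℕ → ℕ) : Net :=
  Finset.univ.val.map fun i : Fin m => ⟨κ i, fun p => f (edgeIdx w (Sum.inl ⟨i, p⟩))⟩

variable {n : ℕ}

/-- The labelled darts of a disjoint union of families. -/
theorem famPre_sum_realization {B ι : Type} {κ : Fin m → Kind}
    {w : List (NetDart κ k × NetDart κ k)} (hw : ValidNet κ w) {f : ℕ → ℕ} {v : ι → Vtx}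
    {M : OrientedMap B} {β : B → ℕ} {pol : B → Prop} :
    let u : ι ⊕ Fin m → Vtx :=
      Sum.elim v fun i : Fin m => ⟨κ i, fun p => f (edgeIdx w (Sum.inl ⟨i, p⟩))⟩
    let q := (famPre v).sum (ofMap (net κ w hw) fun x => f (edgeIdx w x))
    ((famPre u).Proper β pol → q.Proper β pol) ∧
    (Nonempty (Realization M (famPre u) β pol) ↔ Nonempty (Realization M q β pol)) := by
  intro u q
  let F : (famPre u).D ≃ q.D := Equiv.sumSigmaDistrib fun i => Port (u i).kind
  have hrot : ∀ d, q.rot (F d) = F ((famPre u).rot d) := by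
    rintro ⟨i | i, p⟩ <;> rfl
  have hout : ∀ d, q.out (F d) ↔ (famPre u).out d := by
    rintro ⟨i | i, p⟩
    · rfl
    · exact hw.2.2.2 i p
  have hlab : ∀ d, q.lab (F d) = (famPre u).lab d := by
    rintro ⟨i | i, p⟩ <;> rfl
  have hs : ∀ d, F (F.symm d) = d := F.apply_symm_apply
  refine ⟨fun h => h.congr F.symm (fun d => ?_) (fun d => ?_), fun ⟨R⟩ => ⟨R.congr F.symm
    (fun d => ?_) (fun d => ?_) (fun d => ?_)⟩, fun ⟨R⟩ => ⟨R.congr F hrot hout hlab⟩⟩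
  · rw [← hout, hs]
  · rw [← hlab, hs]
  · apply F.injective
    rw [← hrot, hs, hs]
  · rw [← hout, hs]
  · rw [← hlab, hs]

theorem univ_map_sum {ι : Type} [Fintype ι] {κ : Fin m → Kind}
    {w : List (NetDart κ k × NetDart κ k)} {f : ℕ → ℕ} {v : ι → Vtx} :
    Finset.univ.val.map (Sum.elim v fun i : Fin m =>
      (⟨κ i, fun p => f (edgeIdx w (Sum.inl ⟨i, p⟩))⟩ : Vtx)) =
      Finset.univ.val.map v + netVerts κ w f := by
  rw [← Finset.univ_disjSum_univ, Finset.val_disjSum, Multiset.disjSum, Multiset.map_add,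
    Multiset.map_map, Multiset.map_map]
  rfl

/-- The well-oriented rooted map given by a connected map. -/
def OrientedMap.toRooted (M : OrientedMap (Fin (n + 1)))
    (h : ∀ x y, Relation.EqvGen M.Adj x y) : OrientedRootedMap n :=
  { M.toOpenMap with connected := h, orient := M.orient }

/-- Every realization of the second net arises by moves from a realization of the first one. -/
def Simulates (ms : Set Move) (N : Net) (β : Fin (n + 1) → ℕ) (N' : Net) (β' : Fin (n + 1) → ℕ) :
    Prop :=
  ∀ M' : OrientedRootedMap n, Realizes M'.toOrientedMap N' β' →
    ∃ M : OrientedRootedMap n, Realizes M.toOrientedMap N β ∧ Relation.ReflTransGen (Step ms) M M'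

theorem Simulates.trans {ms : Set Move} {N N' N'' : Net} {β β' β'' : Fin (n + 1) → ℕ}
    (h : Simulates ms N β N' β') (h' : Simulates ms N' β' N'' β'') : Simulates ms N β N'' β'' := by
  intro M'' hM''
  obtain ⟨M', hM', h1⟩ := h' M'' hM''
  obtain ⟨M, hM, h2⟩ := h M' hM'
  exact ⟨M, hM, h2.trans h1⟩

/-- The vertices of `C` form one context for both sides of the move: by `hf` the patterns give the
same names to their legs, and by `hQ`, `hQ'` the same directions. The left-hand map is then the
tautological realization of its names, and only its connectedness has to be proved. -/
theorem simulates_move {ms : Set Move} {m' : ℕ} {κ : Fin m → Kind} {κ' : Fin m' → Kind}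
    {w : List (NetDart κ k × NetDart κ k)} {w' : List (NetDart κ' k × NetDart κ' k)}
    {hw : ValidNet κ w} {hw' : ValidNet κ' w'}
    (hms : (⟨k, net κ w hw, net κ' w' hw'⟩ : Move) ∈ ms) {Q : Fin k → Bool}
    (hQ : LegSpec κ w Q) (hQ' : LegSpec κ' w' Q) (hE : EdgeSpec κ w) (hE' : EdgeSpec κ' w')
    {l : ℕ} {p₀ : (i : Fin m) × Port (κ i)} (hR : ReachSpec κ w l p₀)
    (p₁ : (i : Fin m') × Port (κ' i)) (C : Net) {f f' : ℕ → ℕ}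
    (hf : ∀ i, f (edgeIdx w (leg i)) = f' (edgeIdx w' (leg i))) {β : Fin (n + 1) → ℕ}
    (hv : Valid (C + netVerts κ w f) β) (hv' : Valid (C + netVerts κ' w' f') β) :
    Simulates ms (C + netVerts κ w f) β (C + netVerts κ' w' f') β := by
  intro M' hM'
  obtain ⟨j, v, rfl⟩ := exists_family C
  rw [← univ_map_sum, ← proper_iff_valid] at hv hv'
  rw [← univ_map_sum] at hM' ⊢
  have hp := (famPre_sum_realization (M := M'.toOrientedMap) hw).1 hv
  have hp' := (famPre_sum_realization (M := M'.toOrientedMap) hw').1 hv'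
  obtain ⟨R'⟩ := (famPre_sum_realization hw').2.1 hM'.family
  have hg : ∀ x, f (edgeIdx w (partner w x)) = f (edgeIdx w x) := fun x => by rw [hE.2]
  have hg' : ∀ x, f' (edgeIdx w' (partner w' x)) = f' (edgeIdx w' x) := fun x => by rw [hE'.2]
  have hatt : ∃ att : Fin k → (i : Fin m) × Port (κ i), ∀ h, partner w (Sum.inr h) =
      Sum.inl (att h) := by
    refine ⟨fun h => (partner w (Sum.inr h)).getLeft (hE.1 h), fun h => ?_⟩
    rw [Sum.inl_getLeft]
  have hatt' : ∃ att : Fin k → (i : Fin m') × Port (κ' i), ∀ h, partner w' (Sum.inr h) =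
      Sum.inl (att h) := by
    refine ⟨fun h => (partner w' (Sum.inr h)).getLeft (hE'.1 h), fun h => ?_⟩
    rw [Sum.inl_getLeft]
  obtain ⟨att, hatt⟩ := hatt
  obtain ⟨att', hatt'⟩ := hatt'
  have hgood : (famPre (Sum.elim v fun i : Fin m =>
      (⟨κ i, fun p => f (edgeIdx w (Sum.inl ⟨i, p⟩))⟩ : Vtx))).Good := famPre_good _
  obtain ⟨R⟩ := (famPre_sum_realization hw).2.1 ⟨Realization.self _ hgood hv⟩
  -- Connectedness is transported against the direction of the move, from the result to its source.
  have hconn := connected_of_realization (P := net κ w hw) (P' := net κ' w' hw') hp hp' hg hg'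
    hatt hatt' hf p₀ (fun d => netReach_spec hw l p₀ d (hR d)) p₁ R R' M'.connected
  have hc := Pre.Proper.context (P := net κ w hw) hp hg hatt
  have hc' := Pre.Proper.context (P := net κ' w' hw') hp' hg' hatt'
  -- The two boundary labellings of the context agree; with `e2` this makes the two contexts
  -- literally the same map.
  have e1 : ctxLab (net κ w hw) (fun x => f (edgeIdx w x)) β =
      ctxLab (net κ' w' hw') (fun x => f' (edgeIdx w' x)) β := by
    funext z
    rcases z with b | h
    · rfl
    · exact hf h
  have e2 : ctxPol (net κ w hw) (nonroot (n := n)) = ctxPol (net κ' w' hw') nonroot := by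
    funext z
    rcases z with b | h
    · rfl
    · exact propext (not_congr ((hQ h).trans (hQ' h).symm))
  refine ⟨OrientedMap.toRooted _ hconn, (Realization.self _ hgood hv).realizes,
    .single ⟨_, hms, (famPre v).toMap (famPre_good v) _ _ hc,
      isGluing_of_realization (famPre_good v) hc hp hg hatt R, ?_⟩⟩
  have := isGluing_of_realization (famPre_good v) hc' hp' hg' hatt' R'
  simp only [← e1, ← e2] at this
  exact this

/-- The right-hand side of this move has no vertices, so the effect on nets is not a replacement of
vertices but the renaming `σ` that merges the two edges at the removed vertex. -/
theorem simulates_elim {ms : Set Move} (hms : moveGlueElim ∈ ms) (C : Net) {s t : ℕ} (hne : s ≠ t)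
    {σ : ℕ → ℕ} (hst : σ s = σ t)
    (hσ : ∀ a b, σ a = σ b → a = b ∨ a = s ∧ b = t ∨ a = t ∧ b = s) {β : Fin (n + 1) → ℕ}
    (hv : Valid (C + {.glue t s}) β) (hv' : Valid (C.map (Vtx.map σ)) fun i => σ (β i)) :
    Simulates ms (C + {.glue t s}) β (C.map (Vtx.map σ)) fun i => σ (β i) := by
  intro M' hM'
  obtain ⟨j, v, rfl⟩ := exists_family C
  -- Edge 0 of the pattern enters the 2-valent vertex and edge 1 leaves it.
  let f : ℕ → ℕ := fun i => if i = 0 then s else t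
  let κ : Fin 1 → Kind := ![.glue]
  let w : List (NetDart κ 2 × NetDart κ 2) := [(leg 0, port 0 .src), (port 0 .tgt, leg 1)]
  have hw : ValidNet κ w := by decide
  have hE : EdgeSpec κ w := by decide
  have hN : netVerts κ w f = {.glue t s} := by
    exact congrArg (fun v : Vtx => ({v} : Net))
      (Vtx.mk_glue fun p => f (edgeIdx w (Sum.inl ⟨0, p⟩)))
  rw [← hN, ← univ_map_sum, ← proper_iff_valid] at hv
  rw [← hN, ← univ_map_sum]
  rw [Multiset.map_map, ← Function.comp_def, ← proper_iff_valid] at hv'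
  rw [Multiset.map_map] at hM'
  have hp := (famPre_sum_realization (M := M'.toOrientedMap) hw).1 hv
  have hp' : ((famPre v).map σ).Proper (fun b => σ (β b)) nonroot := hv'
  obtain ⟨R'⟩ : Nonempty (Realization M'.toOrientedMap ((famPre v).map σ) (fun b => σ (β b))
    nonroot) := hM'.family
  have hgood : (famPre (Sum.elim v fun i : Fin 1 =>
      (⟨κ i, fun p => f (edgeIdx w (Sum.inl ⟨i, p⟩))⟩ : Vtx))).Good := famPre_good _
  obtain ⟨R⟩ := (famPre_sum_realization hw).2.1 ⟨Realization.self _ hgood hv⟩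
  have hgw : (fun x => f (edgeIdx w x)) = glueWire s t := by
    funext x
    rcases x with ⟨i, p⟩ | i
    · fin_cases i
      cases p <;> rfl
    · fin_cases i <;> rfl
  -- The labelling occurs inside dependent types, so `hgw` is used after replacing it by an
  -- arbitrary `g`.
  have hp : ((famPre v).sum (ofMap glueNet (glueWire s t))).Proper β nonroot := by
    have : ∀ g, (fun x => f (edgeIdx w x)) = g →
        ((famPre v).sum (ofMap (net κ w hw) g)).Proper β nonroot := by
      rintro _ rfl
      exact hp
    exact this _ hgw
  have R : Realization ((famPre (Sum.elim v fun i : Fin 1 =>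
      (⟨κ i, fun p => f (edgeIdx w (Sum.inl ⟨i, p⟩))⟩ : Vtx))).toMap hgood β nonroot hv)
      ((famPre v).sum (ofMap glueNet (glueWire s t))) β nonroot := by
    have : ∀ g, (fun x => f (edgeIdx w x)) = g → Realization ((famPre (Sum.elim v fun i : Fin 1 =>
        (⟨κ i, fun p => f (edgeIdx w (Sum.inl ⟨i, p⟩))⟩ : Vtx))).toMap hgood β nonroot hv)
        ((famPre v).sum (ofMap (net κ w hw) g)) β nonroot := by
      rintro _ rfl
      exact R
    exact this _ hgw
  have hconn := connected_of_elim hp hp' hne hσ R R' M'.connected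
  have hc := Pre.Proper.context (P := glueNet) hp (glueWire_e s t) glueAtt_e
  exact ⟨OrientedMap.toRooted _ hconn, (Realization.self _ hgood hv).realizes,
    .single ⟨_, hms, (famPre v).toMap (famPre_good v) _ _ hc,
      isGluing_of_realization (famPre_good v) hc hp (glueWire_e s t) glueAtt_e R,
      isGluing_edgeNet (famPre_good v) hc hp' hst hσ R'⟩⟩

end NetVerts

end ImploidMoves


namespace ImploidMoves

/-! ### The moves as rules on nets -/

/-- The vertices of a concrete net reduce to an explicit list; these lemmas rewrite it as a sum of
singletons, in which `abel` can rearrange vertices. -/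
theorem coe_one {a a' : Vtx} (ha : a = a') : (↑[a] : Net) = {a'} := by subst ha; rfl

theorem coe_two {a a' b b' : Vtx} (ha : a = a') (hb : b = b') :
    (↑[a, b] : Net) = {a'} + {b'} := by subst ha hb; rfl

theorem coe_three {a a' b b' c c' : Vtx} (ha : a = a') (hb : b = b') (hc : c = c') :
    (↑[a, b, c] : Net) = {a'} + {b'} + {c'} := by subst ha hb hc; rfl

theorem coe_four {a a' b b' c c' d d' : Vtx} (ha : a = a') (hb : b = b') (hc : c = c')
    (hd : d = d') : (↑[a, b, c, d] : Net) = {a'} + {b'} + {c'} + {d'} := by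
  subst ha hb hc hd; rfl

theorem coe_five {a a' b b' c c' d d' e e' : Vtx} (ha : a = a') (hb : b = b') (hc : c = c')
    (hd : d = d') (he : e = e') : (↑[a, b, c, d, e] : Net) = {a'} + {b'} + {c'} + {d'} + {e'} := by
  subst ha hb hc hd he; rfl

/-! ### Unused edge names -/

section Fresh

variable {n : ℕ}

theorem exists_bound (N : Net) (β : Fin (n + 1) → ℕ) :
    ∃ K, ∀ w, K ≤ w → oc N w + bo β w = 0 := by
  have h1 : ∃ K, ∀ w, K ≤ w → oc N w = 0 := by
    induction N using Multiset.induction_on with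
    | empty => exact ⟨0, fun w _ => rfl⟩
    | cons v N ih =>
      obtain ⟨K, hK⟩ := ih
      refine ⟨max K (Finset.univ.sup v.wire + 1), fun w hw => ?_⟩
      rw [← Multiset.singleton_add, oc_add, oc_singleton, hK w (le_of_max_le_left hw), add_zero,
        Vtx.oc]
      refine Finset.sum_eq_zero fun p _ => ?_
      have h2 : v.wire p ≤ Finset.univ.sup v.wire := Finset.le_sup (Finset.mem_univ p)
      have h3 := le_of_max_le_right hw
      have h4 : w ≠ v.wire p := by omega
      simp [delta, h4]
  obtain ⟨K, hK⟩ := h1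
  refine ⟨max K (Finset.univ.sup β + 1), fun w hw => ?_⟩
  rw [hK w (le_of_max_le_left hw), zero_add, bo]
  refine Finset.sum_eq_zero fun i _ => ?_
  have h2 : β i.succ ≤ Finset.univ.sup β := Finset.le_sup (Finset.mem_univ _)
  have h3 := le_of_max_le_right hw
  have h4 : w ≠ β i.succ := by omega
  simp [delta, h4]

/-- Only finitely many names occur. Freshness is phrased as one more inequality of the kind found in
`Valid`, so that it can be combined with validity arithmetically. -/
theorem Valid.fresh {N : Net} {β : Fin (n + 1) → ℕ} (h : Valid N β) :
    ∃ u, ∀ w, delta w u + (oc N w + bo β w) ≤ 1 := by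
  obtain ⟨K, hK⟩ := exists_bound N β
  refine ⟨K, fun w => ?_⟩
  by_cases hw : w = K
  · rw [hK w hw.ge]
    simp [delta, hw]
  · have := (h w).2
    simpa [delta, hw] using this

theorem Valid.fresh_two {N : Net} {β : Fin (n + 1) → ℕ} (h : Valid N β) :
    ∃ u v, ∀ w, delta w u + delta w v + (oc N w + bo β w) ≤ 1 := by
  obtain ⟨K, hK⟩ := exists_bound N β
  refine ⟨K, K + 1, fun w => ?_⟩
  by_cases hw : w = K
  · rw [hK w hw.ge]
    simp [delta, hw]
  · by_cases hw' : w = K + 1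
    · rw [hK w (by omega)]
      simp [delta, hw']
    · have := (h w).2
      simpa [delta, hw, hw'] using this

end Fresh

/-- The net `N` is valid, and all realizations of the net `N₀` arise from it by moves. -/
structure Back {n : ℕ} (ms : Set Move) (N₀ : Net) (β₀ : Fin (n + 1) → ℕ) (β : Fin (n + 1) → ℕ)
    (N : Net) : Prop where
  valid : Valid N β
  sim : Simulates ms N β N₀ β₀

theorem Back.refl {n : ℕ} {ms : Set Move} {N : Net} {β : Fin (n + 1) → ℕ} (h : Valid N β) :
    Back ms N β β N := ⟨h, fun M hM => ⟨M, hM, .refl⟩⟩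

/-- Counts of occurrences detect the name at every port, so a name with count zero can be renamed
without effect. -/
theorem map_update_of_fresh {C : Net} {u a : ℕ} (ho : oc C u = 0) (hi : ic C u = 0) :
    C.map (Vtx.map (Function.update id u a)) = C := by
  conv_rhs => rw [← Multiset.map_id C]
  refine Multiset.map_congr rfl fun v hv => ?_
  obtain ⟨C', rfl⟩ := Multiset.exists_cons_of_mem hv
  rw [← Multiset.singleton_add, oc_add, oc_singleton] at ho
  rw [← Multiset.singleton_add, ic_add, ic_singleton] at hi
  have ho' : v.oc u = 0 := by omega
  have hi' : v.ic u = 0 := by omega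
  rw [Vtx.oc, Finset.sum_eq_zero_iff] at ho'
  rw [Vtx.ic, Finset.sum_eq_zero_iff] at hi'
  rcases v with ⟨k, w⟩
  simp only [Vtx.map, id]
  congr 1
  funext p
  have h1 := ho' p (Finset.mem_univ p)
  have h2 := hi' p (Finset.mem_univ p)
  have h3 : w p ≠ u := by
    intro h
    by_cases hp : p.isOut = true <;> simp [hp, delta, h] at h1 h2
  simp [h3]

theorem update_id_eq {u a x y : ℕ} (h : Function.update id u a x = Function.update id u a y) :
    x = y ∨ x = a ∧ y = u ∨ x = u ∧ y = a := by
  by_cases hx : x = u <;> by_cases hy : y = u <;> simp_all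

theorem delta_self (u : ℕ) : delta u u = 1 := if_pos rfl

theorem delta_eq_zero {w u : ℕ} (h : delta w u = 0) : w ≠ u := by
  rintro rfl
  simp [delta] at h

/-! ### Backward rewriting rules for the moves -/

section Rules

set_option linter.unusedSimpArgs false

variable {n : ℕ} {ms : Set Move} {N₀ : Net} {β₀ β : Fin (n + 1) → ℕ}

theorem Back.congr {N N' : Net} (h : Back ms N₀ β₀ β N) (e : N = N') : Back ms N₀ β₀ β N' := e ▸ h

/-- The lists `f` and `f'` give the names of the edges of the two patterns in the order in which
they are listed. In every use below they have as many entries as there are edges, so the default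
value 0 is never read. Validity of the new net is a separate hypothesis because its inner edges may
bear new names. -/
theorem Back.move {m m' k : ℕ} {κ : Fin m → Kind} {κ' : Fin m' → Kind}
    {w : List (NetDart κ k × NetDart κ k)} {w' : List (NetDart κ' k × NetDart κ' k)}
    {hw : ValidNet κ w} {hw' : ValidNet κ' w'}
    (hms : (⟨k, net κ w hw, net κ' w' hw'⟩ : Move) ∈ ms) (Q : Fin k → Bool)
    (hQ : LegSpec κ w Q) (hQ' : LegSpec κ' w' Q) (hE : EdgeSpec κ w) (hE' : EdgeSpec κ' w')
    {l : ℕ} {p₀ : (i : Fin m) × Port (κ i)} (hR : ReachSpec κ w l p₀)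
    (p₁ : (i : Fin m') × Port (κ' i)) {C L R : Net} (f f' : List ℕ)
    (hL : netVerts κ w (fun i => f.getD i 0) = L) (hR' : netVerts κ' w' (fun i => f'.getD i 0) = R)
    (hf : ∀ i, f.getD (edgeIdx w (leg i)) 0 = f'.getD (edgeIdx w' (leg i)) 0)
    (h : Back ms N₀ β₀ β (C + R)) (hv : Valid (C + L) β) : Back ms N₀ β₀ β (C + L) := by
  subst hL hR'
  exact ⟨hv, (simulates_move hms hQ hQ' hE hE' hR p₁ C hf hv h.valid).trans h.sim⟩

/-- Undoing an elimination cuts an edge `a` near one vertex: there the end is renamed to a fresh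
`u`, and a 2-valent vertex bridges `u` and `a`. The renaming of `u` to `a` reverts this and affects
no other vertex, as `u` occurs nowhere else. The alternatives in `hst` are the two possible
directions of the bridge. -/
theorem Back.elim (hms : moveGlueElim ∈ ms) {C : Net} {v v' : Vtx} {u a : ℕ}
    (h : Back ms N₀ β₀ β (C + {v'})) (hv : v.map (Function.update id u a) = v')
    (hu : ∀ w, delta w u + (oc (C + {v'}) w + bo β w) ≤ 1)
    (ha : 1 ≤ oc (C + {v'}) a + bo β a) {s t : ℕ}
    (hst : s = u ∧ t = a ∨ s = a ∧ t = u) (hval : Valid (C + {v} + {.glue t s}) β) :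
    Back ms N₀ β₀ β (C + {v} + {.glue t s}) := by
  have h0 := hu u
  have h1 := (h.valid u).1
  rw [delta_self] at h0
  rw [oc_add] at h0 h1
  rw [ic_add] at h1
  have hC : (C + {v}).map (Vtx.map (Function.update id u a)) = C + {v'} := by
    rw [Multiset.map_add, map_update_of_fresh (by omega) (by omega), Multiset.map_singleton, hv]
  have hβ : (fun i => Function.update id u a (β i)) = β := by
    funext i
    have h2 : β i ≠ u := by
      rintro h3
      induction i using Fin.cases with
      | zero => rw [h3, delta_self] at h1; omega
      | succ i =>
        have h4 : bo β u = 0 := by omega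
        rw [bo, Finset.sum_eq_zero_iff] at h4
        exact delta_eq_zero (h4 i (Finset.mem_univ i)) h3.symm
    simp [h2]
  -- The name `a` is in use and `u` is not.
  have hne : u ≠ a := by
    rintro rfl
    have h2 := hu u
    rw [delta_self] at h2
    omega
  have hval' := h.valid
  rw [← hC, ← hβ] at hval'
  refine ⟨hval, Simulates.trans ?_ h.sim⟩
  have := simulates_elim hms (C + {v}) (s := s) (t := t) (σ := Function.update id u a)
    (by rcases hst with ⟨rfl, rfl⟩ | ⟨rfl, rfl⟩ <;> tauto)
    (by rcases hst with ⟨rfl, rfl⟩ | ⟨rfl, rfl⟩ <;> simp [hne.symm])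
    (fun x y hxy => by
      rcases hst with ⟨rfl, rfl⟩ | ⟨rfl, rfl⟩ <;> rcases update_id_eq hxy with h | h | h <;> tauto)
    hval hval'
  rwa [hC, hβ] at this

theorem oc_pos_of_ic {N : Net} (h : Valid N β) {a : ℕ} (ha : 1 ≤ ic N a) :
    1 ≤ oc N a + bo β a := by
  rw [(h a).1]
  omega

/-- This and the next rules insert a bullet at a chosen port. At an input port the bullet leads from
the old name to the fresh one; at an output port from the fresh name to the old one. -/
theorem Back.elimArg (hms : moveGlueElim ∈ ms) {C : Net} {c a f : ℕ}
    (h : Back ms N₀ β₀ β (C + {.app c a f})) :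
    ∃ u, Back ms N₀ β₀ β (C + {.app c u f} + {.glue u a}) := by
  obtain ⟨u, hu⟩ := h.valid.fresh
  have hc := hu c
  have hf := hu f
  have hv := h.valid f
  simp only [oc_add, ic_add, oc_singleton, ic_singleton, Vtx.oc_app, Vtx.ic_app, delta_self]
    at hc hf hv
  refine ⟨u, h.elim hms (u := u) (a := a) ?_ hu ?_ (Or.inr ⟨rfl, rfl⟩) fun w => ?_⟩
  · rw [Vtx.map_app, Function.update_self, Function.update_of_ne, Function.update_of_ne]
    · rfl
    · exact delta_eq_zero (by omega)
    · exact delta_eq_zero (by omega)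
  · apply oc_pos_of_ic h.valid
    simp only [ic_add, ic_singleton, Vtx.ic_app, delta_self]
    omega
  · have h1 := h.valid w
    have h2 := hu w
    simp only [oc_add, ic_add, oc_singleton, ic_singleton, Vtx.oc_app, Vtx.ic_app, Vtx.oc_glue,
      Vtx.ic_glue] at h1 h2 ⊢
    omega

theorem Back.elimFn (hms : moveGlueElim ∈ ms) {C : Net} {c a f : ℕ}
    (h : Back ms N₀ β₀ β (C + {.app c a f})) :
    ∃ u, Back ms N₀ β₀ β (C + {.app c a u} + {.glue u f}) := by
  obtain ⟨u, hu⟩ := h.valid.fresh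
  have hc := hu c
  have hf := hu a
  have hv := h.valid a
  simp only [oc_add, ic_add, oc_singleton, ic_singleton, Vtx.oc_app, Vtx.ic_app, delta_self]
    at hc hf hv
  refine ⟨u, h.elim hms (u := u) (a := f) ?_ hu ?_ (Or.inr ⟨rfl, rfl⟩) fun w => ?_⟩
  · rw [Vtx.map_app, Function.update_self, Function.update_of_ne, Function.update_of_ne]
    · rfl
    · exact delta_eq_zero (by omega)
    · exact delta_eq_zero (by omega)
  · apply oc_pos_of_ic h.valid
    simp only [ic_add, ic_singleton, Vtx.ic_app, delta_self]
    omega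
  · have h1 := h.valid w
    have h2 := hu w
    simp only [oc_add, ic_add, oc_singleton, ic_singleton, Vtx.oc_app, Vtx.ic_app, Vtx.oc_glue,
      Vtx.ic_glue] at h1 h2 ⊢
    omega

theorem Back.elimCont (hms : moveGlueElim ∈ ms) {C : Net} {c a f : ℕ}
    (h : Back ms N₀ β₀ β (C + {.app c a f})) :
    ∃ u, Back ms N₀ β₀ β (C + {.app u a f} + {.glue c u}) := by
  obtain ⟨u, hu⟩ := h.valid.fresh
  have hc := hu a
  have hf := hu f
  have hv := h.valid a
  have hv' := h.valid f
  simp only [oc_add, ic_add, oc_singleton, ic_singleton, Vtx.oc_app, Vtx.ic_app, delta_self]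
    at hc hf hv hv'
  refine ⟨u, h.elim hms (u := u) (a := c) ?_ hu ?_ (Or.inl ⟨rfl, rfl⟩) fun w => ?_⟩
  · rw [Vtx.map_app, Function.update_self, Function.update_of_ne, Function.update_of_ne]
    · rfl
    · exact delta_eq_zero (by omega)
    · exact delta_eq_zero (by omega)
  · simp only [oc_add, oc_singleton, Vtx.oc_app, delta_self]
    omega
  · have h1 := h.valid w
    have h2 := hu w
    simp only [oc_add, ic_add, oc_singleton, ic_singleton, Vtx.oc_app, Vtx.ic_app, Vtx.oc_glue,
      Vtx.ic_glue] at h1 h2 ⊢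
    omega

theorem Back.elimBody (hms : moveGlueElim ∈ ms) {C : Net} {r x b : ℕ}
    (h : Back ms N₀ β₀ β (C + {.lam r x b})) :
    ∃ u, Back ms N₀ β₀ β (C + {.lam r x u} + {.glue u b}) := by
  obtain ⟨u, hu⟩ := h.valid.fresh
  have hc := hu r
  have hf := hu x
  simp only [oc_add, oc_singleton, Vtx.oc_lam, delta_self] at hc hf
  refine ⟨u, h.elim hms (u := u) (a := b) ?_ hu ?_ (Or.inr ⟨rfl, rfl⟩) fun w => ?_⟩
  · rw [Vtx.map_lam, Function.update_self, Function.update_of_ne, Function.update_of_ne]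
    · rfl
    · exact delta_eq_zero (by omega)
    · exact delta_eq_zero (by omega)
  · apply oc_pos_of_ic h.valid
    simp only [ic_add, ic_singleton, Vtx.ic_lam, delta_self]
    omega
  · have h1 := h.valid w
    have h2 := hu w
    simp only [oc_add, ic_add, oc_singleton, ic_singleton, Vtx.oc_lam, Vtx.ic_lam, Vtx.oc_glue,
      Vtx.ic_glue] at h1 h2 ⊢
    omega

theorem Back.elimGlue (hms : moveGlueElim ∈ ms) {C : Net} {t s : ℕ}
    (h : Back ms N₀ β₀ β (C + {.glue t s})) :
    ∃ u, Back ms N₀ β₀ β (C + {.glue t u} + {.glue u s}) := by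
  obtain ⟨u, hu⟩ := h.valid.fresh
  have hc := hu t
  simp only [oc_add, oc_singleton, Vtx.oc_glue, delta_self] at hc
  refine ⟨u, h.elim hms (u := u) (a := s) ?_ hu ?_ (Or.inr ⟨rfl, rfl⟩) fun w => ?_⟩
  · rw [Vtx.map_glue, Function.update_self, Function.update_of_ne]
    · rfl
    · exact delta_eq_zero (by omega)
  · apply oc_pos_of_ic h.valid
    simp only [ic_add, ic_singleton, Vtx.ic_glue, delta_self]
    omega
  · have h1 := h.valid w
    have h2 := hu w
    simp only [oc_add, ic_add, oc_singleton, ic_singleton, Vtx.oc_glue, Vtx.ic_glue] at h1 h2 ⊢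
    omega

/-- Here the end that is cut off is the boundary root rather than a port. The bullet so created is
the one by which V'_n differs from V_n. -/
theorem Back.elimRoot (hms : moveGlueElim ∈ ms) {N : Net} (h : Back ms N₀ β₀ β N) :
    ∃ u, Back ms N₀ β₀ (Function.update β 0 u) (N + {.glue u (β 0)}) := by
  obtain ⟨u, hu⟩ := h.valid.fresh
  have hu1 := hu u
  have hu2 := (h.valid u).1
  have hr := hu (β 0)
  have hr2 := (h.valid (β 0)).1
  rw [delta_self] at hu1 hr2
  have hne : u ≠ β 0 := (delta_eq_zero (w := β 0) (u := u) (by omega)).symm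
  have hN : N.map (Vtx.map (Function.update id u (β 0))) = N :=
    map_update_of_fresh (by omega) (by omega)
  have hβ : (fun i => Function.update id u (β 0) (Function.update β 0 u i)) = β := by
    funext i
    induction i using Fin.cases with
    | zero => simp
    | succ i =>
      have h4 : bo β u = 0 := by omega
      rw [bo, Finset.sum_eq_zero_iff] at h4
      have h5 := delta_eq_zero (h4 i (Finset.mem_univ i))
      simp [Fin.succ_ne_zero, h5.symm]
  -- Renaming the root does not affect the counts of the non-root boundary.
  have hbo : ∀ w, bo (Function.update β 0 u) w = bo β w := fun w => by
    simp [bo, Fin.succ_ne_zero]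
  have hval : Valid (N + {.glue u (β 0)}) (Function.update β 0 u) := fun w => by
    have h1 := h.valid w
    have h2 := hu w
    rw [hbo, Function.update_self]
    simp only [oc_add, ic_add, oc_singleton, ic_singleton, Vtx.oc_glue, Vtx.ic_glue]
    omega
  refine ⟨u, hval, Simulates.trans ?_ h.sim⟩
  have hval' : Valid (N.map (Vtx.map (Function.update id u (β 0))))
      fun i => Function.update id u (β 0) (Function.update β 0 u i) := by
    rw [hN, hβ]
    exact h.valid
  have := simulates_elim hms N (s := β 0) (t := u) (σ := Function.update id u (β 0))
    hne.symm (by simp [hne.symm]) (fun x y hxy => update_id_eq hxy) hval hval'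
  rwa [hN, hβ] at this

/-- In this and the following rules a move is read from right to left: its right-hand side is found
in the net and replaced by its left-hand side. Inner edges of the right-hand side disappear with
their names; inner edges of the left-hand side need fresh ones. -/
theorem Back.dup (hms : moveGlueDup ∈ ms) {C : Net} {t a s : ℕ}
    (h : Back ms N₀ β₀ β (C + ({.glue a s} + {.glue t a}))) :
    Back ms N₀ β₀ β (C + {.glue t s}) := by
  refine Back.move hms ![true, false] (by decide) (by decide) (by decide) (by decide)
    (l := 1) (p₀ := ⟨0, .src⟩) (by decide) ⟨0, .src⟩ [s, t] [s, a, t]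
    (coe_one (Vtx.mk_glue _)) (coe_two (Vtx.mk_glue _) (Vtx.mk_glue _)) (fun i => by fin_cases i <;> rfl) h
    fun w => ?_
  have h1 := h.valid w
  simp only [oc_add, ic_add, oc_singleton, ic_singleton, Vtx.oc_glue, Vtx.ic_glue] at h1 ⊢
  omega

theorem Back.appGlue (hms : moveAppGlue ∈ ms) {C : Net} {c a f c' a' f' : ℕ}
    (h : Back ms N₀ β₀ β (C + ({.app c' a' f'} + {.glue f' f} + {.glue a' a} + {.glue c c'}))) :
    Back ms N₀ β₀ β (C + ({.app c a f})) := by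
  refine Back.move hms ![true, true, false] (by decide) (by decide) (by decide) (by decide)
    (l := 3) (p₀ := ⟨0, .cont⟩) (by decide) ⟨0, .cont⟩ [f, a, c] [f, f', a, a', c', c]
    (coe_one (Vtx.mk_app _))
    (coe_four (Vtx.mk_app _) (Vtx.mk_glue _) (Vtx.mk_glue _) (Vtx.mk_glue _))
    (fun i => by fin_cases i <;> rfl) h fun w => ?_
  have h1 := h.valid w
  simp only [oc_add, ic_add, oc_singleton, ic_singleton, Vtx.oc_glue, Vtx.ic_glue, Vtx.oc_app,
    Vtx.ic_app, Vtx.oc_lam, Vtx.ic_lam, Vtx.oc_unit, Vtx.ic_unit] at h1 ⊢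
  omega

theorem Back.beta (hms : moveBeta ∈ ms) {C : Net} {c m x a : ℕ}
    (h : Back ms N₀ β₀ β (C + ({.glue c m} + {.glue x a}))) :
    ∃ q q', Back ms N₀ β₀ β (C + ({.lam q x m} + {.app c a q'} + {.glue q' q})) := by
  obtain ⟨q, q', hu⟩ := h.valid.fresh_two
  refine ⟨q, q', ?_⟩
  refine Back.move hms ![true, false, true, false] (by decide) (by decide) (by decide) (by decide)
    (l := 7) (p₀ := ⟨0, .root⟩) (by decide) ⟨0, .tgt⟩ [m, x, q, q', a, c] [m, c, a, x]
    (coe_three (Vtx.mk_lam _) (Vtx.mk_app _) (Vtx.mk_glue _))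
    (coe_two (Vtx.mk_glue _) (Vtx.mk_glue _))
    (fun i => by fin_cases i <;> rfl) h fun w => ?_
  have h1 := h.valid w
  have h2 := hu w
  simp only [oc_add, ic_add, oc_singleton, ic_singleton, Vtx.oc_glue, Vtx.ic_glue, Vtx.oc_app,
    Vtx.ic_app, Vtx.oc_lam, Vtx.ic_lam, Vtx.oc_unit, Vtx.ic_unit] at h1 h2 ⊢
  omega

theorem Back.eta (hms : moveEta ∈ ms) {C : Net} {t s b c v x : ℕ}
    (h : Back ms N₀ β₀ β (C + ({.app c v s} + {.lam t x b} + {.glue b c} + {.glue v x}))) :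
    Back ms N₀ β₀ β (C + ({.glue t s})) := by
  refine Back.move hms ![true, false] (by decide) (by decide) (by decide) (by decide)
    (l := 1) (p₀ := ⟨0, .tgt⟩) (by decide) ⟨0, .cont⟩ [s, t] [s, c, b, x, v, t]
    (coe_one (Vtx.mk_glue _))
    (coe_four (Vtx.mk_app _) (Vtx.mk_lam _) (Vtx.mk_glue _) (Vtx.mk_glue _))
    (fun i => by fin_cases i <;> rfl) h fun w => ?_
  have h1 := h.valid w
  simp only [oc_add, ic_add, oc_singleton, ic_singleton, Vtx.oc_glue, Vtx.ic_glue, Vtx.oc_app,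
    Vtx.ic_app, Vtx.oc_lam, Vtx.ic_lam, Vtx.oc_unit, Vtx.ic_unit] at h1 ⊢
  omega

theorem Back.comp (hms : moveComp ∈ ms) {C : Net} {r b v u y m : ℕ}
    (h : Back ms N₀ β₀ β (C + ({.lam r u m} + {.lam m y b} + {.app v y u}))) :
    Back ms N₀ β₀ β (C + ({.lam r v b})) := by
  refine Back.move hms ![true, false, false] (by decide) (by decide) (by decide) (by decide)
    (l := 3) (p₀ := ⟨0, .root⟩) (by decide) ⟨0, .root⟩ [b, v, r] [r, m, b, u, y, v]
    (coe_one (Vtx.mk_lam _))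
    (coe_three (Vtx.mk_lam _) (Vtx.mk_lam _) (Vtx.mk_app _))
    (fun i => by fin_cases i <;> rfl) h fun w => ?_
  have h1 := h.valid w
  simp only [oc_add, ic_add, oc_singleton, ic_singleton, Vtx.oc_glue, Vtx.ic_glue, Vtx.oc_app,
    Vtx.ic_app, Vtx.oc_lam, Vtx.ic_lam, Vtx.oc_unit, Vtx.ic_unit] at h1 ⊢
  omega

theorem Back.iota (hms : moveIota ∈ ms) {C : Net} {t s : ℕ}
    (h : Back ms N₀ β₀ β (C + ({.glue t s}))) :
    ∃ i, Back ms N₀ β₀ β (C + ({.app t s i} + {.unit i})) := by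
  obtain ⟨i, hu⟩ := h.valid.fresh
  refine ⟨i, ?_⟩
  refine Back.move hms ![true, false] (by decide) (by decide) (by decide) (by decide)
    (l := 4) (p₀ := ⟨0, .cont⟩) (by decide) ⟨0, .tgt⟩ [i, s, t] [s, t]
    (coe_two (Vtx.mk_app _) (Vtx.mk_unit _))
    (coe_one (Vtx.mk_glue _))
    (fun i => by fin_cases i <;> rfl) h fun w => ?_
  have h1 := h.valid w
  have h2 := hu w
  simp only [oc_add, ic_add, oc_singleton, ic_singleton, Vtx.oc_glue, Vtx.ic_glue, Vtx.oc_app,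
    Vtx.ic_app, Vtx.oc_lam, Vtx.ic_lam, Vtx.oc_unit, Vtx.ic_unit] at h1 h2 ⊢
  omega

theorem Back.iotaInv (hms : moveIotaInv ∈ ms) {C : Net} {t s i : ℕ}
    (h : Back ms N₀ β₀ β (C + ({.app t s i} + {.unit i}))) :
    Back ms N₀ β₀ β (C + ({.glue t s})) := by
  refine Back.move hms ![true, false] (by decide) (by decide) (by decide) (by decide)
    (l := 1) (p₀ := ⟨0, .tgt⟩) (by decide) ⟨0, .cont⟩ [s, t] [i, s, t]
    (coe_one (Vtx.mk_glue _))
    (coe_two (Vtx.mk_app _) (Vtx.mk_unit _))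
    (fun i => by fin_cases i <;> rfl) h fun w => ?_
  have h1 := h.valid w
  simp only [oc_add, ic_add, oc_singleton, ic_singleton, Vtx.oc_glue, Vtx.ic_glue, Vtx.oc_app,
    Vtx.ic_app, Vtx.oc_lam, Vtx.ic_lam, Vtx.oc_unit, Vtx.ic_unit] at h1 ⊢
  omega

theorem Back.unit (hms : moveUnit ∈ ms) {C : Net} {t s i : ℕ}
    (h : Back ms N₀ β₀ β (C + ({.app t i s} + {.unit i}))) :
    Back ms N₀ β₀ β (C + ({.glue t s})) := by
  refine Back.move hms ![true, false] (by decide) (by decide) (by decide) (by decide)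
    (l := 1) (p₀ := ⟨0, .tgt⟩) (by decide) ⟨0, .cont⟩ [s, t] [s, i, t]
    (coe_one (Vtx.mk_glue _))
    (coe_two (Vtx.mk_app _) (Vtx.mk_unit _))
    (fun i => by fin_cases i <;> rfl) h fun w => ?_
  have h1 := h.valid w
  simp only [oc_add, ic_add, oc_singleton, ic_singleton, Vtx.oc_glue, Vtx.ic_glue, Vtx.oc_app,
    Vtx.ic_app, Vtx.oc_lam, Vtx.ic_lam, Vtx.oc_unit, Vtx.ic_unit] at h1 ⊢
  omega

theorem Back.chi (hms : moveChi ∈ ms) {C : Net} {r p a b f : ℕ}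
    (h : Back ms N₀ β₀ β (C + ({.app p b f} + {.app r a p}))) :
    ∃ q, Back ms N₀ β₀ β (C + ({.app q a f} + {.app r b q})) := by
  obtain ⟨q, hu⟩ := h.valid.fresh
  refine ⟨q, ?_⟩
  refine Back.move hms ![true, true, true, false] (by decide) (by decide) (by decide) (by decide)
    (l := 5) (p₀ := ⟨0, .cont⟩) (by decide) ⟨0, .cont⟩ [f, q, r, a, b] [f, p, r, b, a]
    (coe_two (Vtx.mk_app _) (Vtx.mk_app _))
    (coe_two (Vtx.mk_app _) (Vtx.mk_app _))
    (fun i => by fin_cases i <;> rfl) h fun w => ?_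
  have h1 := h.valid w
  have h2 := hu w
  simp only [oc_add, ic_add, oc_singleton, ic_singleton, Vtx.oc_glue, Vtx.ic_glue, Vtx.oc_app,
    Vtx.ic_app, Vtx.oc_lam, Vtx.ic_lam, Vtx.oc_unit, Vtx.ic_unit] at h1 h2 ⊢
  omega

theorem Back.const (hms : moveC ∈ ms) {C : Net} {i x y z m₁ m₂ m₃ k : ℕ}
    (h : Back ms N₀ β₀ β (C + ({.lam i x m₁} + {.lam m₁ y m₂} + {.lam m₂ z m₃} + {.app m₃ y k} + {.app k z x}))) :
    Back ms N₀ β₀ β (C + ({.unit i})) := by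
  refine Back.move hms ![false] (by decide) (by decide) (by decide) (by decide)
    (l := 1) (p₀ := ⟨0, .out⟩) (by decide) ⟨0, .root⟩ [i] [i, m₁, m₂, m₃, k, x, z, y]
    (coe_one (Vtx.mk_unit _))
    (coe_five (Vtx.mk_lam _) (Vtx.mk_lam _) (Vtx.mk_lam _) (Vtx.mk_app _) (Vtx.mk_app _))
    (fun i => by fin_cases i <;> rfl) h fun w => ?_
  have h1 := h.valid w
  simp only [oc_add, ic_add, oc_singleton, ic_singleton, Vtx.oc_glue, Vtx.ic_glue, Vtx.oc_app,
    Vtx.ic_app, Vtx.oc_lam, Vtx.ic_lam, Vtx.oc_unit, Vtx.ic_unit] at h1 ⊢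
  omega

theorem Back.gamma (hms : moveGamma ∈ ms) {C : Net} {r a f : ℕ}
    (h : Back ms N₀ β₀ β (C + ({.app r f a}))) :
    Back ms N₀ β₀ β (C + ({.app r a f})) := by
  refine Back.move hms ![true, true, false] (by decide) (by decide) (by decide) (by decide)
    (l := 3) (p₀ := ⟨0, .cont⟩) (by decide) ⟨0, .cont⟩ [f, a, r] [a, f, r]
    (coe_one (Vtx.mk_app _))
    (coe_one (Vtx.mk_app _))
    (fun i => by fin_cases i <;> rfl) h fun w => ?_
  have h1 := h.valid w
  simp only [oc_add, ic_add, oc_singleton, ic_singleton, Vtx.oc_glue, Vtx.ic_glue, Vtx.oc_app,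
    Vtx.ic_app, Vtx.oc_lam, Vtx.ic_lam, Vtx.oc_unit, Vtx.ic_unit] at h1 ⊢
  omega

end Rules

end ImploidMoves


namespace ImploidMoves

/-! ### Derived rules -/

section Derived

variable {n : ℕ} {ms : Set Move} {N₀ : Net} {β₀ β : Fin (n + 1) → ℕ}

/-- Forwards: all three edges at the negative vertex are subdivided, and the bullets at the argument
and at the output are eliminated. Thus a bullet can be created at the function input alone. -/
theorem Back.bulletFn (hp : imploidMoves ⊆ ms) {C : Net} {r x R q : ℕ}
    (h : Back ms N₀ β₀ β (C + ({.app r x R} + {.glue R q}))) :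
    Back ms N₀ β₀ β (C + {.app r x q}) := by
  obtain ⟨u, h⟩ := (h.congr (N' := C + {.glue R q} + {.app r x R}) (by abel)).elimArg
    (hp (by simp [imploidMoves]))
  obtain ⟨v, h⟩ := (h.congr (N' := C + {.glue R q} + {.glue u x} + {.app r u R})
    (by abel)).elimCont (hp (by simp [imploidMoves]))
  exact (h.congr (N' := C + ({.app v u R} + {.glue R q} + {.glue u x} + {.glue r v}))
    (by abel)).appGlue (hp (by simp [imploidMoves]))

/-- The bullet that β requires in front of the function input is produced by `Back.bulletFn`, so β
applies to redexes without a bullet. -/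
theorem Back.betaPlain (hp : imploidMoves ⊆ ms) {C : Net} {c m x a : ℕ}
    (h : Back ms N₀ β₀ β (C + ({.glue c m} + {.glue x a}))) :
    ∃ q, Back ms N₀ β₀ β (C + ({.lam q x m} + {.app c a q})) := by
  obtain ⟨q, q', h⟩ := h.beta (hp (by simp [imploidMoves]))
  refine ⟨q, ?_⟩
  exact ((h.congr (N' := C + {.lam q x m} + ({.app c a q'} + {.glue q' q})) (by abel)).bulletFn
    hp).congr (by abel)

/-- Forwards this is (A(B))(x) ⇒ ((λv.A(v))(B))(x) ⇒ ((λu.λy.A(u(y)))(B))(x) ⇒ A(B(x)), by η,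
composition and two applications of β. The bullets consumed and produced by these moves are supplied
by backward eliminations. -/
theorem Back.assoc (hp : imploidMoves ⊆ ms) {C : Net} {r v A x B : ℕ}
    (h : Back ms N₀ β₀ β (C + ({.app r v A} + {.app v x B}))) :
    ∃ p, Back ms N₀ β₀ β (C + ({.app r x p} + {.app p B A})) := by
  have he : moveGlueElim ∈ ms := hp (by simp [imploidMoves])
  obtain ⟨b, h⟩ := (h.congr (N' := C + {.app v x B} + {.app r v A}) (by abel)).elimCont he
  obtain ⟨y, h⟩ := (h.congr (N' := C + {.app b v A} + {.glue r b} + {.app v x B})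
    (by abel)).elimArg he
  obtain ⟨u, h⟩ := (h.congr (N' := C + {.app b v A} + {.glue r b} + {.glue y x} + {.app v y B})
    (by abel)).elimFn he
  -- Expansion to (λy.A(u(y)))(x), where u stands for B behind a bullet; the next expansion
  -- abstracts u as well.
  obtain ⟨q, h⟩ := (h.congr (N' := C + {.app b v A} + {.app v y u} + {.glue u B} +
    ({.glue r b} + {.glue y x})) (by abel)).betaPlain hp
  obtain ⟨p, h⟩ := (h.congr (N' := C + {.app b v A} + {.app v y u} + {.glue u B} +
    {.lam q y b} + {.app r x q}) (by abel)).elimFn he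
  obtain ⟨k, h⟩ := (h.congr (N' := C + {.app b v A} + {.app v y u} + {.lam q y b} + {.app r x p} +
    ({.glue p q} + {.glue u B})) (by abel)).betaPlain hp
  have h := (h.congr (N' := C + {.app b v A} + {.app r x p} + {.app p B k} +
    ({.lam k u q} + {.lam q y b} + {.app v y u})) (by abel)).comp (hp (by simp [imploidMoves]))
  obtain ⟨b', h⟩ := h.elimBody he
  obtain ⟨v', h⟩ := (h.congr (N' := C + {.app r x p} + {.app p B k} + {.lam k v b'} +
    {.glue b' b} + {.app b v A}) (by abel)).elimArg he
  -- The abstraction λv.A(v), with its two bullets now in place, contracts to A behind one bullet.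
  have h := (h.congr (N' := C + {.app r x p} + {.app p B k} +
    ({.app b v' A} + {.lam k v b'} + {.glue b' b} + {.glue v' v})) (by abel)).eta
    (hp (by simp [imploidMoves]))
  exact ⟨p, ((h.congr (N' := C + {.app r x p} + ({.app p B k} + {.glue k A})) (by abel)).bulletFn
    hp).congr (by abel)⟩

/-- The vertices of a spine with root edge `r` and non-root boundary edges `Γ`. -/
inductive Sp : Net → ℕ → List ℕ → Prop
  | unit (r : ℕ) : Sp {.unit r} r []
  | app {L : Net} {f : ℕ} {Γ : List ℕ} (r x : ℕ) : Sp L f Γ → Sp (L + {.app r x f}) r (Γ ++ [x])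

theorem Sp.append_singleton {L : Net} {r : ℕ} {Γ : List ℕ} {x : ℕ} (h : Sp L r (Γ ++ [x])) :
    ∃ L' f, Sp L' f Γ ∧ L = L' + {.app r x f} := by
  generalize hΔ : Γ ++ [x] = Δ at h
  cases h with
  | unit => simp at hΔ
  | app r y h =>
    obtain ⟨rfl, h2⟩ := List.append_inj' hΔ rfl
    obtain rfl : x = y := by simpa using h2
    exact ⟨_, _, h, rfl⟩

/-- An application of a spine to a spine comes from one spine. The induction is on the argument: for
`I` the unit move T ⇒ T(I) suffices, and an outermost argument x is moved out by associativity,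
T(W(x)) coming from (T(W))(x). -/
theorem Back.split (hp : imploidMoves ⊆ ms) {L₂ : Net} {a : ℕ} {Δ : List ℕ} (h₂ : Sp L₂ a Δ)
    {C L₁ : Net} {r f : ℕ} {Γ : List ℕ} (h₁ : Sp L₁ f Γ)
    (h : Back ms N₀ β₀ β (C + ({.app r a f} + L₁ + L₂))) :
    ∃ q L, Sp L q (Γ ++ Δ) ∧ Back ms N₀ β₀ β (C + ({.glue r q} + L)) := by
  induction h₂ generalizing C r with
  | unit a =>
    refine ⟨f, L₁, by simpa using h₁, ?_⟩
    exact ((h.congr (N' := C + L₁ + ({.app r a f} + {.unit a})) (by abel)).unit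
      (hp (by simp [imploidMoves]))).congr (by abel)
  | @app L g Δ a x h₂ ih =>
    obtain ⟨p, h⟩ := (h.congr (N' := C + L₁ + L + ({.app r a f} + {.app a x g}))
      (by abel)).assoc hp
    obtain ⟨q, L', hL', h⟩ := ih (h.congr (N' := C + {.app r x p} + ({.app p g f} + L₁ + L))
      (by abel))
    -- The bullet left by the induction hypothesis sits below the new last application. It is
    -- absorbed there, and a new one is inserted at the output.
    have h := (h.congr (N' := C + L' + ({.app r x p} + {.glue p q})) (by abel)).bulletFn hp
    obtain ⟨u, h⟩ := h.elimCont (hp (by simp [imploidMoves]))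
    refine ⟨u, L' + {.app u x q}, ?_, h.congr (by abel)⟩
    rw [← List.append_assoc]
    exact hL'.app u x

/-- The vertices of a term with root edge `r` and non-root boundary edges `Γ`; the order of `Γ` is
respected if `E` is false. -/
inductive Tm (E : Prop) : Net → ℕ → List ℕ → Prop
  | var (w : ℕ) : Tm E 0 w [w]
  | unit (r : ℕ) : Tm E {.unit r} r []
  | glue {L : Net} {s : ℕ} {Γ : List ℕ} (r : ℕ) : Tm E L s Γ → Tm E ({.glue r s} + L) r Γ
  | lam {L : Net} {b x : ℕ} {Γ : List ℕ} (r : ℕ) : Tm E L b (Γ ++ [x]) →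
      Tm E ({.lam r x b} + L) r Γ
  | app {L₁ L₂ : Net} {f a : ℕ} {Γ Δ : List ℕ} (r : ℕ) : Tm E L₁ f Γ → Tm E L₂ a Δ →
      Tm E ({.app r a f} + L₁ + L₂) r (Γ ++ Δ)
  | exch {L : Net} {r : ℕ} {Γ Δ : List ℕ} : E → Γ.Perm Δ → Tm E L r Γ → Tm E L r Δ

/-- The arguments of two consecutive negative vertices can be exchanged. -/
def CanSwap (n : ℕ) (ms : Set Move) : Prop :=
  ∀ {N₀ : Net} {β₀ β : Fin (n + 1) → ℕ} {C : Net} {r a p b T : ℕ},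
    Back ms N₀ β₀ β (C + ({.app r a p} + {.app p b T})) →
    ∃ q, Back ms N₀ β₀ β (C + ({.app r b q} + {.app q a T}))

theorem canSwap_chi (h : moveChi ∈ ms) : CanSwap n ms := by
  intro N₀ β₀ β C r a p b T hB
  obtain ⟨q, hq⟩ := (hB.congr (N' := C + ({.app p b T} + {.app r a p})) (by abel)).chi h
  exact ⟨q, hq.congr (by abel)⟩

/-- Forwards: (T(a))(b) ⇒ (a(T))(b) ⇒ a(T(b)) ⇒ (T(b))(a), by γ, associativity and γ. -/
theorem canSwap_gamma (hp : imploidMoves ⊆ ms) (hm : moveGamma ∈ ms) : CanSwap n ms := by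
  intro N₀ β₀ β C r a p b T h
  have h := (h.congr (N' := C + {.app p b T} + {.app r a p}) (by abel)).gamma hm
  obtain ⟨q, h⟩ := (h.congr (N' := C + ({.app r p a} + {.app p b T})) (by abel)).assoc hp
  have h := (h.congr (N' := C + {.app r b q} + {.app q T a}) (by abel)).gamma hm
  exact ⟨q, h.congr (by abel)⟩

/-- Forwards: (T(a))(b) ⇒ ((I(T))(a))(b) by ι, then C replaces I by λx.λy.λz.(x(z))(y), and three
applications of β yield (T(b))(a). -/
theorem canSwap_const (hp : imploidMoves ⊆ ms) (hm : moveC ∈ ms) : CanSwap n ms := by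
  intro N₀ β₀ β C r a k b T h
  have he : moveGlueElim ∈ ms := hp (by simp [imploidMoves])
  obtain ⟨m₃, h⟩ := (h.congr (N' := C + {.app k b T} + {.app r a k}) (by abel)).elimCont he
  obtain ⟨y, h⟩ := (h.congr (N' := C + {.app k b T} + {.glue r m₃} + {.app m₃ a k})
    (by abel)).elimArg he
  obtain ⟨z, h⟩ := (h.congr (N' := C + {.glue r m₃} + {.app m₃ y k} + {.glue y a} +
    {.app k b T}) (by abel)).elimArg he
  obtain ⟨x, h⟩ := (h.congr (N' := C + {.glue r m₃} + {.app m₃ y k} + {.glue y a} + {.glue z b} +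
    {.app k z T}) (by abel)).elimFn he
  obtain ⟨q₂, h⟩ := (h.congr (N' := C + {.app m₃ y k} + {.glue y a} + {.app k z x} + {.glue x T} +
    ({.glue r m₃} + {.glue z b})) (by abel)).betaPlain hp
  obtain ⟨p, h⟩ := (h.congr (N' := C + {.app m₃ y k} + {.glue y a} + {.app k z x} + {.glue x T} +
    {.lam q₂ z m₃} + {.app r b q₂}) (by abel)).elimFn he
  obtain ⟨q₁, h⟩ := (h.congr (N' := C + {.app m₃ y k} + {.app k z x} + {.glue x T} +
    {.lam q₂ z m₃} + {.app r b p} + ({.glue p q₂} + {.glue y a})) (by abel)).betaPlain hp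
  obtain ⟨t, h⟩ := (h.congr (N' := C + {.app m₃ y k} + {.app k z x} + {.glue x T} +
    {.lam q₂ z m₃} + {.app r b p} + {.lam q₁ y q₂} + {.app p a q₁}) (by abel)).elimFn he
  obtain ⟨i, h⟩ := (h.congr (N' := C + {.app m₃ y k} + {.app k z x} + {.lam q₂ z m₃} +
    {.app r b p} + {.lam q₁ y q₂} + {.app p a t} + ({.glue t q₁} + {.glue x T}))
    (by abel)).betaPlain hp
  have h := (h.congr (N' := C + {.app r b p} + {.app p a t} + {.app t T i} +
    ({.lam i x q₁} + {.lam q₁ y q₂} + {.lam q₂ z m₃} + {.app m₃ y k} + {.app k z x}))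
    (by abel)).const hm
  have h := (h.congr (N' := C + {.app r b p} + {.app p a t} + ({.app t T i} + {.unit i}))
    (by abel)).iotaInv (hp (by simp [imploidMoves]))
  have h := (h.congr (N' := C + {.app r b p} + ({.app p a t} + {.glue t T})) (by abel)).bulletFn hp
  exact ⟨p, h.congr (by abel)⟩

/-- At the end of the spine this is `CanSwap` itself; later arguments are stripped off by induction.
-/
theorem Back.spine_swap (hs : CanSwap n ms) {a b : ℕ} {Γ Δ : List ℕ} {C L : Net} {r : ℕ}
    (hL : Sp L r (Γ ++ a :: b :: Δ)) (h : Back ms N₀ β₀ β (C + L)) :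
    ∃ L', Sp L' r (Γ ++ b :: a :: Δ) ∧ Back ms N₀ β₀ β (C + L') := by
  induction Δ using List.reverseRecOn generalizing C L r with
  | nil =>
    rw [show Γ ++ [a, b] = (Γ ++ [a]) ++ [b] by simp] at hL
    obtain ⟨L, f, hL₁, rfl⟩ := hL.append_singleton
    obtain ⟨L, g, hL₂, rfl⟩ := hL₁.append_singleton
    obtain ⟨q, h⟩ := hs (h.congr (N' := C + L + ({.app r b f} + {.app f a g})) (by abel))
    refine ⟨L + {.app q b g} + {.app r a q}, ?_, h.congr (by abel)⟩
    rw [show Γ ++ [b, a] = (Γ ++ [b]) ++ [a] by simp]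
    exact (hL₂.app q b).app r a
  | append_singleton Δ x ih =>
    rw [show Γ ++ a :: b :: (Δ ++ [x]) = (Γ ++ a :: b :: Δ) ++ [x] by simp] at hL
    obtain ⟨L, f, hL₁, rfl⟩ := hL.append_singleton
    obtain ⟨L', hL', h⟩ := ih hL₁ (h.congr (N' := C + {.app r x f} + L) (by abel))
    refine ⟨L' + {.app r x f}, ?_, h.congr (by abel)⟩
    rw [show Γ ++ b :: a :: (Δ ++ [x]) = (Γ ++ b :: a :: Δ) ++ [x] by simp]
    exact hL'.app r x

/-- Permutations are generated by adjacent exchanges. The prefix `Ψ` collects the entries already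
passed, which are the innermost arguments of the spine. -/
theorem Back.spine_perm (hs : CanSwap n ms) {Γ Δ : List ℕ} (hΓ : Γ.Perm Δ) (Ψ : List ℕ)
    {C L : Net} {r : ℕ} (hL : Sp L r (Ψ ++ Γ)) (h : Back ms N₀ β₀ β (C + L)) :
    ∃ L', Sp L' r (Ψ ++ Δ) ∧ Back ms N₀ β₀ β (C + L') := by
  induction hΓ generalizing L Ψ with
  | nil => exact ⟨L, hL, h⟩
  | cons x _ ih =>
    rw [← List.singleton_append, ← List.append_assoc] at hL ⊢
    exact ih _ hL h
  | swap x y l => exact h.spine_swap hs hL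
  | trans _ _ ih1 ih2 =>
    obtain ⟨L', hL', h⟩ := ih1 Ψ hL h
    exact ih2 Ψ hL' h

/-- Every term below a 2-valent vertex arises from a spine below a 2-valent vertex. -/
theorem Back.spine_of_term (hp : imploidMoves ⊆ ms) {E : Prop} (hE : E → CanSwap n ms) {L : Net}
    {s : ℕ} {Γ : List ℕ} (hL : Tm E L s Γ) {C : Net} {r : ℕ}
    (h : Back ms N₀ β₀ β (C + ({.glue r s} + L))) :
    ∃ q L', Sp L' q Γ ∧ Back ms N₀ β₀ β (C + ({.glue r q} + L')) := by
  have he : moveGlueElim ∈ ms := hp (by simp [imploidMoves])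
  have hd : moveGlueDup ∈ ms := hp (by simp [imploidMoves])
  induction hL generalizing C r with
  -- A bullet over a variable comes from a bullet over I(x): one bullet is split in two, and the
  -- lower one is the result of ι.
  | var w =>
    obtain ⟨u, h⟩ := (h.congr (N' := C + {.glue r w}) (by abel)).elimGlue he
    obtain ⟨i, h⟩ := h.iota (hp (by simp [imploidMoves]))
    exact ⟨u, {.unit i} + {.app u w i}, (Sp.unit i).app u w, h.congr (by abel)⟩
  | unit s => exact ⟨s, _, .unit s, h⟩
  | @glue L s' Γ s _ ih =>
    obtain ⟨q, L', hL', h⟩ := ih (h.congr (N' := C + {.glue r s} + ({.glue s s'} + L)) (by abel))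
    refine ⟨q, L', hL', ?_⟩
    exact ((h.congr (N' := C + L' + ({.glue s q} + {.glue r s})) (by abel)).dup hd).congr (by abel)
  -- A bullet is inserted at the body so that the induction hypothesis applies. The bound variable
  -- is the last boundary arc, hence the outermost argument of the resulting spine, and λx.V(x) is
  -- an η-expansion of V; the two bullets that remain are merged.
  | @lam L b x Γ s _ ih =>
    obtain ⟨b', h⟩ := (h.congr (N' := C + {.glue r s} + L + {.lam s x b}) (by abel)).elimBody he
    obtain ⟨q, L', hL', h⟩ := ih (h.congr (N' := C + {.glue r s} + {.lam s x b'} +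
      ({.glue b' b} + L)) (by abel))
    obtain ⟨L', f, hL₁, rfl⟩ := hL'.append_singleton
    obtain ⟨v, h⟩ := (h.congr (N' := C + {.glue r s} + {.lam s x b'} + {.glue b' q} + L' +
      {.app q x f}) (by abel)).elimArg he
    have h := (h.congr (N' := C + {.glue r s} + L' +
      ({.app q v f} + {.lam s x b'} + {.glue b' q} + {.glue v x})) (by abel)).eta
      (hp (by simp [imploidMoves]))
    exact ⟨f, L', hL₁, ((h.congr (N' := C + L' + ({.glue s f} + {.glue r s}))
      (by abel)).dup hd).congr (by abel)⟩
  -- Bullets at the function and the argument feed the two induction hypotheses. Together with the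
  -- given bullet at the output they surround the negative vertex and are absorbed at once, leaving
  -- an application of two spines; `Back.split` returns a bullet at the root.
  | @app L₁ L₂ f a Γ Δ s _ _ ih1 ih2 =>
    obtain ⟨f', h⟩ := (h.congr (N' := C + {.glue r s} + L₁ + L₂ + {.app s a f})
      (by abel)).elimFn he
    obtain ⟨a', h⟩ := (h.congr (N' := C + {.glue r s} + L₁ + L₂ + {.glue f' f} + {.app s a f'})
      (by abel)).elimArg he
    obtain ⟨q₁, L₁', hL₁, h⟩ := ih1 (h.congr (N' := C + {.glue r s} + L₂ + {.app s a' f'} +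
      {.glue a' a} + ({.glue f' f} + L₁)) (by abel))
    obtain ⟨q₂, L₂', hL₂, h⟩ := ih2 (h.congr (N' := C + {.glue r s} + {.app s a' f'} +
      {.glue f' q₁} + L₁' + ({.glue a' a} + L₂)) (by abel))
    have h := (h.congr (N' := C + L₁' + L₂' +
      ({.app s a' f'} + {.glue f' q₁} + {.glue a' q₂} + {.glue r s})) (by abel)).appGlue
      (hp (by simp [imploidMoves]))
    exact (h.congr (N' := C + ({.app r q₂ q₁} + L₁' + L₂')) (by abel)).split hp hL₂ hL₁
  | exch e hΓ _ ih =>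
    obtain ⟨q, L', hL', h⟩ := ih h
    obtain ⟨L'', hL'', h⟩ := (h.congr (add_assoc _ _ _).symm).spine_perm (hE e) hΓ [] hL'
    exact ⟨q, L'', hL'', h.congr (add_assoc _ _ _)⟩

end Derived

end ImploidMoves


namespace ImploidMoves

/-! ### Spines are realizations -/

section SpineReal

variable {n : ℕ}

theorem univ_map_sumElim {ι ι' : Type} [Fintype ι] [Fintype ι'] (v : ι → Vtx) (v' : ι' → Vtx) :
    Finset.univ.val.map (Sum.elim v v') = Finset.univ.val.map v + Finset.univ.val.map v' := by
  rw [← Finset.univ_disjSum_univ, Finset.val_disjSum, Multiset.disjSum, Multiset.map_add,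
    Multiset.map_map, Multiset.map_map]
  rfl

theorem univ_map_unique (v : Vtx) : (Finset.univ : Finset Unit).val.map (fun _ => v) = {v} := rfl

/-- The darts of a negative vertex. -/
def appEquiv (r x f : ℕ) : (famPre fun _ : Unit => Vtx.app r x f).D ≃ Fin 3 where
  toFun
    | ⟨_, .cont⟩ => 0
    | ⟨_, .arg⟩ => 1
    | ⟨_, .fn⟩ => 2
  invFun
    | 0 => ⟨(), .cont⟩
    | 1 => ⟨(), .arg⟩
    | 2 => ⟨(), .fn⟩
  left_inv := by rintro ⟨_, p⟩; cases p <;> rfl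
  right_inv i := by fin_cases i <;> rfl

/-- The darts of a 2-valent vertex. -/
def glueEquiv (t s : ℕ) : (famPre fun _ : Unit => Vtx.glue t s).D ≃ Fin 2 where
  toFun
    | ⟨_, .tgt⟩ => 0
    | ⟨_, .src⟩ => 1
  invFun
    | 0 => ⟨(), .tgt⟩
    | 1 => ⟨(), .src⟩
  left_inv := by rintro ⟨_, p⟩; cases p <;> rfl
  right_inv i := by fin_cases i <;> rfl

theorem Realizes.of_sum {ι ι' : Type} [Fintype ι] [Fintype ι'] {v : ι → Vtx} {v' : ι' → Vtx}
    {M : OrientedMap (Fin (n + 1))} {β : Fin (n + 1) → ℕ}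
    (R : Realization M ((famPre v).sum (famPre v')) β nonroot) :
    Realizes M (Finset.univ.val.map v + Finset.univ.val.map v') β := by
  rw [← univ_map_sumElim]
  refine Realization.realizes (R.congr (q := famPre (Sum.elim v v'))
    (Equiv.sumSigmaDistrib fun i => Port (Sum.elim v v' i).kind) ?_ ?_ ?_)
  all_goals rintro ⟨i | i, p⟩ <;> rfl

/-- The edge names of the darts of a realization. -/
def Realization.name {B : Type} {M : OrientedMap B} {p : Pre} {β : B → ℕ} {pol : B → Prop}
    (R : Realization M p β pol) : M.D ⊕ B → ℕ :=
  Sum.elim (fun d => p.lab (R.φ.symm d)) β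

theorem Realization.name_map {B : Type} {M : OrientedMap B} {p : Pre} {β : B → ℕ} {pol : B → Prop}
    (R : Realization M p β pol) (x) : R.name (Sum.map R.φ id x) = p.labB β x := by
  rcases x with d | b <;> simp [Realization.name]

theorem Realization.name_e {B : Type} {M : OrientedMap B} {p : Pre} {β : B → ℕ} {pol : B → Prop}
    (R : Realization M p β pol) (x) : R.name (M.e x) = R.name x := by
  obtain ⟨y, rfl⟩ := sum_map_surj R.φ x
  obtain ⟨z, hz⟩ := sum_map_surj R.φ (M.e (Sum.map R.φ id y))
  rw [← hz, R.name_map, R.name_map]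
  exact R.lab y z hz.symm

theorem realizes_app (T : OrientedMap (Fin (n + 1))) {L : Net} {β : Fin (n + 2) → ℕ} {f : ℕ}
    (h : Realizes T L (Fin.cons f fun i => β i.succ.castSucc)) :
    Realizes ({ appOpen T.toOpenMap with orient := appOrient T.toOpenMap T.orient } :
      OrientedMap (Fin (n + 2))) (L + {.app (β 0) (β (Fin.last (n + 1))) f}) β := by
  obtain ⟨m, v, rfl, ⟨R⟩⟩ := h
  rw [← univ_map_unique]
  -- The darts 0, 1, 2 of the new vertex are output, argument and function. The third takes the name
  -- `f` of the former root edge of `T`.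
  let N : (T.D ⊕ Fin 3) ⊕ Fin (n + 2) → ℕ := Sum.elim
    (Sum.elim (fun d => (famPre v).lab (R.φ.symm d)) ![β 0, β (Fin.last (n + 1)), f]) β
  have hN : ∀ x, N (appLift x) = R.name x := by
    rintro (d | i)
    · rfl
    · by_cases hi : i = 0
      · subst hi
        rfl
      · obtain ⟨i, rfl⟩ := Fin.exists_succ_eq.2 hi
        simp [appLift, N, Realization.name]
  have hNe : ∀ x, N (appE T.e x) = N x := by
    intro x
    rcases appLift_cases x with ⟨y, rfl⟩ | rfl | rfl | rfl | rfl
    · rw [appE_lift, hN, hN, R.name_e]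
    · rfl
    · rfl
    · rw [appE_zero]
      rfl
    · rw [appE_last]
      rfl
  let F := Equiv.sumCongr R.φ (appEquiv (β 0) (β (Fin.last (n + 1))) f)
  have hF : ∀ x, N (Sum.map F id x) = ((famPre v).sum (famPre fun _ : Unit =>
      Vtx.app (β 0) (β (Fin.last (n + 1))) f)).labB β x := by
    rintro ((d | ⟨_, p⟩) | i)
    · exact R.name_map (Sum.inl d)
    · cases p <;> rfl
    · rfl
  refine Realizes.of_sum ⟨F, ?_, ?_, ?_⟩
  · rintro (d | ⟨_, p⟩)
    · exact congrArg Sum.inl (R.rot d)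
    · cases p <;> rfl
  · rintro ((d | ⟨_, p⟩) | i)
    · exact (appPos_lift T.pos (Sum.inl (R.φ d))).trans (R.pos (Sum.inl d))
    · cases p with
      | cont => exact iff_of_true (appPos_cont _) rfl
      | arg => exact iff_of_false (appPos_arg _) (by simp [Port.isOut])
      | fn =>
        refine (appPos_lift T.pos (Sum.inr 0)).trans ((R.pos (Sum.inr 0)).trans ?_)
        simp [Port.isOut]
    · by_cases h0 : i = 0
      · subst h0
        exact iff_of_false (appPos_zero _) (by simp)
      · by_cases hl : i = Fin.last (n + 1)
        · subst hl
          exact iff_of_true (appPos_last _) h0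
        · have hi : i.castPred hl ≠ 0 := by
            intro h; apply h0; rw [← Fin.castSucc_castPred i hl, h]; rfl
          have h1 := (appPos_lift T.pos (Sum.inr (i.castPred hl))).trans
            (R.pos (Sum.inr (i.castPred hl)))
          simp only [appLift, hi, if_false, Fin.castSucc_castPred] at h1
          exact h1.trans (iff_of_true hi h0)
  · intro x y hxy
    exact (hF y).symm.trans ((congrArg N hxy).symm.trans ((hNe _).trans (hF x)))

theorem unitNet_pos_out : Sum.inl ⟨0, .out⟩ ∈ unitNet.pos := by
  exact (net_pos _).2 (List.mem_singleton.2 rfl)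

theorem realizes_spine {L : Net} {β : Fin (n + 1) → ℕ}
    (h : Sp L (β 0) (List.ofFn fun i : Fin n => β i.succ)) : Realizes (spine n) L β := by
  induction n generalizing L with
  | zero =>
    generalize hr : β 0 = r at h
    generalize hΓ : (List.ofFn fun i : Fin 0 => β i.succ) = Γ at h
    cases h with
    | app => simp at hΓ
    | unit =>
      subst hr
      have : ({.unit (β 0)} : Net) = Finset.univ.val.map fun _ : Fin 1 => Vtx.unit (β 0) := rfl
      rw [this]
      refine Realization.realizes ⟨⟨fun d => ⟨0, .out⟩, fun d => ⟨0, .out⟩, ?_, ?_⟩, ?_, ?_, ?_⟩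
      · rintro ⟨i, p⟩
        cases p
        fin_cases i
        rfl
      · rintro ⟨i, p⟩
        fin_cases i
        cases p
        rfl
      · rintro ⟨i, p⟩
        rfl
      · rintro (⟨i, p⟩ | i)
        · cases p
          refine iff_of_true ?_ rfl
          fin_cases i
          exact unitNet_pos_out
        · fin_cases i
          refine iff_of_false ?_ (by simp)
          exact spine_root 0
      · have hall : ∀ x : (famPre fun _ : Fin 1 => Vtx.unit (β 0)).D ⊕ Fin 1,
            (famPre fun _ : Fin 1 => Vtx.unit (β 0)).labB β x = β 0 := by
          rintro (⟨i, p⟩ | i)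
          · cases p
            rfl
          · fin_cases i
            rfl
        intro x y _
        rw [hall, hall]
  | succ n ih =>
    -- The last boundary arc is the outermost argument of the spine, so the list is split at its
    -- end.
    rw [List.ofFn_succ', List.concat_eq_append] at h
    obtain ⟨L', f, hL', rfl⟩ := h.append_singleton
    exact realizes_app (spine n) (ih hL')

theorem realizes_glue (T : OrientedMap (Fin (n + 1))) (h0 : Sum.inr 0 ∉ T.pos) {L : Net}
    {β : Fin (n + 1) → ℕ} {q : ℕ} (h : Realizes T L (Function.update β 0 q)) :
    Realizes ({ glueOpen T.toOpenMap with orient := glueOrient T.toOpenMap T.orient h0 } :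
      OrientedMap (Fin (n + 1))) (L + {.glue (β 0) q}) β := by
  obtain ⟨m, v, rfl, ⟨R⟩⟩ := h
  rw [← univ_map_unique]
  let N : (T.D ⊕ Fin 2) ⊕ Fin (n + 1) → ℕ := Sum.elim
    (Sum.elim (fun d => (famPre v).lab (R.φ.symm d)) ![β 0, q]) β
  have hN : ∀ x, N (glueLift x) = R.name x := by
    rintro (d | i)
    · rfl
    · by_cases hi : i = 0
      · subst hi
        simp [glueLift, N, Realization.name]
      · simp [glueLift, N, Realization.name, hi]
  have hNe : ∀ x, N (glueE T.e x) = N x := by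
    intro x
    rcases glueLift_cases x with ⟨y, rfl⟩ | rfl | rfl
    · rw [glueE_lift, hN, hN, R.name_e]
    · rfl
    · rw [glueE_zero]
      rfl
  let F := Equiv.sumCongr R.φ (glueEquiv (β 0) q)
  have hF : ∀ x, N (Sum.map F id x) = ((famPre v).sum (famPre fun _ : Unit =>
      Vtx.glue (β 0) q)).labB β x := by
    rintro ((d | ⟨_, p⟩) | i)
    · exact R.name_map (Sum.inl d)
    · cases p <;> rfl
    · rfl
  refine Realizes.of_sum ⟨F, ?_, ?_, ?_⟩
  · rintro (d | ⟨_, p⟩)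
    · exact congrArg Sum.inl (R.rot d)
    · cases p <;> rfl
  · rintro ((d | ⟨_, p⟩) | i)
    · exact (gluePos_lift T.pos (Sum.inl (R.φ d))).trans (R.pos (Sum.inl d))
    · cases p with
      | tgt => exact iff_of_true (gluePos_tgt _) rfl
      | src => exact iff_of_false (gluePos_src _ h0) (by simp [Port.isOut])
    · by_cases hi : i = 0
      · subst hi
        exact iff_of_false (gluePos_zero _) (by simp)
      · have h1 := (gluePos_lift T.pos (Sum.inr i)).trans (R.pos (Sum.inr i))
        simp only [glueLift, hi, if_false] at h1
        exact h1
  · intro x y hxy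
    exact (hF y).symm.trans ((congrArg N hxy).symm.trans ((hNe _).trans (hF x)))

theorem realizes_spine' {L : Net} {β : Fin (n + 1) → ℕ} {q : ℕ}
    (h : Sp L q (List.ofFn fun i : Fin n => β i.succ)) :
    Realizes (spine' n).toOrientedMap (L + {.glue (β 0) q}) β := by
  refine realizes_glue (spine n) (spine_root n) (realizes_spine ?_)
  simpa using h

/-- A bullet inserted at the root starts `Back.spine_of_term`, which ends in the net of V'_n.
Simulation yields a source map with this net, and valid names determine a map up to isomorphism. -/
theorem generatedBy_of_term {ms : Set Move} (hp : imploidMoves ⊆ ms) {E : Prop}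
    (hE : E → CanSwap n ms) {M : OrientedRootedMap n} {L : Net} {β : Fin (n + 1) → ℕ}
    (hv : Valid L β) (hM : Realizes M.toOrientedMap L β)
    (hL : Tm E L (β 0) (List.ofFn fun i : Fin n => β i.succ)) : GeneratedBy ms M := by
  obtain ⟨u, h⟩ := (Back.refl (ms := ms) hv).elimRoot (hp (by simp [imploidMoves]))
  obtain ⟨q, L', hL', h⟩ := Back.spine_of_term hp hE hL
    (h.congr (N' := 0 + ({.glue u (β 0)} + L)) (by abel))
  obtain ⟨S, hS, hSM⟩ := h.sim M hM
  refine ⟨S, ?_, hSM⟩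
  refine Realizes.isomorphic (realizes_spine' (L := L') (q := q) (β := Function.update β 0 u) ?_)
    (by
      have : L' + {.glue (Function.update β 0 u 0) q} = 0 + ({.glue u q} + L') := by
        rw [Function.update_self]
        abel
      rw [this]
      exact hS) ?_
  · simpa [Fin.succ_ne_zero] using hL'
  · have := h.valid
    rw [Function.update_self]
    rwa [show L' + {.glue u q} = 0 + ({.glue u q} + L') by abel]

end SpineReal

end ImploidMoves


namespace ImploidMoves

/-! ### Terms of topologically oriented maps -/

section Top

variable {B : Type} {M : OpenMap B} {O : Set (M.D ⊕ B)}

/-- The topological orientation of a submap, with a list of its non-root boundary arcs that is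
compatible with the decomposition up to permutations, which are allowed if `E` holds. -/
inductive TopList (M : OpenMap B) (O : Set (M.D ⊕ B)) (E : Prop) :
    Set M.D → M.D ⊕ B → List (M.D ⊕ B) → Prop
  | edge (r : M.D ⊕ B) : M.e r ∈ O → TopList M O E ∅ r [M.e r]
  | unit (r : M.D ⊕ B) (d : M.D) :
      M.e r = Sum.inl d → M.rot d = d → Sum.inl d ∈ O → TopList M O E {d} r []
  | glue (r : M.D ⊕ B) (d : M.D) (S : Set M.D) (Γ : List (M.D ⊕ B)) :
      M.e r = Sum.inl d → M.rot d ≠ d → M.rot (M.rot d) = d →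
      Sum.inl d ∈ O → Sum.inl (M.rot d) ∉ O → Disjoint {d, M.rot d} S →
      TopList M O E S (Sum.inl (M.rot d)) Γ → TopList M O E ({d, M.rot d} ∪ S) r Γ
  | lam (r : M.D ⊕ B) (d : M.D) (S : Set M.D) (Γ : List (M.D ⊕ B)) :
      M.e r = Sum.inl d → M.rot d ≠ d → M.rot (M.rot (M.rot d)) = d →
      Sum.inl d ∈ O → Sum.inl (M.rot d) ∈ O → Sum.inl (M.rot (M.rot d)) ∉ O →
      Disjoint {d, M.rot d, M.rot (M.rot d)} S →
      TopList M O E S (Sum.inl (M.rot (M.rot d))) (Γ ++ [Sum.inl (M.rot d)]) →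
      TopList M O E ({d, M.rot d, M.rot (M.rot d)} ∪ S) r Γ
  | app (r : M.D ⊕ B) (d : M.D) (S₁ S₂ : Set M.D) (Γ₁ Γ₂ : List (M.D ⊕ B)) :
      M.e r = Sum.inl d → M.rot d ≠ d → M.rot (M.rot (M.rot d)) = d →
      Sum.inl d ∈ O → Sum.inl (M.rot d) ∉ O → Sum.inl (M.rot (M.rot d)) ∉ O →
      Disjoint {d, M.rot d, M.rot (M.rot d)} (S₁ ∪ S₂) → Disjoint S₁ S₂ →
      TopList M O E S₁ (Sum.inl (M.rot (M.rot d))) Γ₁ →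
      TopList M O E S₂ (Sum.inl (M.rot d)) Γ₂ →
      TopList M O E ({d, M.rot d, M.rot (M.rot d)} ∪ (S₁ ∪ S₂)) r (Γ₁ ++ Γ₂)
  | exch (S : Set M.D) (r : M.D ⊕ B) (Γ Δ : List (M.D ⊕ B)) :
      E → Γ.Perm Δ → TopList M O E S r Γ → TopList M O E S r Δ

theorem TopologicalAt.pos {S : Set M.D} {r : M.D ⊕ B} {B' : Set (M.D ⊕ B)}
    (h : TopologicalAt M O S r B') : M.e r ∈ O ∧ B' ⊆ O := by
  induction h with
  | edge r h => exact ⟨h, by simpa using h⟩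
  | unit r d h _ h' => exact ⟨h ▸ h', by simp⟩
  | glue r d S B' h _ _ h' _ _ _ ih => exact ⟨h ▸ h', ih.2⟩
  | lam r d S B' h _ _ h' _ _ _ _ _ ih =>
    exact ⟨h ▸ h', (Set.subset_insert _ _).trans ih.2⟩
  | app r d S₁ S₂ B₁ B₂ h _ _ h' _ _ _ _ _ _ _ ih1 ih2 =>
    exact ⟨h ▸ h', Set.union_subset ih1.2 ih2.2⟩

/-- With exchange available, any duplicate-free listing of the boundary will do. -/
theorem TopologicalAt.topList {S : Set M.D} {r : M.D ⊕ B} {B' : Set (M.D ⊕ B)}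
    (h : TopologicalAt M O S r B') (Γ : List (M.D ⊕ B)) (hd : Γ.Nodup) (hΓ : ∀ x, x ∈ Γ ↔ x ∈ B') :
    TopList M O True S r Γ := by
  classical
  induction h generalizing Γ with
  | edge r h =>
    refine .exch _ _ _ _ trivial ?_ (.edge r h)
    rw [List.perm_ext_iff_of_nodup (by simp) hd]
    simpa [eq_comm] using fun x => (hΓ x).symm
  | unit r d h1 h2 h3 =>
    obtain rfl : Γ = [] := List.eq_nil_iff_forall_not_mem.2 (by simpa using hΓ)
    exact .unit r d h1 h2 h3
  | glue r d S B' h1 h2 h3 h4 h5 h6 _ ih => exact .glue r d S Γ h1 h2 h3 h4 h5 h6 (ih Γ hd hΓ)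
  | lam r d S B' h1 h2 h3 h4 h5 h6 h7 h8 _ ih =>
    refine .lam r d S Γ h1 h2 h3 h4 h5 h6 h7 (ih _ ?_ ?_)
    · rw [← List.concat_eq_append, List.nodup_concat]
      exact ⟨fun h => h8 ((hΓ _).1 h), hd⟩
    · intro x
      simp [hΓ, or_comm]
  | app r d S₁ S₂ B₁ B₂ h1 h2 h3 h4 h5 h6 h7 h8 h9 _ _ ih1 ih2 =>
    -- The listing is sorted into the arcs of the function part followed by those of the argument
    -- part, which changes it by a permutation.
    refine .exch _ _ _ _ trivial (List.filter_append_perm (fun x => decide (x ∈ B₁)) Γ)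
      (.app r d S₁ S₂ _ _ h1 h2 h3 h4 h5 h6 h7 h8 (ih1 _ (hd.filter _) ?_)
        (ih2 _ (hd.filter _) ?_))
    · intro x
      simp only [List.mem_filter, hΓ, Set.mem_union, decide_eq_true_eq]
      tauto
    · intro x
      have : x ∈ B₁ → x ∉ B₂ := fun h => Set.disjoint_left.1 h9 h
      simp only [List.mem_filter, hΓ, Set.mem_union, Bool.not_eq_true', decide_eq_false_iff_not]
      tauto

/-- The vertices `N`, with edge names `lab`, are the vertices of `M` made of the darts in `S`. -/
def SubRealizes (M : OpenMap B) (O : Set (M.D ⊕ B)) (lab : M.D ⊕ B → ℕ) (S : Set M.D) (N : Net) :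
    Prop :=
  ∃ (ι : Type) (_ : Fintype ι) (v : ι → Vtx) (ψ : (famPre v).D → M.D),
    Finset.univ.val.map v = N ∧ Function.Injective ψ ∧ Set.range ψ = S ∧
    (∀ d, M.rot (ψ d) = ψ ((famPre v).rot d)) ∧ (∀ d, Sum.inl (ψ d) ∈ O ↔ (famPre v).out d) ∧
    ∀ d, lab (Sum.inl (ψ d)) = (famPre v).lab d

variable {lab : M.D ⊕ B → ℕ}

theorem SubRealizes.empty : SubRealizes M O lab ∅ 0 := by
  refine ⟨Empty, inferInstance, Empty.elim, fun d => d.1.elim, rfl, fun d => d.1.elim, ?_,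
    fun d => d.1.elim, fun d => d.1.elim, fun d => d.1.elim⟩
  ext x
  simp

theorem SubRealizes.add {S S' : Set M.D} {N N' : Net} (h : SubRealizes M O lab S N)
    (h' : SubRealizes M O lab S' N') (hd : Disjoint S S') :
    SubRealizes M O lab (S ∪ S') (N + N') := by
  obtain ⟨ι, _, v, ψ, rfl, h1, rfl, h2, h3, h4⟩ := h
  obtain ⟨ι', _, v', ψ', rfl, h1', rfl, h2', h3', h4'⟩ := h'
  let F : (famPre (Sum.elim v v')).D ≃ (famPre v).D ⊕ (famPre v').D :=
    Equiv.sumSigmaDistrib fun i => Port (Sum.elim v v' i).kind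
  refine ⟨ι ⊕ ι', inferInstance, Sum.elim v v', Sum.elim ψ ψ' ∘ F, univ_map_sumElim _ _,
    Function.Injective.comp (h1.sumElim h1' fun a b hab => ?_) F.injective, ?_, ?_, ?_, ?_⟩
  · exact Set.disjoint_left.1 hd ⟨a, rfl⟩ ⟨b, hab.symm⟩
  · rw [F.surjective.range_comp, Set.Sum.elim_range]
  · rintro ⟨i | i, p⟩
    · exact h2 ⟨i, p⟩
    · exact h2' ⟨i, p⟩
  · rintro ⟨i | i, p⟩
    · exact h3 ⟨i, p⟩
    · exact h3' ⟨i, p⟩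
  · rintro ⟨i | i, p⟩
    · exact h4 ⟨i, p⟩
    · exact h4' ⟨i, p⟩

theorem SubRealizes.of_unit {d : M.D} (h1 : M.rot d = d) (h2 : Sum.inl d ∈ O) :
    SubRealizes M O lab {d} {.unit (lab (Sum.inl d))} := by
  refine ⟨Unit, inferInstance, fun _ => .unit (lab (Sum.inl d)), fun _ => d, rfl, ?_, ?_, ?_, ?_, ?_⟩
  · rintro ⟨_, p⟩ ⟨_, q⟩ _
    cases p; cases q; rfl
  · ext x
    exact ⟨by rintro ⟨_, rfl⟩; rfl, by rintro rfl; exact ⟨⟨(), .out⟩, rfl⟩⟩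
  · exact fun _ => h1
  · rintro ⟨_, p⟩
    cases p
    exact iff_of_true h2 rfl
  · rintro ⟨_, p⟩
    cases p
    rfl

theorem SubRealizes.of_glue {d : M.D} (h1 : M.rot d ≠ d) (h2 : M.rot (M.rot d) = d)
    (h3 : Sum.inl d ∈ O) (h4 : Sum.inl (M.rot d) ∉ O) :
    SubRealizes M O lab {d, M.rot d} {.glue (lab (Sum.inl d)) (lab (Sum.inl (M.rot d)))} := by
  let v := fun _ : Unit => Vtx.glue (lab (Sum.inl d)) (lab (Sum.inl (M.rot d)))
  let ψ : (famPre v).D → M.D := fun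
    | ⟨_, .tgt⟩ => d
    | ⟨_, .src⟩ => M.rot d
  refine ⟨Unit, inferInstance, v, ψ, rfl, ?_, ?_, ?_, ?_, ?_⟩
  · rintro ⟨_, p⟩ ⟨_, q⟩ h
    cases p <;> cases q
    · rfl
    · exact absurd h.symm h1
    · exact absurd h h1
    · rfl
  · ext x
    constructor
    · rintro ⟨⟨_, p⟩, rfl⟩
      cases p <;> simp [ψ]
    · rintro (rfl | rfl)
      · exact ⟨⟨(), .tgt⟩, rfl⟩
      · exact ⟨⟨(), .src⟩, rfl⟩
  · rintro ⟨_, p⟩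
    cases p
    · rfl
    · exact h2
  · rintro ⟨_, p⟩
    cases p
    · exact iff_of_true h3 rfl
    · exact iff_of_false h4 (by simp [v, Port.isOut])
  · rintro ⟨_, p⟩
    cases p <;> rfl

theorem rot_ne {d : M.D} (h1 : M.rot d ≠ d) (h2 : M.rot (M.rot (M.rot d)) = d) :
    M.rot (M.rot d) ≠ d ∧ M.rot (M.rot d) ≠ M.rot d := by
  refine ⟨fun h => h1 ?_, fun h => h1 (M.rot.injective h)⟩
  rwa [h] at h2

theorem SubRealizes.of_lam {d : M.D} (h1 : M.rot d ≠ d) (h2 : M.rot (M.rot (M.rot d)) = d)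
    (h3 : Sum.inl d ∈ O) (h4 : Sum.inl (M.rot d) ∈ O) (h5 : Sum.inl (M.rot (M.rot d)) ∉ O) :
    SubRealizes M O lab {d, M.rot d, M.rot (M.rot d)} {.lam (lab (Sum.inl d))
      (lab (Sum.inl (M.rot d))) (lab (Sum.inl (M.rot (M.rot d))))} := by
  obtain ⟨h6, h7⟩ := rot_ne h1 h2
  let v := fun _ : Unit => Vtx.lam (lab (Sum.inl d)) (lab (Sum.inl (M.rot d)))
    (lab (Sum.inl (M.rot (M.rot d))))
  let ψ : (famPre v).D → M.D := fun
    | ⟨_, .root⟩ => d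
    | ⟨_, .var⟩ => M.rot d
    | ⟨_, .body⟩ => M.rot (M.rot d)
  refine ⟨Unit, inferInstance, v, ψ, rfl, ?_, ?_, ?_, ?_, ?_⟩
  · rintro ⟨_, p⟩ ⟨_, q⟩ h
    cases p <;> cases q <;> first | rfl | (exfalso; simp [ψ] at h; tauto)
  · ext x
    constructor
    · rintro ⟨⟨_, p⟩, rfl⟩
      cases p <;> simp [ψ]
    · rintro (rfl | rfl | rfl)
      · exact ⟨⟨(), .root⟩, rfl⟩
      · exact ⟨⟨(), .var⟩, rfl⟩
      · exact ⟨⟨(), .body⟩, rfl⟩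
  · rintro ⟨_, p⟩
    cases p
    · rfl
    · rfl
    · exact h2
  · rintro ⟨_, p⟩
    cases p
    · exact iff_of_true h3 rfl
    · exact iff_of_true h4 rfl
    · exact iff_of_false h5 (by simp [v, Port.isOut])
  · rintro ⟨_, p⟩
    cases p <;> rfl

theorem SubRealizes.of_app {d : M.D} (h1 : M.rot d ≠ d) (h2 : M.rot (M.rot (M.rot d)) = d)
    (h3 : Sum.inl d ∈ O) (h4 : Sum.inl (M.rot d) ∉ O) (h5 : Sum.inl (M.rot (M.rot d)) ∉ O) :
    SubRealizes M O lab {d, M.rot d, M.rot (M.rot d)} {.app (lab (Sum.inl d))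
      (lab (Sum.inl (M.rot d))) (lab (Sum.inl (M.rot (M.rot d))))} := by
  obtain ⟨h6, h7⟩ := rot_ne h1 h2
  let v := fun _ : Unit => Vtx.app (lab (Sum.inl d)) (lab (Sum.inl (M.rot d)))
    (lab (Sum.inl (M.rot (M.rot d))))
  let ψ : (famPre v).D → M.D := fun
    | ⟨_, .cont⟩ => d
    | ⟨_, .arg⟩ => M.rot d
    | ⟨_, .fn⟩ => M.rot (M.rot d)
  refine ⟨Unit, inferInstance, v, ψ, rfl, ?_, ?_, ?_, ?_, ?_⟩
  · rintro ⟨_, p⟩ ⟨_, q⟩ h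
    cases p <;> cases q <;> first | rfl | (exfalso; simp [ψ] at h; tauto)
  · ext x
    constructor
    · rintro ⟨⟨_, p⟩, rfl⟩
      cases p <;> simp [ψ]
    · rintro (rfl | rfl | rfl)
      · exact ⟨⟨(), .cont⟩, rfl⟩
      · exact ⟨⟨(), .arg⟩, rfl⟩
      · exact ⟨⟨(), .fn⟩, rfl⟩
  · rintro ⟨_, p⟩
    cases p
    · rfl
    · rfl
    · exact h2
  · rintro ⟨_, p⟩
    cases p
    · exact iff_of_true h3 rfl
    · exact iff_of_false h4 (by simp [v, Port.isOut])
    · exact iff_of_false h5 (by simp [v, Port.isOut])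
  · rintro ⟨_, p⟩
    cases p <;> rfl

/-- The steps of the topological recursion are the term constructors; disjointness of the dart sets
ensures that every vertex is counted once. -/
theorem TopList.term (hlab : ∀ x, lab (M.e x) = lab x) {E : Prop} {S : Set M.D} {r : M.D ⊕ B}
    {Γ : List (M.D ⊕ B)} (h : TopList M O E S r Γ) :
    ∃ N, SubRealizes M O lab S N ∧ Tm E N (lab r) (Γ.map lab) := by
  induction h with
  | edge r h =>
    refine ⟨0, .empty, ?_⟩
    simpa [hlab] using Tm.var (E := E) (lab r)
  | unit r d h1 h2 h3 =>
    refine ⟨_, .of_unit h2 h3, ?_⟩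
    rw [← h1, hlab]
    exact .unit _
  | glue r d S Γ h1 h2 h3 h4 h5 h6 _ ih =>
    obtain ⟨N, hN, ht⟩ := ih
    refine ⟨_, (SubRealizes.of_glue h2 h3 h4 h5).add hN h6, ?_⟩
    rw [← h1, hlab]
    exact ht.glue _
  | lam r d S Γ h1 h2 h3 h4 h5 h6 h7 _ ih =>
    obtain ⟨N, hN, ht⟩ := ih
    refine ⟨_, (SubRealizes.of_lam h2 h3 h4 h5 h6).add hN h7, ?_⟩
    rw [← h1, hlab]
    rw [List.map_append] at ht
    exact ht.lam _
  | app r d S₁ S₂ Γ₁ Γ₂ h1 h2 h3 h4 h5 h6 h7 h8 _ _ ih1 ih2 =>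
    obtain ⟨N₁, hN₁, ht₁⟩ := ih1
    obtain ⟨N₂, hN₂, ht₂⟩ := ih2
    refine ⟨_, (SubRealizes.of_app h2 h3 h4 h5 h6).add (hN₁.add hN₂ h8) h7, ?_⟩
    rw [← h1, hlab, ← add_assoc, List.map_append]
    exact ht₁.app _ ht₂
  | exch S r Γ Δ e hp _ ih =>
    obtain ⟨N, hN, ht⟩ := ih
    exact ⟨N, hN, .exch e (hp.map _) ht⟩

end Top

theorem generatedBy_of_topList {n : ℕ} {ms : Set Move} (hp : imploidMoves ⊆ ms) {E : Prop}
    (hE : E → CanSwap n ms) (M : RootedMap n) (o : Orientation M.toOpenMap)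
    (ho : M.IsTopological o) (h : TopList M.toOpenMap o.pos E Set.univ (Sum.inr 0)
      (List.ofFn fun i : Fin n => Sum.inr i.succ)) : GeneratedBy ms (M.withOrientation o) := by
  classical
  have := M.finite
  obtain ⟨enc, henc⟩ := Countable.exists_injective_nat (M.D ⊕ Fin (n + 1))
  -- An edge is named by the code of its positive arc, which is the same seen from either end.
  let lab : M.D ⊕ Fin (n + 1) → ℕ := fun x => enc (if x ∈ o.pos then x else M.e x)
  have hlab : ∀ x, lab (M.e x) = lab x := by
    intro x
    have := o.pos_iff x
    by_cases hx : x ∈ o.pos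
    · simp [lab, hx, this.1 hx, M.e_invol x]
    · simp [lab, hx, show M.e x ∈ o.pos by tauto]
  have hinj : ∀ x y, lab x = lab y → (x ∈ o.pos ↔ y ∈ o.pos) → x = y := by
    intro x y h1 h2
    have h1 := henc h1
    by_cases hx : x ∈ o.pos
    · simpa [hx, h2.1 hx] using h1
    · simp only [hx, show y ∉ o.pos by tauto, if_false] at h1
      exact M.e_invol.injective h1
  obtain ⟨h0, hb⟩ := ho.pos
  have h0 : Sum.inr 0 ∉ o.pos := (o.pos_iff (Sum.inr 0)).not.2 (not_not.2 h0)
  obtain ⟨N, ⟨ι, _, v, ψ, rfl, h1, h2, h3, h4, h5⟩, ht⟩ := h.term hlab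
  let β : Fin (n + 1) → ℕ := fun i => lab (Sum.inr i)
  let φ : (famPre v).D ≃ M.D := Equiv.ofBijective ψ ⟨h1, Set.range_eq_univ.1 h2⟩
  have hL : ∀ x, lab (Sum.map φ id x) = (famPre v).labB β x := by
    rintro (d | i)
    · exact h5 d
    · rfl
  have hO : ∀ x, Sum.map φ id x ∈ o.pos ↔ (famPre v).outB nonroot x := by
    rintro (d | i)
    · exact h4 d
    · by_cases hi : i = 0
      · subst hi
        exact iff_of_false h0 (by simp)
      · exact iff_of_true (hb ⟨i, hi, rfl⟩) hi
  have R : Realization (M.withOrientation o).toOrientedMap (famPre v) β nonroot :=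
    ⟨φ, h3, hO, fun x y hxy => (hL y).symm.trans
      ((congrArg lab hxy).symm.trans ((hlab _).trans (hL x)))⟩
  refine generatedBy_of_term hp hE ((proper_iff_valid v β).1 ⟨fun x => ?_, fun x y h6 h7 => ?_⟩)
    R.realizes (by simpa [List.map_ofFn, Function.comp_def] using ht)
  · obtain ⟨y, hy⟩ := sum_map_surj φ (M.e (Sum.map φ id x))
    refine ⟨y, ?_, ?_⟩
    · rw [← hL, ← hL, hy, hlab]
    · rw [← hO, ← hO, hy, o.pos_iff (Sum.map φ id x), not_not]
  · exact sum_map_inj φ (hinj _ _ (by rw [hL, hL, h6]) (by rw [hO, hO, h7]))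

end ImploidMoves


namespace ImploidMoves

/-! ### Existence of the topological orientation -/

section Existence

variable {B : Type} {M : OpenMap B}

/-- The arcs reachable from `r` through edges and through the vertices made of darts in `S`. -/
inductive Reach (M : OpenMap B) (S : Set M.D) (r : M.D ⊕ B) : M.D ⊕ B → Prop
  | root : Reach M S r r
  | edge (x : M.D ⊕ B) : Reach M S r x → Reach M S r (M.e x)
  | vertex (d : M.D) : d ∈ S → Reach M S r (Sum.inl d) → Reach M S r (Sum.inl (M.rot d))

/-- `S` is a union of vertices. -/
def RotClosed (M : OpenMap B) (S : Set M.D) : Prop := ∀ d ∈ S, M.rot d ∈ S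

theorem RotClosed.of_rot_mem {S : Set M.D} (h : RotClosed M S) {d : M.D} (hd : M.rot d ∈ S) :
    d ∈ S := by
  rcases M.deg_le d with h1 | h1 | h1
  · rwa [h1] at hd
  · rw [← h1]; exact h _ hd
  · rw [← h1]; exact h _ (h _ hd)

/-- Vertices have degree at most 3, so up to two further rotations lead from `M.rot d` back to `d`.
-/
theorem Reach.of_rot {S : Set M.D} {r : M.D ⊕ B} (hS : RotClosed M S) {d : M.D} (hd : d ∈ S)
    (h : Reach M S r (Sum.inl (M.rot d))) : Reach M S r (Sum.inl d) := by
  have h2 := Reach.vertex _ (hS _ hd) h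
  have h3 := Reach.vertex _ (hS _ (hS _ hd)) h2
  rcases M.deg_le d with h1 | h1 | h1
  · rwa [h1] at h
  · rwa [h1] at h2
  · rwa [h1] at h3

theorem Reach.of_edge {S : Set M.D} {r x : M.D ⊕ B} (h : Reach M S r (M.e x)) : Reach M S r x := by
  have := h.edge
  rwa [M.e_invol] at this

/-- Each step of a path from `b` can be reversed when `S` is a union of vertices, so an arc reached
from both roots would make `b` reachable from `a`. -/
theorem Reach.disjoint {S : Set M.D} {a b x : M.D ⊕ B} (hS : RotClosed M S)
    (hab : ¬ Reach M S a b) (hb : Reach M S b x) : ¬ Reach M S a x := by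
  induction hb with
  | root => exact hab
  | edge x _ ih => exact fun h => ih h.of_edge
  | vertex d hd _ ih => exact fun h => ih (h.of_rot hS hd)

theorem Reach.trans {S : Set M.D} {a b x : M.D ⊕ B} (h : Reach M S a b) (h' : Reach M S b x) :
    Reach M S a x := by
  induction h' with
  | root => exact h
  | edge x _ ih => exact ih.edge
  | vertex d hd _ ih => exact ih.vertex _ hd

theorem Reach.mono {S T : Set M.D} (hST : S ⊆ T) {a x : M.D ⊕ B} (h : Reach M S a x) :
    Reach M T a x := by
  induction h with
  | root => exact .root
  | edge x _ ih => exact ih.edge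
  | vertex d hd _ ih => exact ih.vertex _ (hST hd)

theorem Reach.restrict {S : Set M.D} {a x : M.D ⊕ B} (h : Reach M S a x) :
    Reach M {s | s ∈ S ∧ Reach M S a (Sum.inl s)} a x := by
  induction h with
  | root => exact .root
  | edge x _ ih => exact ih.edge
  | vertex d hd h ih => exact ih.vertex _ ⟨hd, h⟩

/-- The set of arcs matters only on the submap and its non-root boundary. This allows sets chosen
separately for the parts of a map to be united. -/
theorem TopologicalAt.congr {O O' : Set (M.D ⊕ B)} {S : Set M.D} {r : M.D ⊕ B}
    {B' : Set (M.D ⊕ B)} (h : TopologicalAt M O S r B')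
    (h1 : ∀ d ∈ S, Sum.inl d ∈ O ↔ Sum.inl d ∈ O') (h2 : ∀ x ∈ B', x ∈ O ↔ x ∈ O') :
    TopologicalAt M O' S r B' := by
  induction h with
  | edge r h => exact .edge r ((h2 _ rfl).1 h)
  | unit r d a b c => exact .unit r d a b ((h1 d rfl).1 c)
  | glue r d S B' a b c e f g _ ih =>
    exact .glue r d S B' a b c ((h1 _ (by simp)).1 e) ((h1 _ (by simp)).not.1 f) g
      (ih (fun s hs => h1 s (Or.inr hs)) h2)
  | lam r d S B' a b c e f g h i _ ih =>
    refine .lam r d S B' a b c ((h1 _ (by simp)).1 e) ((h1 _ (by simp)).1 f)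
      ((h1 _ (by simp)).not.1 g) h i (ih (fun s hs => h1 s (Or.inr hs)) ?_)
    rintro x (rfl | hx)
    · exact h1 _ (by simp)
    · exact h2 x hx
  | app r d S₁ S₂ B₁ B₂ a b c e f g h i j _ _ ih1 ih2 =>
    exact .app r d S₁ S₂ B₁ B₂ a b c ((h1 _ (by simp)).1 e) ((h1 _ (by simp)).not.1 f)
      ((h1 _ (by simp)).not.1 g) h i j
      (ih1 (fun s hs => h1 s (Or.inr (Or.inl hs))) fun x hx => h2 x (Or.inl hx))
      (ih2 (fun s hs => h1 s (Or.inr (Or.inr hs))) fun x hx => h2 x (Or.inr hx))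

theorem TopologicalAt.cast {O : Set (M.D ⊕ B)} {S T : Set M.D} {r : M.D ⊕ B}
    {B' C' : Set (M.D ⊕ B)} (h : TopologicalAt M O S r B') (hS : S = T) (hB : B' = C') :
    TopologicalAt M O T r C' := hS ▸ hB ▸ h

/-- The non-root boundary arcs of the submap with root `r` and vertices in `S`. -/
abbrev bdry (M : OpenMap B) (S : Set M.D) (r : M.D ⊕ B) : Set (M.D ⊕ B) :=
  {x | Reach M S r x ∧ x ≠ r ∧ ∀ d ∈ S, x ≠ Sum.inl d}

/-- The arcs `r` and `d` form an edge, so each is entered along it only from the other. Rotation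
cannot produce `r`, which lies outside `S`, and produces `d` only from a dart in the removed set
`K`. -/
theorem reach_remove {S : Set M.D} {r q : M.D ⊕ B} {d : M.D} (hr : M.e r = Sum.inl d)
    (hrS : ∀ s ∈ S, r ≠ Sum.inl s) (hS : RotClosed M S) {K : Set M.D}
    (hK : ∀ s, M.rot s = d → s ∈ K) (hq : q ≠ r) (hq' : q ≠ Sum.inl d) {x : M.D ⊕ B}
    (h : Reach M (S \ K) q x) : x ≠ r ∧ x ≠ Sum.inl d := by
  induction h with
  | root => exact ⟨hq, hq'⟩
  | edge x _ ih =>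
    refine ⟨fun h => ih.2 ?_, fun h => ih.1 ?_⟩
    · rw [← hr, ← h, M.e_invol]
    · exact M.e_invol.injective (h.trans hr.symm)
  | vertex s hs _ ih =>
    refine ⟨(hrS _ (hS _ hs.1)).symm, fun h => hs.2 (hK s ?_)⟩
    exact Sum.inl.inj h

/-- Here and in the following cases the set `O` is confined to arcs reachable from the root and
different from it. This prevents sets built for different parts from interfering, and keeps the new
root an input. -/
theorem exists_topologicalAt_edge {S : Set M.D} {r : M.D ⊕ B} (hr : ∀ d ∈ S, M.e r ≠ Sum.inl d)
    (hrS : ∀ s ∈ S, r ≠ Sum.inl s) (hS : ∀ d ∈ S, Reach M S r (Sum.inl d)) :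
    ∃ O, (∀ x ∈ O, Reach M S r x ∧ x ≠ r) ∧ TopologicalAt M O S r (bdry M S r) := by
  have h1 : ∀ x, Reach M S r x → x = r ∨ x = M.e r := by
    intro x h
    induction h with
    | root => exact Or.inl rfl
    | edge x _ ih =>
      rcases ih with rfl | rfl
      · exact Or.inr rfl
      · exact Or.inl (M.e_invol _)
    | vertex d hd _ ih =>
      rcases ih with h | h
      · exact absurd h.symm (hrS d hd)
      · exact absurd h.symm (hr d hd)
  have h2 : S = ∅ := Set.eq_empty_iff_forall_notMem.2 fun d hd => by
    rcases h1 _ (hS d hd) with h | h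
    · exact hrS d hd h.symm
    · exact hr d hd h.symm
  subst h2
  refine ⟨{M.e r}, ?_, (TopologicalAt.edge r (Set.mem_singleton _)).cast rfl ?_⟩
  · rintro x rfl
    exact ⟨Reach.root.edge, M.e_ne r⟩
  · ext x
    constructor
    · rintro rfl
      exact ⟨Reach.root.edge, M.e_ne r, by simp⟩
    · rintro ⟨h, h', -⟩
      exact (h1 x h).resolve_left h'

theorem exists_topologicalAt_unit {S : Set M.D} {r : M.D ⊕ B} {d : M.D} (hr : M.e r = Sum.inl d)
    (hd : d ∈ S) (hdd : M.rot d = d)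
    (hrS : ∀ s ∈ S, r ≠ Sum.inl s) (hS : ∀ d ∈ S, Reach M S r (Sum.inl d)) :
    ∃ O, (∀ x ∈ O, Reach M S r x ∧ x ≠ r) ∧ TopologicalAt M O S r (bdry M S r) := by
  have h1 : ∀ x, Reach M S r x → x = r ∨ x = Sum.inl d := by
    intro x h
    induction h with
    | root => exact Or.inl rfl
    | edge x _ ih =>
      rcases ih with rfl | rfl
      · exact Or.inr hr
      · exact Or.inl (by rw [← hr, M.e_invol])
    | vertex s hs _ ih =>
      rcases ih with h | h
      · exact absurd h.symm (hrS s hs)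
      · rw [Sum.inl.inj h, hdd]
        exact Or.inr rfl
  have h2 : S = {d} := by
    ext s
    constructor
    · intro hs
      rcases h1 _ (hS s hs) with h | h
      · exact absurd h.symm (hrS s hs)
      · exact Sum.inl.inj h
    · rintro rfl
      exact hd
  refine ⟨{Sum.inl d}, ?_, (TopologicalAt.unit r d hr hdd (Set.mem_singleton _)).cast h2.symm ?_⟩
  · rintro x rfl
    exact ⟨hS d hd, (hrS d hd).symm⟩
  · symm
    rw [Set.eq_empty_iff_forall_notMem]
    rintro x ⟨h3, h4, h5⟩
    exact h5 d hd ((h1 x h3).resolve_left h4)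

theorem exists_topologicalAt_glue {S : Set M.D} {r : M.D ⊕ B} {d : M.D} (hr : M.e r = Sum.inl d)
    (hd : d ∈ S) (hdd : M.rot d ≠ d) (hddd : M.rot (M.rot d) = d) (hrot : RotClosed M S)
    (hrS : ∀ s ∈ S, r ≠ Sum.inl s) (hS : ∀ d ∈ S, Reach M S r (Sum.inl d))
    (ih : ∀ T r', T ⊂ S → RotClosed M T → (∀ s ∈ T, r' ≠ Sum.inl s) →
      (∀ d ∈ T, Reach M T r' (Sum.inl d)) → ∃ O, (∀ x ∈ O, Reach M T r' x ∧ x ≠ r') ∧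
        TopologicalAt M O T r' (bdry M T r')) :
    ∃ O, (∀ x ∈ O, Reach M S r x ∧ x ≠ r) ∧ TopologicalAt M O S r (bdry M S r) := by
  have hT : RotClosed M (S \ {d, M.rot d}) := by
    rintro s ⟨hs, hs'⟩
    refine ⟨hrot s hs, fun h => hs' ?_⟩
    rcases h with h | h
    · exact Or.inr (M.rot.injective (h.trans hddd.symm))
    · exact Or.inl (M.rot.injective h)
  have hin : Reach M S r (Sum.inl (M.rot d)) := (hr ▸ Reach.root.edge).vertex _ hd
  have hsplit : ∀ x, Reach M S r x →
      x = r ∨ x = Sum.inl d ∨ Reach M (S \ {d, M.rot d}) (Sum.inl (M.rot d)) x := by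
    intro x h
    induction h with
    | root => exact Or.inl rfl
    | edge x _ ih =>
      rcases ih with rfl | rfl | h
      · exact Or.inr (Or.inl hr)
      · exact Or.inl (by rw [← hr, M.e_invol])
      · exact Or.inr (Or.inr h.edge)
    | vertex s hs _ ih =>
      rcases ih with h | h | h
      · exact absurd h.symm (hrS s hs)
      · rw [Sum.inl.inj h]
        exact Or.inr (Or.inr .root)
      · by_cases hs1 : s = M.rot d
        · rw [hs1, hddd]
          exact Or.inr (Or.inl rfl)
        · by_cases hs2 : s = d
          · rw [hs2]
            exact Or.inr (Or.inr .root)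
          · exact Or.inr (Or.inr (h.vertex _ ⟨hs, by simp [hs1, hs2]⟩))
  have hsub : ∀ x, Reach M (S \ {d, M.rot d}) (Sum.inl (M.rot d)) x → Reach M S r x :=
    fun x h => hin.trans (h.mono Set.sdiff_subset)
  have hne : ∀ x, Reach M (S \ {d, M.rot d}) (Sum.inl (M.rot d)) x → x ≠ r ∧ x ≠ Sum.inl d := by
    intro x h
    refine reach_remove hr hrS hrot ?_ (hrS _ (hrot _ hd)).symm (by simpa using hdd) h
    exact fun s hs => Or.inr (M.rot.injective (hs.trans hddd.symm))
  obtain ⟨O, hO, h⟩ := ih (S \ {d, M.rot d}) (Sum.inl (M.rot d))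
    ⟨Set.sdiff_subset, fun h => (h hd).2 (by simp)⟩ hT
    (by rintro s ⟨_, hs⟩ h; apply hs; simp at h; simp [h])
    (by
      rintro s ⟨hs, hs'⟩
      rcases hsplit _ (hS s hs) with h | h | h
      · exact absurd h.symm (hrS s hs)
      · simp at h; simp [h] at hs'
      · exact h)
  have hdO : Sum.inl (M.rot d) ∉ O := fun h => (hO _ h).2 rfl
  refine ⟨insert (Sum.inl d) O, ?_, (TopologicalAt.glue r d _ _ hr hdd hddd (by simp)
    (by simp [hdd, hdO]) Set.disjoint_sdiff_right (h.congr (fun s hs => ?_) fun x hx => ?_)).cast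
    ?_ ?_⟩
  · rintro x (rfl | hx)
    · exact ⟨hS d hd, (hrS d hd).symm⟩
    · exact ⟨hsub x (hO x hx).1, (hne x (hO x hx).1).1⟩
  · have : s ≠ d := fun h => hs.2 (Or.inl h)
    simp [this]
  · simp [(hne x hx.1).2]
  · exact Set.union_sdiff_cancel (by rintro s (rfl | rfl); exacts [hd, hrot _ hd])
  · ext x
    constructor
    · rintro ⟨h1, h2, h3⟩
      refine ⟨hsub x h1, (hne x h1).1, fun s hs hx => ?_⟩
      by_cases hs1 : s = d
      · exact (hne x h1).2 (hs1 ▸ hx)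
      · by_cases hs2 : s = M.rot d
        · exact h2 (hs2 ▸ hx)
        · exact h3 s ⟨hs, by simp [hs1, hs2]⟩ hx
    · rintro ⟨h1, h2, h3⟩
      refine ⟨((hsplit x h1).resolve_left h2).resolve_left (h3 d hd), h3 _ (hrot _ hd),
        fun s hs => h3 s hs.1⟩

/-- After removal of the vertex, every reachable arc off the root edge is reached from the second or
from the third dart. Whether these two lie in one component decides between abstraction and
application. -/
theorem exists_topologicalAt_three {S : Set M.D} {r : M.D ⊕ B} {d : M.D} (hr : M.e r = Sum.inl d)
    (hd : d ∈ S) (hdd : M.rot d ≠ d) (hddd : M.rot (M.rot (M.rot d)) = d) (hrot : RotClosed M S)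
    (hrS : ∀ s ∈ S, r ≠ Sum.inl s) (hS : ∀ d ∈ S, Reach M S r (Sum.inl d))
    (ih : ∀ T r', T ⊂ S → RotClosed M T → (∀ s ∈ T, r' ≠ Sum.inl s) →
      (∀ d ∈ T, Reach M T r' (Sum.inl d)) → ∃ O, (∀ x ∈ O, Reach M T r' x ∧ x ≠ r') ∧
        TopologicalAt M O T r' (bdry M T r')) :
    ∃ O, (∀ x ∈ O, Reach M S r x ∧ x ≠ r) ∧ TopologicalAt M O S r (bdry M S r) := by
  obtain ⟨hn1, hn2⟩ := rot_ne hdd hddd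
  set d₁ := M.rot d with hd₁
  set d₂ := M.rot d₁ with hd₂
  have hd₁S : d₁ ∈ S := hrot _ hd
  have hd₂S : d₂ ∈ S := hrot _ hd₁S
  set K : Set M.D := {d, d₁, d₂} with hK
  have hT : RotClosed M (S \ K) := by
    rintro s ⟨hs, hs'⟩
    refine ⟨hrot s hs, fun h => hs' ?_⟩
    rcases h with h | h | h
    · exact Or.inr (Or.inr (M.rot.injective (h.trans hddd.symm)))
    · exact Or.inl (M.rot.injective h)
    · exact Or.inr (Or.inl (M.rot.injective h))
  have hin1 : Reach M S r (Sum.inl d₁) := (hr ▸ Reach.root.edge).vertex _ hd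
  have hin2 : Reach M S r (Sum.inl d₂) := hin1.vertex _ hd₁S
  have hsplit : ∀ x, Reach M S r x → x = r ∨ x = Sum.inl d ∨
      Reach M (S \ K) (Sum.inl d₂) x ∨ Reach M (S \ K) (Sum.inl d₁) x := by
    intro x h
    induction h with
    | root => exact Or.inl rfl
    | edge x _ ih =>
      rcases ih with rfl | rfl | h | h
      · exact Or.inr (Or.inl hr)
      · exact Or.inl (by rw [← hr, M.e_invol])
      · exact Or.inr (Or.inr (Or.inl h.edge))
      · exact Or.inr (Or.inr (Or.inr h.edge))
    | vertex s hs _ ih =>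
      by_cases hs0 : s = d
      · rw [hs0]
        exact Or.inr (Or.inr (Or.inr .root))
      by_cases hs1 : s = d₁
      · rw [hs1]
        exact Or.inr (Or.inr (Or.inl .root))
      by_cases hs2 : s = d₂
      · rw [hs2, hddd]
        exact Or.inr (Or.inl rfl)
      have hsT : s ∈ S \ K := ⟨hs, by simp [hK, hs0, hs1, hs2]⟩
      rcases ih with h | h | h | h
      · exact absurd h.symm (hrS s hs)
      · exact absurd (Sum.inl.inj h) hs0
      · exact Or.inr (Or.inr (Or.inl (h.vertex _ hsT)))
      · exact Or.inr (Or.inr (Or.inr (h.vertex _ hsT)))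
  have hKd : ∀ s, M.rot s = d → s ∈ K := fun s hs =>
    Or.inr (Or.inr (M.rot.injective (hs.trans hddd.symm)))
  have hne1 : ∀ x, Reach M (S \ K) (Sum.inl d₁) x → x ≠ r ∧ x ≠ Sum.inl d := fun x h =>
    reach_remove hr hrS hrot hKd (hrS _ hd₁S).symm (by simpa using hdd) h
  have hne2 : ∀ x, Reach M (S \ K) (Sum.inl d₂) x → x ≠ r ∧ x ≠ Sum.inl d := fun x h =>
    reach_remove hr hrS hrot hKd (hrS _ hd₂S).symm (by simpa using hn1) h
  have hsub1 : ∀ x, Reach M (S \ K) (Sum.inl d₁) x → Reach M S r x :=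
    fun x h => hin1.trans (h.mono Set.sdiff_subset)
  have hsub2 : ∀ x, Reach M (S \ K) (Sum.inl d₂) x → Reach M S r x :=
    fun x h => hin2.trans (h.mono Set.sdiff_subset)
  have hlt : S \ K ⊂ S := ⟨Set.sdiff_subset, fun h => (h hd).2 (by simp [hK])⟩
  have hKS : K ∪ (S \ K) = S :=
    Set.union_sdiff_cancel (by rintro s (rfl | rfl | rfl); exacts [hd, hd₁S, hd₂S])
  have hnotK : ∀ s ∈ S \ K, s ≠ d ∧ s ≠ d₁ ∧ s ≠ d₂ := by
    rintro s ⟨-, hs⟩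
    simpa [hK] using hs
  -- If the second dart is still reachable from the third, the remainder is one submap rooted at the
  -- third dart, and the second dart is one of its boundary arcs.
  by_cases hc : Reach M (S \ K) (Sum.inl d₂) (Sum.inl d₁)
  · have hsplit' : ∀ x, Reach M S r x → x = r ∨ x = Sum.inl d ∨
        Reach M (S \ K) (Sum.inl d₂) x := by
      intro x hx
      rcases hsplit x hx with h | h | h | h
      · exact Or.inl h
      · exact Or.inr (Or.inl h)
      · exact Or.inr (Or.inr h)
      · exact Or.inr (Or.inr (hc.trans h))
    obtain ⟨O, hO, h⟩ := ih (S \ K) (Sum.inl d₂) hlt hT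
      (fun s hs h => (hnotK s hs).2.2 (Sum.inl.inj h).symm)
      (fun s hs => by
        rcases hsplit' _ (hS s hs.1) with h | h | h
        · exact absurd h.symm (hrS s hs.1)
        · exact absurd (Sum.inl.inj h) (hnotK s hs).1
        · exact h)
    have hd₂O : Sum.inl d₂ ∉ O := fun h => (hO _ h).2 rfl
    have hd₁b : Sum.inl d₁ ∈ bdry M (S \ K) (Sum.inl d₂) :=
      ⟨hc, by simpa using hn2.symm, fun s hs h => (hnotK s hs).2.1 (Sum.inl.inj h).symm⟩
    refine ⟨insert (Sum.inl d) O, ?_, (TopologicalAt.lam r d (S \ K)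
      (bdry M (S \ K) (Sum.inl d₂) \ {Sum.inl d₁}) hr hdd hddd (by simp)
      (Or.inr (h.pos.2 hd₁b)) (by simp [← hd₁, ← hd₂, hn1, hd₂O]) Set.disjoint_sdiff_right (by simp [hd₁])
      ((h.congr (fun s hs => ?_) fun x hx => ?_).cast rfl ?_)).cast hKS ?_⟩
    · rintro x (rfl | hx)
      · exact ⟨hS d hd, (hrS d hd).symm⟩
      · exact ⟨hsub2 x (hO x hx).1, (hne2 x (hO x hx).1).1⟩
    · simp [(hnotK s hs).1]
    · simp [(hne2 x hx.1).2]
    · rw [Set.insert_sdiff_singleton, Set.insert_eq_of_mem hd₁b]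
    · ext x
      constructor
      · rintro ⟨⟨h1, h2, h3⟩, h4⟩
        refine ⟨hsub2 x h1, (hne2 x h1).1, fun s hs hx => ?_⟩
        by_cases hsK : s ∈ K
        · rcases hsK with rfl | rfl | rfl
          · exact (hne2 x h1).2 hx
          · exact h4 hx
          · exact h2 hx
        · exact h3 s ⟨hs, hsK⟩ hx
      · rintro ⟨h1, h2, h3⟩
        exact ⟨⟨((hsplit' x h1).resolve_left h2).resolve_left (h3 d hd), h3 _ hd₂S,
          fun s hs => h3 s hs.1⟩, h3 _ hd₁S⟩
  -- Otherwise the two darts reach disjoint sets of arcs.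
  · have hdis : ∀ x, Reach M (S \ K) (Sum.inl d₁) x → ¬ Reach M (S \ K) (Sum.inl d₂) x :=
      fun x hx => hx.disjoint hT hc
    -- The induction hypothesis is applied to the component of `q`. Restricting to its own darts
    -- changes neither what is reachable nor the boundary.
    have key : ∀ q, q ∈ S → q ∈ K → ∃ O,
        (∀ x ∈ O, Reach M (S \ K) (Sum.inl q) x ∧ x ≠ Sum.inl q) ∧
        TopologicalAt M O {s | s ∈ S \ K ∧ Reach M (S \ K) (Sum.inl q) (Sum.inl s)} (Sum.inl q)
          {x | Reach M (S \ K) (Sum.inl q) x ∧ x ≠ Sum.inl q ∧ ∀ s ∈ S \ K, x ≠ Sum.inl s} := by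
      intro q hq hqK
      have hsub : {s | s ∈ S \ K ∧ Reach M (S \ K) (Sum.inl q) (Sum.inl s)} ⊆ S \ K :=
        fun s hs => hs.1
      obtain ⟨O, hO, h⟩ := ih {s | s ∈ S \ K ∧ Reach M (S \ K) (Sum.inl q) (Sum.inl s)}
        (Sum.inl q) (lt_of_le_of_lt hsub hlt) (fun s hs => ⟨hT s hs.1, hs.2.vertex _ hs.1⟩)
        (fun s hs h => hs.1.2 (Sum.inl.inj h ▸ hqK)) (fun s hs => hs.2.restrict)
      refine ⟨O, fun x hx => ⟨(hO x hx).1.mono hsub, (hO x hx).2⟩, h.cast rfl ?_⟩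
      ext x
      constructor
      · rintro ⟨h1, h2, h3⟩
        exact ⟨h1.mono hsub, h2, fun s hs hx => h3 s ⟨hs, hx ▸ h1.mono hsub⟩ hx⟩
      · rintro ⟨h1, h2, h3⟩
        exact ⟨h1.restrict, h2, fun s hs => h3 s hs.1⟩
    obtain ⟨O₂, hO₂, h₂⟩ := key d₂ hd₂S (by simp [hK])
    obtain ⟨O₁, hO₁, h₁⟩ := key d₁ hd₁S (by simp [hK])
    have hd₁O : Sum.inl d₁ ∉ insert (Sum.inl d) (O₁ ∪ O₂) := by
      rintro (h | h | h)
      · exact hdd (Sum.inl.inj h)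
      · exact (hO₁ _ h).2 rfl
      · exact hdis _ .root (hO₂ _ h).1
    have hd₂O : Sum.inl d₂ ∉ insert (Sum.inl d) (O₁ ∪ O₂) := by
      rintro (h | h | h)
      · exact hn1 (Sum.inl.inj h)
      · exact hdis _ (hO₁ _ h).1 .root
      · exact (hO₂ _ h).2 rfl
    have hc1 : ∀ x, Reach M (S \ K) (Sum.inl d₁) x →
        (x ∈ O₁ ↔ x ∈ insert (Sum.inl d) (O₁ ∪ O₂)) := by
      intro x hx
      refine ⟨fun h => Or.inr (Or.inl h), ?_⟩
      rintro (h | h | h)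
      · exact absurd h (hne1 x hx).2
      · exact h
      · exact absurd (hO₂ _ h).1 (hdis x hx)
    have hc2 : ∀ x, Reach M (S \ K) (Sum.inl d₂) x →
        (x ∈ O₂ ↔ x ∈ insert (Sum.inl d) (O₁ ∪ O₂)) := by
      intro x hx
      refine ⟨fun h => Or.inr (Or.inr h), ?_⟩
      rintro (h | h | h)
      · exact absurd h (hne2 x hx).2
      · exact absurd hx (hdis x (hO₁ _ h).1)
      · exact h
    have hS12 : {s | s ∈ S \ K ∧ Reach M (S \ K) (Sum.inl d₂) (Sum.inl s)} ∪
        {s | s ∈ S \ K ∧ Reach M (S \ K) (Sum.inl d₁) (Sum.inl s)} = S \ K := by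
      ext s
      constructor
      · rintro (h | h) <;> exact h.1
      · intro hs
        rcases hsplit _ (hS s hs.1) with h | h | h | h
        · exact absurd h.symm (hrS s hs.1)
        · exact absurd (Sum.inl.inj h) (hnotK s hs).1
        · exact Or.inl ⟨hs, h⟩
        · exact Or.inr ⟨hs, h⟩
    refine ⟨insert (Sum.inl d) (O₁ ∪ O₂), ?_, (TopologicalAt.app r d _ _ _ _ hr hdd hddd (by simp)
      hd₁O hd₂O ?_ ?_ ?_ (h₂.congr (fun s hs => hc2 _ hs.2) fun x hx => hc2 _ hx.1)
      (h₁.congr (fun s hs => hc1 _ hs.2) fun x hx => hc1 _ hx.1)).cast ?_ ?_⟩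
    · rintro x (rfl | hx | hx)
      · exact ⟨hS d hd, (hrS d hd).symm⟩
      · exact ⟨hsub1 x (hO₁ x hx).1, (hne1 x (hO₁ x hx).1).1⟩
      · exact ⟨hsub2 x (hO₂ x hx).1, (hne2 x (hO₂ x hx).1).1⟩
    · rw [hS12]
      exact Set.disjoint_sdiff_right
    · exact Set.disjoint_left.2 fun s h h' => hdis _ h'.2 h.2
    · exact Set.disjoint_left.2 fun s h h' => hdis _ h'.1 h.1
    · rw [hS12]
      exact hKS
    · ext x
      constructor
      · rintro (⟨h1, h2, h3⟩ | ⟨h1, h2, h3⟩)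
        · refine ⟨hsub2 x h1, (hne2 x h1).1, fun s hs hx => ?_⟩
          by_cases hsK : s ∈ K
          · rcases hsK with rfl | rfl | rfl
            · exact (hne2 x h1).2 hx
            · exact hdis _ .root (hx ▸ h1)
            · exact h2 hx
          · exact h3 s ⟨hs, hsK⟩ hx
        · refine ⟨hsub1 x h1, (hne1 x h1).1, fun s hs hx => ?_⟩
          by_cases hsK : s ∈ K
          · rcases hsK with rfl | rfl | rfl
            · exact (hne1 x h1).2 hx
            · exact h2 hx
            · exact hdis _ (hx ▸ h1) .root
          · exact h3 s ⟨hs, hsK⟩ hx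
      · rintro ⟨h1, h2, h3⟩
        rcases hsplit _ h1 with h | h | h | h
        · exact absurd h h2
        · exact absurd h (h3 d hd)
        · exact Or.inl ⟨h, h3 _ hd₂S, fun s hs => h3 s hs.1⟩
        · exact Or.inr ⟨h, h3 _ hd₁S, fun s hs => h3 s hs.1⟩

theorem exists_topologicalAt (M : OpenMap B) (S : Set M.D) (r : M.D ⊕ B) (hrot : RotClosed M S)
    (hrS : ∀ s ∈ S, r ≠ Sum.inl s) (hS : ∀ d ∈ S, Reach M S r (Sum.inl d)) :
    ∃ O, (∀ x ∈ O, Reach M S r x ∧ x ≠ r) ∧ TopologicalAt M O S r (bdry M S r) := by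
  have := M.finite
  induction S using WellFoundedLT.induction generalizing r with
  | ind S ih =>
    by_cases h : ∃ d ∈ S, M.e r = Sum.inl d
    · obtain ⟨d, hd, hr⟩ := h
      by_cases h1 : M.rot d = d
      · exact exists_topologicalAt_unit hr hd h1 hrS hS
      · by_cases h2 : M.rot (M.rot d) = d
        · exact exists_topologicalAt_glue hr hd h1 h2 hrot hrS hS fun T r' hT => ih T hT r'
        · exact exists_topologicalAt_three hr hd h1
            (((M.deg_le d).resolve_left h1).resolve_left h2) hrot hrS hS fun T r' hT => ih T hT r'
    · exact exists_topologicalAt_edge (fun d hd h' => h ⟨d, hd, h'⟩) hrS hS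

/-- A set that agrees with the topological rules contains exactly one arc of every edge. Besides the
root edge, each edge is covered in a recursive call, and the root of such a call is an input of the
removed vertex, so the assumption `hr` renews itself. -/
theorem TopologicalAt.alternate {O : Set (M.D ⊕ B)} {S : Set M.D} {r : M.D ⊕ B}
    {B' : Set (M.D ⊕ B)} (h : TopologicalAt M O S r B') (hr : r ∉ O) :
    (r ∈ O ↔ M.e r ∉ O) ∧ (∀ d ∈ S, Sum.inl d ∈ O ↔ M.e (Sum.inl d) ∉ O) ∧
      ∀ x ∈ B', x ∈ O ↔ M.e x ∉ O := by
  have h0 : r ∈ O ↔ M.e r ∉ O := iff_of_false hr (not_not.2 h.pos.1)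
  have h1 : ∀ d, M.e r = Sum.inl d → (Sum.inl d ∈ O ↔ M.e (Sum.inl d) ∉ O) := by
    intro d hd
    rw [← hd, M.e_invol]
    exact iff_of_true h.pos.1 hr
  refine ⟨h0, ?_⟩
  induction h with
  | edge r h =>
    refine ⟨by simp, ?_⟩
    rintro x rfl
    rw [M.e_invol]
    exact iff_of_true h hr
  | unit r d a b c =>
    refine ⟨?_, by simp⟩
    rintro x rfl
    exact h1 x a
  | glue r d S B' a b c e f g h ih =>
    have i0 : Sum.inl (M.rot d) ∈ O ↔ M.e (Sum.inl (M.rot d)) ∉ O :=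
      iff_of_false f (not_not.2 h.pos.1)
    have i1 : ∀ s, M.e (Sum.inl (M.rot d)) = Sum.inl s →
        (Sum.inl s ∈ O ↔ M.e (Sum.inl s) ∉ O) := by
      intro s hs
      rw [← hs, M.e_invol]
      exact iff_of_true h.pos.1 f
    obtain ⟨i2, i3⟩ := ih f i0 i1
    refine ⟨?_, i3⟩
    rintro s ((rfl | rfl) | hs)
    exacts [h1 _ a, i0, i2 s hs]
  | lam r d S B' a b c e f g _ _ h ih =>
    have i0 : Sum.inl (M.rot (M.rot d)) ∈ O ↔ M.e (Sum.inl (M.rot (M.rot d))) ∉ O :=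
      iff_of_false g (not_not.2 h.pos.1)
    have i1 : ∀ s, M.e (Sum.inl (M.rot (M.rot d))) = Sum.inl s →
        (Sum.inl s ∈ O ↔ M.e (Sum.inl s) ∉ O) := by
      intro s hs
      rw [← hs, M.e_invol]
      exact iff_of_true h.pos.1 g
    obtain ⟨i2, i3⟩ := ih g i0 i1
    refine ⟨?_, fun x hx => i3 x (Or.inr hx)⟩
    rintro s ((rfl | rfl | rfl) | hs)
    exacts [h1 _ a, i3 _ (Or.inl rfl), i0, i2 s hs]
  | app r d S₁ S₂ B₁ B₂ a b c e f g _ _ _ h h' ih ih' =>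
    have i0 : Sum.inl (M.rot (M.rot d)) ∈ O ↔ M.e (Sum.inl (M.rot (M.rot d))) ∉ O :=
      iff_of_false g (not_not.2 h.pos.1)
    have i1 : ∀ s, M.e (Sum.inl (M.rot (M.rot d))) = Sum.inl s →
        (Sum.inl s ∈ O ↔ M.e (Sum.inl s) ∉ O) := by
      intro s hs
      rw [← hs, M.e_invol]
      exact iff_of_true h.pos.1 g
    have j0 : Sum.inl (M.rot d) ∈ O ↔ M.e (Sum.inl (M.rot d)) ∉ O :=
      iff_of_false f (not_not.2 h'.pos.1)
    have j1 : ∀ s, M.e (Sum.inl (M.rot d)) = Sum.inl s →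
        (Sum.inl s ∈ O ↔ M.e (Sum.inl s) ∉ O) := by
      intro s hs
      rw [← hs, M.e_invol]
      exact iff_of_true h'.pos.1 f
    obtain ⟨i2, i3⟩ := ih g i0 i1
    obtain ⟨j2, j3⟩ := ih' f j0 j1
    constructor
    · rintro s ((rfl | rfl | rfl) | hs | hs)
      exacts [h1 _ a, j0, i0, i2 s hs, j2 s hs]
    · rintro x (hx | hx)
      exacts [i3 x hx, j3 x hx]

theorem TopologicalAt.well {O : Set (M.D ⊕ B)} {S : Set M.D} {r : M.D ⊕ B}
    {B' : Set (M.D ⊕ B)} (h : TopologicalAt M O S r B') : ∀ d ∈ S, M.rot d ≠ d →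
      ∃ a b, M.rot.SameCycle d a ∧ M.rot.SameCycle d b ∧ Sum.inl a ∈ O ∧ Sum.inl b ∉ O := by
  have c1 : ∀ d, M.rot.SameCycle d (M.rot d) := fun d => ⟨1, rfl⟩
  induction h with
  | edge => simp
  | unit r d a b c =>
    rintro s rfl hs
    exact absurd b hs
  | glue r d S B' a b c e f g h ih =>
    rintro s ((rfl | rfl) | hs)
    · exact fun _ => ⟨_, _, .refl _ _, c1 _, e, f⟩
    · exact fun _ => ⟨_, _, (c1 _).symm, .refl _ _, e, f⟩
    · exact ih s hs
  | lam r d S B' a b c e f g _ _ h ih =>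
    rintro s ((rfl | rfl | rfl) | hs)
    · exact fun _ => ⟨_, _, .refl _ _, (c1 _).trans (c1 _), e, g⟩
    · exact fun _ => ⟨_, _, .refl _ _, c1 _, f, g⟩
    · exact fun _ => ⟨_, _, (c1 _).symm, .refl _ _, f, g⟩
    · exact ih s hs
  | app r d S₁ S₂ B₁ B₂ a b c e f g _ _ _ h h' ih ih' =>
    rintro s ((rfl | rfl | rfl) | hs | hs)
    · exact fun _ => ⟨_, _, .refl _ _, c1 _, e, f⟩
    · exact fun _ => ⟨_, _, (c1 _).symm, .refl _ _, e, f⟩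
    · exact fun _ => ⟨_, _, ((c1 _).trans (c1 _)).symm, .refl _ _, e, g⟩
    · exact ih s hs
    · exact ih' s hs

end Existence

/-- Connectedness of the map is reachability of every arc from the root when all vertices may be
used; what is left as boundary is then exactly the non-root boundary. -/
theorem RootedMap.exists_isTopological {n : ℕ} (M : RootedMap n) :
    ∃ o : Orientation M.toOpenMap, M.IsTopological o := by
  have hu : RotClosed M.toOpenMap Set.univ := fun _ _ => Set.mem_univ _
  have hall : ∀ x, Reach M.toOpenMap Set.univ (Sum.inr 0) x := by
    have : ∀ x y, Relation.EqvGen M.Adj x y → (Reach M.toOpenMap Set.univ (Sum.inr 0) x ↔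
        Reach M.toOpenMap Set.univ (Sum.inr 0) y) := by
      intro x y h
      induction h with
      | rel x y h =>
        cases h with
        | edge x => exact ⟨fun h => h.edge, fun h => h.of_edge⟩
        | vertex d => exact ⟨fun h => h.vertex _ trivial,
            fun h => h.of_rot hu trivial⟩
      | refl => rfl
      | symm _ _ _ ih => exact ih.symm
      | trans _ _ _ _ _ ih1 ih2 => exact ih1.trans ih2
    exact fun x => (this _ x (M.connected _ _)).1 .root
  obtain ⟨O, hO, h⟩ := exists_topologicalAt M.toOpenMap Set.univ (Sum.inr 0) hu
    (by simp) (fun d _ => hall _)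
  have hb : bdry M.toOpenMap Set.univ (Sum.inr 0) =
      {x | ∃ i : Fin (n + 1), i ≠ 0 ∧ x = Sum.inr i} := by
    ext x
    rcases x with d | i <;> simp [hall]
  obtain ⟨h1, h2, h3⟩ := h.alternate fun h => (hO _ h).2 rfl
  refine ⟨⟨O, ?_, fun d => h.well d trivial⟩, h.cast rfl hb⟩
  rintro (d | i)
  · exact h2 d trivial
  · by_cases hi : i = 0
    · subst hi
      exact h1
    · exact h3 _ (hb ▸ ⟨i, hi, rfl⟩)

end ImploidMoves


namespace ImploidMoves

/-! ### Genus of a pair of permutations -/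

section Genus

open Equiv Equiv.Perm

variable {α : Type}

/-- The equivalence relation generated by one pair. -/
abbrev pairSetoid (a b : α) : Setoid α := Relation.EqvGen.setoid fun x y => x = a ∧ y = b

/-- The equivalence relation whose classes are the cycles of a permutation. -/
abbrev orb (σ : Perm α) : Setoid α := SameCycle.setoid σ

/-- The number of classes. -/
noncomputable abbrev numClasses (s : Setoid α) : ℕ := Nat.card (Quotient s)

theorem pairSetoid_le {a b : α} {s : Setoid α} : pairSetoid a b ≤ s ↔ s a b := by
  constructor
  · exact fun h => h (.rel _ _ ⟨rfl, rfl⟩)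
  · intro h
    refine Setoid.eqvGen_le ?_
    rintro _ _ ⟨rfl, rfl⟩
    exact h

theorem orb_le {σ : Perm α} {s : Setoid α} (h : ∀ x, s x (σ x)) : orb σ ≤ s := by
  have h' : ∀ x, s (σ⁻¹ x) x := fun x => by simpa using h (σ⁻¹ x)
  rintro x _ ⟨i, rfl⟩
  induction i with
  | zero => exact s.refl x
  | succ i ih =>
    rw [add_comm, zpow_add, zpow_one]
    exact s.trans ih (h _)
  | pred i ih =>
    rw [sub_eq_neg_add, zpow_add, zpow_neg_one]
    exact s.trans ih (s.symm (h' _))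

theorem orb_inv (σ : Perm α) : orb σ⁻¹ = orb σ := by
  ext x y
  exact sameCycle_inv

theorem numOrbits_inv (σ : Perm α) : numOrbits σ⁻¹ = numOrbits σ := by
  change numClasses (orb _) = numClasses (orb _)
  rw [orb_inv]

theorem orb_apply (σ : Perm α) (x : α) : orb σ x (σ x) := ⟨1, rfl⟩

theorem sup_pairSetoid_of_rel {s : Setoid α} {a b : α} (h : s a b) : s ⊔ pairSetoid a b = s :=
  sup_eq_left.2 (pairSetoid_le.2 h)

/-- The function `f` redirects the class of `b` to that of `a`. Its kernel is the join, and its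
range omits exactly one class. -/
theorem numClasses_sup_pairSetoid [Finite α] {s : Setoid α} {a b : α} (h : ¬ s a b) :
    numClasses (s ⊔ pairSetoid a b) + 1 = numClasses s := by
  classical
  let f : α → Quotient s := fun x => if s x b then ⟦a⟧ else ⟦x⟧
  have hJ : (s ⊔ pairSetoid a b) a b := pairSetoid_le.1 le_sup_right
  have hs : ∀ {x y}, s x y → (s ⊔ pairSetoid a b) x y := fun h => le_sup_left (a := s) h
  have hf : ∀ x z, f x = ⟦z⟧ → (s ⊔ pairSetoid a b) x z := by
    intro x z hz
    by_cases hx : s x b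
    · simp only [f, hx, if_true] at hz
      exact Setoid.trans' _ (hs hx) (Setoid.trans' _ (Setoid.symm' _ hJ) (hs (Quotient.exact hz)))
    · simp only [f, hx, if_false] at hz
      exact hs (Quotient.exact hz)
  have hker : s ⊔ pairSetoid a b = Setoid.ker f := by
    refine le_antisymm (sup_le ?_ ?_) ?_
    · intro x y hxy
      have : s x b ↔ s y b := ⟨fun h => s.trans (s.symm hxy) h, fun h => s.trans hxy h⟩
      by_cases hx : s x b
      · simp [Setoid.ker_def, f, hx, this.1 hx]
      · simpa [Setoid.ker_def, f, hx, this.not.1 hx] using Quotient.sound hxy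
    · rw [pairSetoid_le, Setoid.ker_def]
      simp [f]
    · intro x y hxy
      obtain ⟨z, hz⟩ := Quotient.exists_rep (f x)
      exact Setoid.trans' _ (hf x z hz.symm) (Setoid.symm' _ (hf y z (hxy.symm.trans hz.symm)))
  have hrange : Set.range f = {⟦b⟧}ᶜ := by
    ext q
    obtain ⟨z, rfl⟩ := Quotient.exists_rep q
    simp only [Set.mem_range, Set.mem_compl_iff, Set.mem_singleton_iff]
    constructor
    · rintro ⟨x, hx⟩ hz
      rw [hz] at hx
      by_cases hxb : s x b
      · simp only [f, hxb, if_true] at hx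
        exact h (Quotient.exact hx)
      · simp only [f, hxb, if_false] at hx
        exact hxb (Quotient.exact hx)
    · intro hz
      exact ⟨z, by simp only [f, show ¬ s z b from fun h => hz (Quotient.sound h), if_false]⟩
  rw [numClasses, hker, Nat.card_congr (Setoid.quotientKerEquivRange f), hrange,
    numClasses, ← Set.ncard_add_ncard_compl ({⟦b⟧} : Set (Quotient s)), Set.ncard_singleton, add_comm]
  rfl

theorem exists_first_return [Finite α] (σ : Perm α) (a b : α) :
    ∃ n, 0 < n ∧ ((σ ^ n) a = a ∨ (σ ^ n) a = b) ∧
      ∀ k, 0 < k → k < n → (σ ^ k) a ≠ a ∧ (σ ^ k) a ≠ b := by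
  classical
  have hex : ∃ n, 0 < n ∧ ((σ ^ n) a = a ∨ (σ ^ n) a = b) :=
    ⟨orderOf σ, orderOf_pos σ, Or.inl (by rw [pow_orderOf_eq_one]; rfl)⟩
  refine ⟨Nat.find hex, (Nat.find_spec hex).1, (Nat.find_spec hex).2, fun k hk hk' => ?_⟩
  have := Nat.find_min hex hk'
  tauto

/-- The orbit has returned to `a` after `n` steps, so exponents may be reduced modulo `n`, and `b`
was not met before. -/
theorem not_sameCycle_of_first_return [Finite α] {σ : Perm α} {a b : α} (hab : a ≠ b) {n : ℕ}
    (hn : 0 < n) (h : (σ ^ n) a = a) (hb : ∀ k, 0 < k → k < n → (σ ^ k) a ≠ b) :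
    ¬ σ.SameCycle a b := by
  intro hs
  obtain ⟨i, hi⟩ := hs.exists_nat_pow_eq
  have hmod : (σ ^ (i % n)) a = b := by
    have hper : Function.IsPeriodicPt σ n a := by
      rw [Function.IsPeriodicPt, Function.IsFixedPt, ← coe_pow]
      exact h
    have := hper.iterate_mod_apply i
    rw [← coe_pow, ← coe_pow] at this
    exact this.trans hi
  rcases Nat.eq_zero_or_pos (i % n) with h0 | h0
  · rw [h0] at hmod
    exact hab hmod
  · exact hb _ h0 (Nat.mod_lt _ hn) hmod

/-! ### Multiplication of a permutation by a transposition -/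

section Swap

variable [DecidableEq α]

/-- Once `a` and `b` are identified, the transposition is invisible. One inclusion suffices, as
multiplying by it twice changes nothing. -/
theorem orb_mul_swap_sup (σ : Perm α) (a b : α) :
    orb (σ * swap a b) ⊔ pairSetoid a b = orb σ ⊔ pairSetoid a b := by
  have key : ∀ ρ : Perm α, orb (ρ * swap a b) ≤ orb ρ ⊔ pairSetoid a b := by
    intro ρ
    have hp : (orb ρ ⊔ pairSetoid a b) a b := pairSetoid_le.1 le_sup_right
    refine orb_le fun x => ?_
    have h1 : (orb ρ ⊔ pairSetoid a b) (swap a b x) ((ρ * swap a b) x) :=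
      le_sup_left (a := orb ρ) (orb_apply ρ _)
    refine Setoid.trans' _ ?_ h1
    by_cases hx : x = a
    · rw [hx, swap_apply_left]
      exact hp
    · by_cases hx' : x = b
      · rw [hx', swap_apply_right]
        exact Setoid.symm' _ hp
      · rw [swap_apply_of_ne_of_ne hx hx']
  refine le_antisymm (sup_le (key σ) le_sup_right) (sup_le ?_ le_sup_right)
  have := key (σ * swap a b)
  rwa [mul_assoc, swap_mul_self, mul_one] at this

/-- The new cycle of `b` follows the old one of `a` up to its first return to the set of `a` and
`b`. If that return is at `a`, the points were in different cycles, which are now merged; if it is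
at `b`, the new cycle closes without meeting `a`. -/
theorem sameCycle_mul_swap [Finite α] (σ : Perm α) {a b : α} (hab : a ≠ b) :
    (σ * swap a b).SameCycle a b ↔ ¬ σ.SameCycle a b := by
  obtain ⟨n, hn, h1, h2⟩ := exists_first_return σ a b
  have hpow : ∀ k, 0 < k → k ≤ n → ((σ * swap a b) ^ k) b = (σ ^ k) a := by
    intro k hk hkn
    induction k, hk using Nat.le_induction with
    | base => simp
    | succ k hk ih =>
      have h3 := h2 k hk hkn
      rw [pow_succ', Perm.mul_apply, ih (Nat.le_of_succ_le hkn), pow_succ', Perm.mul_apply,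
        Perm.mul_apply, swap_apply_of_ne_of_ne h3.1 h3.2]
  rcases h1 with h1 | h1
  · refine iff_of_true (SameCycle.symm ⟨n, ?_⟩) ?_
    · rw [zpow_natCast, hpow n hn le_rfl, h1]
    · exact not_sameCycle_of_first_return hab hn h1 fun k hk hk' => (h2 k hk hk').2
  · refine iff_of_false (fun h => ?_) (not_not.2 ⟨n, by rw [zpow_natCast, h1]⟩)
    refine not_sameCycle_of_first_return hab.symm hn ((hpow n hn le_rfl).trans h1)
      (fun k hk hk' => ?_) h.symm
    rw [hpow k hk hk'.le]
    exact (h2 k hk hk').1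

theorem numOrbits_mul_swap_of_sameCycle [Finite α] {σ : Perm α} {a b : α} (hab : a ≠ b)
    (h : σ.SameCycle a b) : numOrbits (σ * swap a b) = numOrbits σ + 1 := by
  have h1 : ¬ orb (σ * swap a b) a b := fun h' => (sameCycle_mul_swap σ hab).1 h' h
  have h2 := numClasses_sup_pairSetoid h1
  rw [orb_mul_swap_sup, sup_pairSetoid_of_rel (s := orb σ) h] at h2
  exact h2.symm

theorem numOrbits_mul_swap_of_not_sameCycle [Finite α] {σ : Perm α} {a b : α}
    (h : ¬ σ.SameCycle a b) : numOrbits (σ * swap a b) + 1 = numOrbits σ := by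
  have hab : a ≠ b := by
    rintro rfl
    exact h (.refl _ _)
  have h1 : (σ * swap a b).SameCycle a b := (sameCycle_mul_swap σ hab).2 h
  have := numOrbits_mul_swap_of_sameCycle hab h1
  rw [mul_assoc, swap_mul_self, mul_one] at this
  exact this.symm

theorem orb_swap_mul_sup (σ : Perm α) (a b : α) :
    orb (swap a b * σ) ⊔ pairSetoid a b = orb σ ⊔ pairSetoid a b := by
  have := orb_mul_swap_sup σ⁻¹ a b
  rwa [← orb_inv, mul_inv_rev, swap_inv, inv_inv, orb_inv] at this

theorem sameCycle_swap_mul [Finite α] (σ : Perm α) {a b : α} (hab : a ≠ b) :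
    (swap a b * σ).SameCycle a b ↔ ¬ σ.SameCycle a b := by
  have := sameCycle_mul_swap σ⁻¹ hab
  rwa [← sameCycle_inv, mul_inv_rev, swap_inv, inv_inv, sameCycle_inv] at this

theorem numOrbits_swap_mul_of_sameCycle [Finite α] {σ : Perm α} {a b : α} (hab : a ≠ b)
    (h : σ.SameCycle a b) : numOrbits (swap a b * σ) = numOrbits σ + 1 := by
  have := numOrbits_mul_swap_of_sameCycle hab (sameCycle_inv.2 h)
  rwa [← numOrbits_inv, mul_inv_rev, swap_inv, inv_inv, numOrbits_inv] at this

theorem numOrbits_swap_mul_of_not_sameCycle [Finite α] {σ : Perm α} {a b : α}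
    (h : ¬ σ.SameCycle a b) : numOrbits (swap a b * σ) + 1 = numOrbits σ := by
  have := numOrbits_mul_swap_of_not_sameCycle (mt sameCycle_inv.1 h)
  rwa [← numOrbits_inv, mul_inv_rev, swap_inv, inv_inv, numOrbits_inv] at this

end Swap

theorem numOrbits_one : numOrbits (1 : Perm α) = Nat.card α := by
  refine Nat.card_congr (Equiv.ofBijective (Quotient.mk (orb 1)) ⟨fun x y h => ?_,
    Quotient.mk_surjective⟩).symm
  exact sameCycle_one.1 (Quotient.exact h)

theorem orb_one : orb (1 : Perm α) = ⊥ := by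
  ext x y
  exact sameCycle_one

theorem orb_mul_le (σ τ : Perm α) : orb (τ * σ) ≤ orb σ ⊔ orb τ :=
  orb_le fun x => Setoid.trans' _ (le_sup_left (a := orb σ) (orb_apply σ x))
    (le_sup_right (a := orb σ) (orb_apply τ (σ x)))

/-- Nonnegativity of the genus, for maps that may be disconnected and whose edge permutation need
not be an involution. Transpositions are split off from `τ`, by induction on the size of its
support. -/
theorem numOrbits_add_le [Finite α] (σ τ : Perm α) :
    numOrbits σ + numOrbits τ + numOrbits (τ * σ) ≤
      Nat.card α + 2 * numClasses (orb σ ⊔ orb τ) := by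
  classical
  have := Fintype.ofFinite α
  induction h : τ.support.card using Nat.strong_induction_on generalizing τ with
  | _ k ih =>
    by_cases h1 : τ = 1
    · rw [h1, orb_one, sup_bot_eq, one_mul, numOrbits_one]
      change numClasses (orb σ) + _ + numClasses (orb σ) ≤ _
      omega
    · obtain ⟨x, hx⟩ : ∃ x, τ x ≠ x := by
        by_contra! hc
        exact h1 (Equiv.ext hc)
      set τ₁ := swap x (τ x) * τ with hτ₁
      have hτ : τ = swap x (τ x) * τ₁ := by rw [hτ₁, ← mul_assoc, swap_mul_self, one_mul]
      have h2 := ih _ (h ▸ card_support_swap_mul hx) τ₁ rfl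
      have hab : x ≠ τ x := hx.symm
      have h3 : ¬ τ₁.SameCycle x (τ x) := by
        rw [hτ₁, sameCycle_swap_mul τ hab, not_not]
        exact orb_apply τ x
      have h4 : numOrbits τ + 1 = numOrbits τ₁ := by
        have := numOrbits_swap_mul_of_not_sameCycle h3
        rwa [← hτ] at this
      have h5 : orb σ ⊔ orb τ = (orb σ ⊔ orb τ₁) ⊔ pairSetoid x (τ x) := by
        rw [sup_assoc, hτ₁, orb_swap_mul_sup, sup_pairSetoid_of_rel (orb_apply τ x)]
      have h6 : τ * σ = swap x (τ x) * (τ₁ * σ) := by rw [← mul_assoc, ← hτ]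
      by_cases h7 : (orb σ ⊔ orb τ₁) x (τ x)
      -- Within a component: `τ` has one cycle less than `τ₁`, and the number of faces grows by at
      -- most one.
      · rw [h5, sup_pairSetoid_of_rel h7]
        have h8 : numOrbits (τ * σ) ≤ numOrbits (τ₁ * σ) + 1 := by
          rw [h6]
          by_cases h9 : (τ₁ * σ).SameCycle x (τ x)
          · exact (numOrbits_swap_mul_of_sameCycle hab h9).le
          · have := numOrbits_swap_mul_of_not_sameCycle h9
            omega
        omega
      -- Between components: one component, one cycle of `τ` and one face are lost, so both sides
      -- decrease by two.
      · have h8 := numClasses_sup_pairSetoid h7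
        rw [← h5] at h8
        have h9 := numOrbits_swap_mul_of_not_sameCycle (σ := τ₁ * σ)
          (fun h => h7 (orb_mul_le σ τ₁ h))
        rw [← h6] at h9
        omega

/-- The map with vertex permutation `σ` and edge permutation `τ` has genus zero. -/
def GenusZero (σ τ : Perm α) : Prop :=
  numOrbits σ + numOrbits τ + numOrbits (τ * σ) = Nat.card α + 2 * numClasses (orb σ ⊔ orb τ)

variable [DecidableEq α]

/-- Cutting a vertex at two corners of the same face adds one vertex and one face. As the genus
cannot become negative, the number of components must grow too, so the two corners are separated. -/
theorem GenusZero.split [Finite α] {σ τ : Perm α} (h : GenusZero σ τ) {x y : α} (hxy : x ≠ y)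
    (h1 : σ.SameCycle x y) (h2 : (τ * σ).SameCycle x y) :
    GenusZero (σ * swap x y) τ ∧ ¬ (orb (σ * swap x y) ⊔ orb τ) x y := by
  have h3 := numOrbits_mul_swap_of_sameCycle hxy h1
  have h4 := numOrbits_mul_swap_of_sameCycle hxy h2
  rw [mul_assoc] at h4
  have h5 := numOrbits_add_le (σ * swap x y) τ
  have h6 : orb σ ⊔ orb τ = (orb (σ * swap x y) ⊔ orb τ) ⊔ pairSetoid x y := by
    rw [sup_right_comm, orb_mul_swap_sup, sup_pairSetoid_of_rel (s := orb σ) h1]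
  unfold GenusZero at h ⊢
  by_cases h7 : (orb (σ * swap x y) ⊔ orb τ) x y
  · rw [sup_pairSetoid_of_rel h7] at h6
    rw [h6] at h
    omega
  · refine ⟨?_, h7⟩
    have := numClasses_sup_pairSetoid h7
    rw [← h6] at this
    omega

/-- The two transpositions cancel in the face permutation. Vertices decrease and cycles of the edge
permutation increase by one, while the components stay the same. -/
theorem GenusZero.merge [Finite α] {σ τ : Perm α} (h : GenusZero σ τ) {x y : α}
    (h1 : ¬ σ.SameCycle x y) (h2 : τ.SameCycle x y) :
    GenusZero (swap x y * σ) (τ * swap x y) := by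
  have hxy : x ≠ y := by
    rintro rfl
    exact h1 (.refl _ _)
  have h3 := numOrbits_swap_mul_of_not_sameCycle h1
  have h4 := numOrbits_mul_swap_of_sameCycle hxy h2
  have h5 : orb (swap x y * σ) ⊔ orb (τ * swap x y) = orb σ ⊔ orb τ := by
    rw [← sup_pairSetoid_of_rel (s := orb (swap x y * σ)) ((sameCycle_swap_mul σ hxy).2 h1),
      ← sup_pairSetoid_of_rel (s := orb τ) h2, orb_swap_mul_sup, ← orb_mul_swap_sup τ,
      sup_right_comm, sup_assoc]
  unfold GenusZero at h ⊢
  rw [h5, mul_assoc, ← mul_assoc (swap x y), swap_mul_self, one_mul]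
  omega

/-- Removal of a point from its cycle. -/
theorem GenusZero.remove [Finite α] {σ τ : Perm α} (h : GenusZero σ τ) {p : α} (hp : τ p = p) :
    ∃ ρ : Perm α, GenusZero ρ τ ∧ ∀ x, x ≠ p → ρ x = if σ x = p then σ p else σ x := by
  by_cases h1 : σ p = p
  · refine ⟨σ, h, fun x hx => ?_⟩
    have : σ x ≠ p := fun h => hx (σ.injective (h.trans h1.symm))
    rw [if_neg this]
  · have h2 : σ⁻¹ p ≠ p := fun h => h1 (inv_eq_iff_eq.1 h).symm
    have h3 : σ (σ⁻¹ p) = p := by simp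
    -- Since `τ` fixes `p`, both `σ` and the face permutation send `σ⁻¹ p` to `p`, so `p` may be cut
    -- off from its vertex.
    refine ⟨σ * swap (σ⁻¹ p) p, (h.split h2 ⟨1, by simp⟩ ⟨1, by simp [hp]⟩).1, fun x hx => ?_⟩
    by_cases h4 : σ x = p
    · have : x = σ⁻¹ p := by rw [← h4]; simp
      rw [if_pos h4, this, Perm.mul_apply, swap_apply_left]
    · have : x ≠ σ⁻¹ p := fun h => h4 (by rw [h, h3])
      rw [if_neg h4, Perm.mul_apply, swap_apply_of_ne_of_ne this hx]

/-- Contraction of an edge. -/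
theorem GenusZero.contract [Finite α] {σ τ : Perm α} (h : GenusZero σ τ) {r d : α}
    (h1 : ¬ σ.SameCycle r d) (h2 : τ r = d) (h3 : τ d = r) (h4 : σ d ≠ d) :
    ∃ ρ : Perm α, GenusZero ρ (τ * swap r d) ∧ ∀ x, x ≠ r → x ≠ d → ρ x =
      if σ x = r then σ d else if σ x = d then (if σ r = r then σ d else σ r) else σ x := by
  have hrd : r ≠ d := by
    rintro rfl
    exact h1 (.refl _ _)
  -- The ends of the edge are merged into one vertex. Both darts of the edge are then fixed by the
  -- edge permutation and are removed one after the other.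
  have h5 := h.merge h1 ⟨1, by simpa using h2⟩
  obtain ⟨ρ, h6, h7⟩ := h5.remove (p := d) (by simp [h2])
  obtain ⟨ρ', h8, h9⟩ := h6.remove (p := r) (by simp [h3])
  refine ⟨ρ', h8, fun x hx hx' => ?_⟩
  have h10 : σ d ≠ r := fun h => h1 (SameCycle.symm ⟨1, by simpa using h⟩)
  have h11 : σ r ≠ d := fun h => h1 ⟨1, by simpa using h⟩
  have h12 : swap r d (σ d) = σ d := swap_apply_of_ne_of_ne h10 h4
  have h13 : ∀ y, swap r d y = d ↔ y = r := by
    intro y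
    exact ⟨fun h => (swap r d).injective (h.trans (swap_apply_left r d).symm),
      fun h => h ▸ swap_apply_left r d⟩
  have h14 : ρ r = if σ r = r then σ d else σ r := by
    rw [h7 r hrd]
    simp only [Perm.mul_apply, h12, h13]
    split_ifs with h
    · rfl
    · exact swap_apply_of_ne_of_ne h h11
  have h15 : ρ x = if σ x = r then σ d else swap r d (σ x) := by
    rw [h7 x hx']
    simp only [Perm.mul_apply, h12, h13]
  rw [h9 x hx, h15, h14]
  by_cases h16 : σ x = r
  · simp [h16, h10]
  · by_cases h17 : σ x = d
    · simp [h17, hrd.symm]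
    · have : swap r d (σ x) = σ x := swap_apply_of_ne_of_ne h16 h17
      simp [h16, h17, this]

end Genus

end ImploidMoves


namespace ImploidMoves

/-! ### Paths of a permutation -/

section Paths

open Equiv Equiv.Perm

variable {α : Type}

/-- Consecutive elements of the list are consecutive elements of a cycle. -/
abbrev Path (σ : Perm α) (l : List α) : Prop := l.IsChain fun a b => σ a = b

theorem Path.congr {σ ρ : Perm α} {l : List α} {q : α} (h : Path σ (l ++ [q]))
    (hρ : ∀ z ∈ l, ρ z = σ z) : Path ρ (l ++ [q]) := by
  induction l with
  | nil => exact .singleton _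
  | cons a l ih =>
    have ih := ih (List.IsChain.tail h) fun z hz => hρ z (List.mem_cons_of_mem _ hz)
    rw [List.cons_append, Path, List.isChain_cons] at h ⊢
    exact ⟨fun y hy => (hρ a List.mem_cons_self).trans (h.1 y hy), ih⟩

theorem Path.sameCycle {σ : Perm α} {a z : α} {l : List α} (h : Path σ (a :: l)) (hz : z ∈ a :: l) :
    σ.SameCycle a z := by
  induction l generalizing a with
  | nil => rw [List.mem_singleton.1 hz]
  | cons b l ih =>
    rw [Path, List.isChain_cons_cons] at h
    rcases List.mem_cons.1 hz with rfl | hz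
    · rfl
    · exact SameCycle.trans ⟨1, h.1⟩ (ih h.2 hz)

theorem Path.apply_mem {σ : Perm α} {a b z : α} {l : List α} (h : Path σ (a :: l ++ [b]))
    (hz : z ∈ a :: l) : σ z ∈ l ++ [b] := by
  induction l generalizing a with
  | nil =>
    rw [List.mem_singleton.1 hz]
    simpa using h
  | cons c l ih =>
    simp only [List.cons_append, Path, List.isChain_cons_cons] at h
    rcases List.mem_cons.1 hz with rfl | hz
    · simp [h.1]
    · exact List.mem_cons_of_mem _ (ih h.2 hz)

theorem Path.mem_of_sameCycle [Finite α] {σ : Perm α} {a z : α} {l : List α}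
    (h : Path σ (a :: l ++ [a])) (hz : σ.SameCycle a z) : z ∈ a :: l := by
  obtain ⟨i, rfl⟩ := hz.exists_nat_pow_eq
  induction i with
  | zero => simp
  | succ i ih =>
    rw [pow_succ', Perm.mul_apply]
    have := h.apply_mem (ih ⟨i, rfl⟩)
    simp only [List.mem_append, List.mem_singleton] at this
    simp only [List.mem_cons]
    tauto

/-- A cycle that enters `P` from `x` must leave it again, because it returns to `x`. -/
theorem exists_exit [Finite α] (φ : Perm α) {P : Set α} {x : α} (hx : x ∉ P) (hφ : φ x ∈ P) :
    ∃ y ∈ P, φ.SameCycle x y ∧ φ y ∉ P := by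
  by_contra! hc
  have h1 : ∀ k : ℕ, (φ ^ (k + 1)) x ∈ P := by
    intro k
    induction k with
    | zero => simpa using hφ
    | succ k ih =>
      rw [pow_succ', Perm.mul_apply]
      exact hc _ ih ⟨(k + 1 : ℕ), by rw [zpow_natCast]⟩
  have h2 := h1 (orderOf φ - 1)
  rw [Nat.sub_add_cancel (orderOf_pos φ), pow_orderOf_eq_one] at h2
  exact hx h2

/-- The boundary cycle is opened at `r` and inserted at the place of `D` in its own cycle, between
the predecessor `q` and the successor of `D`. -/
theorem Path.contract [DecidableEq α] {σ ρ : Perm α} {r D q : α} {Γ : List α} (h : Path σ (r :: Γ ++ [r]))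
    (hrD : r ≠ D) (hr : r ∉ Γ) (hD : D ∉ Γ) (hq : σ q = D) (hqr : q ≠ r) (hqD : q ≠ D)
    (hρ : ∀ x, x ≠ r → x ≠ D → ρ x =
      if σ x = r then σ D else if σ x = D then (if σ r = r then σ D else σ r) else σ x) :
    Path ρ (q :: Γ ++ [σ D]) := by
  have key : ∀ (Γ : List α) (a : α), a ≠ r → a ≠ D → r ∉ Γ → D ∉ Γ → Path σ (a :: Γ ++ [r]) →
      Path ρ (a :: Γ ++ [σ D]) := by
    intro Γ
    induction Γ with
    | nil =>
      intro a h1 h2 _ _ h3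
      simp only [List.cons_append, List.nil_append, Path, List.isChain_pair] at h3 ⊢
      rw [hρ a h1 h2, if_pos h3]
    | cons b Γ ih =>
      intro a h1 h2 h4 h5 h3
      simp only [List.cons_append, Path, List.isChain_cons_cons, List.mem_cons, not_or] at h3 h4 h5 ⊢
      refine ⟨?_, ih b (Ne.symm h4.1) (Ne.symm h5.1) h4.2 h5.2 h3.2⟩
      rw [hρ a h1 h2, h3.1, if_neg (Ne.symm h4.1), if_neg (Ne.symm h5.1)]
  have h0 : ρ q = if σ r = r then σ D else σ r := by
    rw [hρ q hqr hqD, hq, if_neg hrD.symm, if_pos rfl]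
  cases Γ with
  | nil =>
    simp only [List.cons_append, List.nil_append, Path, List.isChain_pair] at h ⊢
    rw [h0, if_pos h]
  | cons b Γ =>
    simp only [List.cons_append, Path, List.isChain_cons_cons, List.mem_cons, not_or] at h hr hD ⊢
    refine ⟨?_, key Γ b (Ne.symm hr.1) (Ne.symm hD.1) hr.2 hD.2 h.2⟩
    rw [h0, h.1, if_neg (Ne.symm hr.1)]

/-- In genus zero, the cycle of a vertex whose removal disconnects the map is a concatenation of
two intervals. -/
theorem GenusZero.split_path [Finite α] {σ τ : Perm α} (h : GenusZero σ τ) {X₁ X₂ : Set α}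
    {a b : α} {Γ : List α} (ha : a ∈ X₁) (hb : b ∈ X₂) (hΓ : ∀ x ∈ Γ, x ∈ X₁ ∨ x ∈ X₂)
    (hX : ∀ x ∈ X₁, x ∉ X₂) (hnd : (a :: Γ ++ [b]).Nodup) (hp : Path σ (a :: Γ ++ [b, a]))
    (hτ : ∀ x ∈ X₂, τ x ∈ X₂)
    (hσ : ∀ x ∈ X₂, x ∉ a :: Γ ++ [b] → σ x ∈ X₂)
    (hc₁ : ∀ J : Setoid α, (∀ x ∈ X₁, J x (τ x)) →
      (∀ x ∈ X₁, x ∉ a :: Γ ++ [b] → J x (σ x)) → ∀ x ∈ X₁, J a x)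
    (hc₂ : ∀ J : Setoid α, (∀ x ∈ X₂, J x (τ x)) →
      (∀ x ∈ X₂, x ∉ a :: Γ ++ [b] → J x (σ x)) → ∀ x ∈ X₂, J b x) :
    ∃ (Γ₁ Γ₂ : List α) (ρ : Perm α), Γ = Γ₁ ++ Γ₂ ∧ (∀ x ∈ Γ₁, x ∈ X₁) ∧ (∀ x ∈ Γ₂, x ∈ X₂) ∧
      GenusZero ρ τ ∧ Path ρ (a :: Γ₁ ++ [a]) ∧ Path ρ (b :: Γ₂ ++ [b]) ∧
      ∀ x, x ∉ a :: Γ ++ [b] → ρ x = σ x := by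
  classical
  -- The list `Γ₁` is the longest initial segment inside `X₁`; what follows, up to and including
  -- `b`, begins in `X₂`.
  obtain ⟨Γ₁, Γ₂, rfl, h1, h2⟩ : ∃ Γ₁ Γ₂, Γ = Γ₁ ++ Γ₂ ∧ (∀ x ∈ Γ₁, x ∈ X₁) ∧
      ∀ c m, Γ₂ ++ [b] = c :: m → c ∈ X₂ := by
    refine ⟨Γ.takeWhile (· ∈ X₁), Γ.dropWhile (· ∈ X₁), List.takeWhile_append_dropWhile.symm,
      fun x hx => by simpa using List.mem_takeWhile_imp hx, ?_⟩
    intro c m hcm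
    rcases hΔ : Γ.dropWhile (· ∈ X₁) with _ | ⟨c', m'⟩
    · rw [hΔ] at hcm
      simp only [List.nil_append, List.cons.injEq] at hcm
      rwa [← hcm.1]
    · have h3 := List.head_dropWhile_not (p := (· ∈ X₁)) (l := Γ) (w := by simp [hΔ])
      simp only [hΔ, List.head_cons, decide_eq_false_iff_not] at h3
      have h4 : c' ∈ Γ := (List.dropWhile_suffix (p := (· ∈ X₁)) (l := Γ)).subset (by simp [hΔ])
      rw [hΔ] at hcm
      simp only [List.cons_append, List.cons.injEq] at hcm
      rw [← hcm.1]
      exact (hΓ c' h4).resolve_left h3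
  obtain ⟨l, x, hlx⟩ : ∃ l x, a :: Γ₁ = l ++ [x] := ⟨_, _, (List.dropLast_append_getLast (by simp)).symm⟩
  obtain ⟨c, m, hcm⟩ : ∃ c m, Γ₂ ++ [b] = c :: m := List.exists_cons_of_ne_nil (by simp)
  have hx₁ : x ∈ X₁ := by
    have : x ∈ a :: Γ₁ := by simp [hlx]
    rcases List.mem_cons.1 this with rfl | h3
    · exact ha
    · exact h1 x h3
  have hc₂X : c ∈ X₂ := h2 c m hcm
  have hlist : a :: (Γ₁ ++ Γ₂) ++ [b] = l ++ x :: c :: m := by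
    rw [← hcm, ← List.cons_append, hlx]
    simp
  have hlist' : a :: (Γ₁ ++ Γ₂) ++ [b, a] = l ++ x :: c :: (m ++ [a]) := by
    rw [show [b, a] = [b] ++ [a] from rfl, ← List.append_assoc, hlist]
    simp
  have hp' := hp
  rw [hlist', Path, List.isChain_append_cons_cons] at hp'
  obtain ⟨hp1, hxc, hp2⟩ := hp'
  have hba : σ b = a := by
    have : a :: (Γ₁ ++ Γ₂) ++ [b, a] = (a :: (Γ₁ ++ Γ₂)) ++ b :: a :: [] := by simp
    rw [this, Path, List.isChain_append_cons_cons] at hp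
    exact hp.2.1
  -- The face through the corner after `x` enters `X₂` there and has to leave it after some `y`.
  -- This can only happen on the boundary cycle, as elsewhere the rotation preserves `X₂`.
  obtain ⟨y, hy₂, hxy, hφy⟩ := exists_exit (τ * σ) (hX x hx₁)
    (show (τ * σ) x ∈ X₂ by rw [Perm.mul_apply, hxc]; exact hτ c hc₂X)
  have hσy : σ y ∉ X₂ := fun h3 => hφy (hτ _ h3)
  have hyl : y ∈ a :: (Γ₁ ++ Γ₂) ++ [b] := by
    by_contra h3
    exact hσy (hσ y hy₂ h3)
  have hne : x ≠ y := fun h3 => hX x hx₁ (h3 ▸ hy₂)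
  have hxl : x ∈ a :: (Γ₁ ++ Γ₂) ++ [b] := by simp [hlist]
  have hpl : Path σ (a :: (Γ₁ ++ Γ₂) ++ [b]) := by
    have : a :: (Γ₁ ++ Γ₂) ++ [b, a] = (a :: (Γ₁ ++ Γ₂) ++ [b]) ++ [a] := by simp
    rw [this] at hp
    exact List.IsChain.left_of_append hp
  have hs : σ.SameCycle x y := (hpl.sameCycle hxl).symm.trans (hpl.sameCycle hyl)
  obtain ⟨hg, hJ⟩ := h.split hne hs hxy
  have hρ : ∀ z, z ≠ x → z ≠ y → (σ * swap x y) z = σ z := fun z h3 h4 => by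
    rw [Perm.mul_apply, swap_apply_of_ne_of_ne h3 h4]
  have hJσ : ∀ z, z ≠ x → z ≠ y → (orb (σ * swap x y) ⊔ orb τ) z (σ z) := fun z h3 h4 => by
    rw [← hρ z h3 h4]
    exact le_sup_left (a := orb (σ * swap x y)) (orb_apply _ z)
  have hJτ : ∀ z, (orb (σ * swap x y) ⊔ orb τ) z (τ z) := fun z =>
    le_sup_right (a := orb (σ * swap x y)) (orb_apply τ z)
  have hJl : ∀ z, z ∉ a :: (Γ₁ ++ Γ₂) ++ [b] → (orb (σ * swap x y) ⊔ orb τ) z (σ z) :=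
    fun z hz => hJσ z (fun h3 => hz (h3 ▸ hxl)) fun h3 => hz (h3 ▸ hyl)
  have hJ₁ := hc₁ _ (fun z _ => hJτ z) fun z _ => hJl z
  have hJ₂ := hc₂ _ (fun z _ => hJτ z) fun z _ => hJl z
  -- The cut at `x` and `y` separates them, and each part is connected without the boundary cycle,
  -- so it separates `a` from `b`.
  have hJab : ¬ (orb (σ * swap x y) ⊔ orb τ) a b := fun h3 =>
    hJ (Setoid.trans' _ (Setoid.symm' _ (hJ₁ x hx₁)) (Setoid.trans' _ h3 (hJ₂ y hy₂)))
  rw [hlist] at hnd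
  have hnd2 := hnd
  rw [List.nodup_append, List.nodup_cons, ← hcm] at hnd2
  obtain ⟨-, ⟨hxn, hndm⟩, hdis⟩ := hnd2
  have hsuff : Path σ (Γ₂ ++ [b]) := by
    rw [hcm]
    have := hpl
    rw [hlist, Path, List.isChain_append_cons_cons] at this
    exact this.2.2
  -- If `y` came earlier, its successor would lie in `X₁` and would still be joined to `b` by the
  -- uncut rest of the cycle, contradicting the separation.
  have hyb : y = b := by
    by_contra hyb
    have hy₃ : y ∈ Γ₂ := by
      have : y ∉ a :: Γ₁ := fun h3 => by
        rcases List.mem_cons.1 h3 with h4 | h4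
        · exact hX a ha (h4 ▸ hy₂)
        · exact hX y (h1 y h4) hy₂
      simp only [List.cons_append, List.append_assoc, List.mem_cons, List.mem_append,
        List.not_mem_nil, or_false, not_or] at hyl this
      tauto
    obtain ⟨u, v, huv⟩ := List.append_of_mem hy₃
    obtain ⟨z, w, hzw⟩ : ∃ z w, v ++ [b] = z :: w := List.exists_cons_of_ne_nil (by simp)
    have h3 : Γ₂ ++ [b] = u ++ y :: (v ++ [b]) := by rw [huv]; simp
    rw [h3] at hsuff hndm hxn
    have h4 := hsuff
    rw [hzw, Path, List.isChain_append_cons_cons, ← hzw] at h4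
    have h5 : Path (σ * swap x y) (v ++ [b]) := by
      refine Path.congr h4.2.2 fun t ht => hρ t ?_ ?_
      · rintro rfl
        exact hxn (by simp [ht])
      · rintro rfl
        rw [List.nodup_append, List.nodup_cons] at hndm
        exact hndm.2.1.1 (by simp [ht])
    rw [hzw] at h5
    have h6 : (σ * swap x y).SameCycle z b := h5.sameCycle (by rw [← hzw]; simp)
    have h7 : z ∈ X₁ := by
      have h8 : z ∈ v ++ [b] := by simp [hzw]
      rw [h4.2.1] at hσy
      rcases List.mem_append.1 h8 with h9 | h9
      · exact (hΓ z (by simp [huv, h9])).resolve_right hσy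
      · rw [List.mem_singleton.1 h9] at hσy
        exact absurd hb hσy
    exact hJab (Setoid.trans' _ (hJ₁ z h7) (le_sup_left (a := orb (σ * swap x y)) h6))
  subst hyb
  have hyΓ₂ : y ∉ Γ₂ := by
    rw [List.nodup_append] at hndm
    exact fun h3 => hndm.2.2 y h3 y (by simp) rfl
  have hxΓ₂ : x ∉ Γ₂ := fun h3 => hxn (by simp [h3])
  have hsuff' : Path (σ * swap x y) (Γ₂ ++ [y]) :=
    hsuff.congr fun t ht => hρ t (fun h3 => hxΓ₂ (h3 ▸ ht)) fun h3 => hyΓ₂ (h3 ▸ ht)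
  refine ⟨Γ₁, Γ₂, σ * swap x y, rfl, h1, ?_, hg, ?_, ?_, ?_⟩
  -- The interval from `c` to `b` is uncut as well, so an element of `X₁` in it would connect the
  -- two parts.
  · intro z hz
    refine (hΓ z (by simp [hz])).resolve_left fun h3 => hJab ?_
    rw [hcm] at hsuff'
    have h4 : (σ * swap x y).SameCycle z y := SameCycle.trans
      (hsuff'.sameCycle (z := z) (by rw [← hcm]; simp [hz])).symm
      (hsuff'.sameCycle (by rw [← hcm]; simp))
    exact Setoid.trans' _ (hJ₁ z h3) (le_sup_left (a := orb (σ * swap x y)) h4)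
  · rw [hlx, List.append_assoc, List.singleton_append, Path, List.isChain_split]
    refine ⟨Path.congr hp1 fun t ht => hρ t ?_ ?_, ?_⟩
    · exact fun h3 => hdis t ht x (by simp) h3
    · exact fun h3 => hdis t ht y (by simp) h3
    · rw [List.isChain_pair, Perm.mul_apply, swap_apply_left, hba]
  · rw [List.cons_append, hcm, Path, List.isChain_cons_cons, ← hcm]
    exact ⟨by rw [Perm.mul_apply, swap_apply_right, hxc], hsuff'⟩
  · exact fun z hz => hρ z (fun h3 => hz (h3 ▸ hxl)) fun h3 => hz (h3 ▸ hyl)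

end Paths

end ImploidMoves


namespace ImploidMoves

/-! ### Planar maps -/

section Planar

open Equiv Equiv.Perm

variable {B : Type} {M : OpenMap B} {O : Set (M.D ⊕ B)}

/-- The arcs of a submap. -/
abbrev subArcs (S : Set M.D) (r : M.D ⊕ B) (B' : Set (M.D ⊕ B)) : Set (M.D ⊕ B) :=
  {x | x = r ∨ x ∈ B' ∨ ∃ s ∈ S, x = Sum.inl s}

theorem TopologicalAt.rotClosed {S : Set M.D} {r : M.D ⊕ B} {B' : Set (M.D ⊕ B)}
    (h : TopologicalAt M O S r B') : RotClosed M S := by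
  induction h with
  | edge => exact fun _ h => h.elim
  | unit r d _ h =>
    rintro s rfl
    exact h
  | glue r d S B' _ _ h _ _ _ _ ih =>
    rintro s ((rfl | rfl) | hs)
    · simp
    · simp [h]
    · exact Or.inr (ih s hs)
  | lam r d S B' _ _ h _ _ _ _ _ _ ih =>
    rintro s ((rfl | rfl | rfl) | hs)
    · simp
    · simp
    · simp [h]
    · exact Or.inr (ih s hs)
  | app r d S₁ S₂ B₁ B₂ _ _ h _ _ _ _ _ _ _ _ ih1 ih2 =>
    rintro s ((rfl | rfl | rfl) | hs | hs)
    · simp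
    · simp
    · simp [h]
    · exact Or.inr (Or.inl (ih1 s hs))
    · exact Or.inr (Or.inr (ih2 s hs))

theorem TopologicalAt.e_mem {S : Set M.D} {r : M.D ⊕ B} {B' : Set (M.D ⊕ B)}
    (h : TopologicalAt M O S r B') : ∀ x ∈ subArcs S r B', M.e x ∈ subArcs S r B' := by
  have key : ∀ {r d} {X : Set (M.D ⊕ B)}, M.e r = Sum.inl d → (∀ x ∈ X, M.e x ∈ X) →
      ∀ x, (x = r ∨ x = Sum.inl d ∨ x ∈ X) → (M.e x = r ∨ M.e x = Sum.inl d ∨ M.e x ∈ X) := by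
    rintro r d X hr hX x (rfl | rfl | hx)
    · exact Or.inr (Or.inl hr)
    · exact Or.inl (by rw [← hr, M.e_invol])
    · exact Or.inr (Or.inr (hX x hx))
  induction h with
  | edge r =>
    rintro x (rfl | rfl | ⟨s, hs, -⟩)
    · exact Or.inr (Or.inl rfl)
    · exact Or.inl (M.e_invol _)
    · exact hs.elim
  | unit r d h =>
    rintro x (rfl | hx | ⟨s, rfl, rfl⟩)
    · exact Or.inr (Or.inr ⟨d, rfl, h⟩)
    · exact hx.elim
    · exact Or.inl (by rw [← h, M.e_invol])
  | glue r d S B' h _ _ _ _ _ _ ih =>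
    have hX : ∀ x, x ∈ subArcs ({d, M.rot d} ∪ S) r B' ↔
        (x = r ∨ x = Sum.inl d ∨ x ∈ subArcs S (Sum.inl (M.rot d)) B') := by
      intro x
      simp only [subArcs, Set.mem_union, Set.mem_insert_iff, Set.mem_singleton_iff,
        Set.mem_ofPred_eq, or_and_right, exists_or, exists_eq_left]
      tauto
    intro x hx
    exact (hX _).2 (key h ih x ((hX x).1 hx))
  | lam r d S B' h _ _ _ _ _ _ _ _ ih =>
    have hX : ∀ x, x ∈ subArcs ({d, M.rot d, M.rot (M.rot d)} ∪ S) r B' ↔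
        (x = r ∨ x = Sum.inl d ∨
          x ∈ subArcs S (Sum.inl (M.rot (M.rot d))) (insert (Sum.inl (M.rot d)) B')) := by
      intro x
      simp only [subArcs, Set.mem_union, Set.mem_insert_iff, Set.mem_singleton_iff,
        Set.mem_ofPred_eq, or_and_right, exists_or, exists_eq_left]
      tauto
    intro x hx
    exact (hX _).2 (key h ih x ((hX x).1 hx))
  | app r d S₁ S₂ B₁ B₂ h _ _ _ _ _ _ _ _ _ _ ih1 ih2 =>
    have hX : ∀ x, x ∈ subArcs ({d, M.rot d, M.rot (M.rot d)} ∪ (S₁ ∪ S₂)) r (B₁ ∪ B₂) ↔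
        (x = r ∨ x = Sum.inl d ∨ x ∈ subArcs S₁ (Sum.inl (M.rot (M.rot d))) B₁ ∪
          subArcs S₂ (Sum.inl (M.rot d)) B₂) := by
      intro x
      simp only [subArcs, Set.mem_union, Set.mem_insert_iff, Set.mem_singleton_iff,
        Set.mem_ofPred_eq, or_and_right, exists_or, exists_eq_left]
      constructor
      · rintro (h | (h | h) | (h | h | h) | h | h) <;> simp only [h, true_or, or_true]
      · rintro (h | h | (h | h | h) | h | h | h) <;> simp only [h, true_or, or_true]
    intro x hx
    refine (hX _).2 (key h ?_ x ((hX x).1 hx))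
    rintro x (hx | hx)
    exacts [Or.inl (ih1 x hx), Or.inr (ih2 x hx)]

/-- Connectedness of a submap through its own edges and vertices. It is stated for an arbitrary
equivalence relation so that it applies after the boundary cycle has been cut. -/
theorem TopologicalAt.rel {S : Set M.D} {r : M.D ⊕ B} {B' : Set (M.D ⊕ B)}
    (h : TopologicalAt M O S r B') (J : Setoid (M.D ⊕ B))
    (he : ∀ x ∈ subArcs S r B', J x (M.e x))
    (hv : ∀ s ∈ S, J (Sum.inl s) (Sum.inl (M.rot s))) : ∀ x ∈ subArcs S r B', J r x := by
  have h1 : J r (M.e r) := he r (Or.inl rfl)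
  induction h with
  | edge r =>
    rintro x (rfl | rfl | ⟨s, hs, -⟩)
    · exact J.refl _
    · exact h1
    · exact hs.elim
  | unit r d h =>
    rintro x (rfl | hx | ⟨s, rfl, rfl⟩)
    · exact J.refl _
    · exact hx.elim
    · rwa [← h]
  | glue r d S B' h _ _ _ _ _ ht ih =>
    have h2 : J r (Sum.inl d) := h ▸ h1
    have h3 : J r (Sum.inl (M.rot d)) := J.trans h2 (hv d (by simp))
    have hX : ∀ x ∈ subArcs S (Sum.inl (M.rot d)) B', x ∈ subArcs ({d, M.rot d} ∪ S) r B' := by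
      rintro x (rfl | hx | ⟨s, hs, rfl⟩)
      · exact Or.inr (Or.inr ⟨_, by simp, rfl⟩)
      · exact Or.inr (Or.inl hx)
      · exact Or.inr (Or.inr ⟨s, Or.inr hs, rfl⟩)
    have ih := ih (fun x hx => he x (hX x hx)) (fun s hs => hv s (Or.inr hs))
      (he _ (hX _ (Or.inl rfl)))
    rintro x (rfl | hx | ⟨s, ((rfl | rfl) | hs), rfl⟩)
    · exact J.refl _
    · exact J.trans h3 (ih x (Or.inr (Or.inl hx)))
    · exact h2
    · exact h3
    · exact J.trans h3 (ih _ (Or.inr (Or.inr ⟨s, hs, rfl⟩)))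
  | lam r d S B' h _ _ _ _ _ _ _ ht ih =>
    have h2 : J r (Sum.inl d) := h ▸ h1
    have h3 : J r (Sum.inl (M.rot d)) := J.trans h2 (hv d (by simp))
    have h4 : J r (Sum.inl (M.rot (M.rot d))) := J.trans h3 (hv _ (by simp))
    have hX : ∀ x ∈ subArcs S (Sum.inl (M.rot (M.rot d))) (insert (Sum.inl (M.rot d)) B'),
        x ∈ subArcs ({d, M.rot d, M.rot (M.rot d)} ∪ S) r B' := by
      rintro x (rfl | (rfl | hx) | ⟨s, hs, rfl⟩)
      · exact Or.inr (Or.inr ⟨_, by simp, rfl⟩)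
      · exact Or.inr (Or.inr ⟨_, by simp, rfl⟩)
      · exact Or.inr (Or.inl hx)
      · exact Or.inr (Or.inr ⟨s, Or.inr hs, rfl⟩)
    have ih := ih (fun x hx => he x (hX x hx)) (fun s hs => hv s (Or.inr hs))
      (he _ (hX _ (Or.inl rfl)))
    rintro x (rfl | hx | ⟨s, ((rfl | rfl | rfl) | hs), rfl⟩)
    · exact J.refl _
    · exact J.trans h4 (ih x (Or.inr (Or.inl (Or.inr hx))))
    · exact h2
    · exact h3
    · exact h4
    · exact J.trans h4 (ih _ (Or.inr (Or.inr ⟨s, hs, rfl⟩)))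
  | app r d S₁ S₂ B₁ B₂ h _ _ _ _ _ _ _ _ ht₁ ht₂ ih1 ih2 =>
    have h2 : J r (Sum.inl d) := h ▸ h1
    have h3 : J r (Sum.inl (M.rot d)) := J.trans h2 (hv d (by simp))
    have h4 : J r (Sum.inl (M.rot (M.rot d))) := J.trans h3 (hv _ (by simp))
    have hX₁ : ∀ x ∈ subArcs S₁ (Sum.inl (M.rot (M.rot d))) B₁,
        x ∈ subArcs ({d, M.rot d, M.rot (M.rot d)} ∪ (S₁ ∪ S₂)) r (B₁ ∪ B₂) := by
      rintro x (rfl | hx | ⟨s, hs, rfl⟩)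
      · exact Or.inr (Or.inr ⟨_, by simp, rfl⟩)
      · exact Or.inr (Or.inl (Or.inl hx))
      · exact Or.inr (Or.inr ⟨s, Or.inr (Or.inl hs), rfl⟩)
    have hX₂ : ∀ x ∈ subArcs S₂ (Sum.inl (M.rot d)) B₂,
        x ∈ subArcs ({d, M.rot d, M.rot (M.rot d)} ∪ (S₁ ∪ S₂)) r (B₁ ∪ B₂) := by
      rintro x (rfl | hx | ⟨s, hs, rfl⟩)
      · exact Or.inr (Or.inr ⟨_, by simp, rfl⟩)
      · exact Or.inr (Or.inl (Or.inr hx))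
      · exact Or.inr (Or.inr ⟨s, Or.inr (Or.inr hs), rfl⟩)
    have ih1 := ih1 (fun x hx => he x (hX₁ x hx)) (fun s hs => hv s (Or.inr (Or.inl hs)))
      (he _ (hX₁ _ (Or.inl rfl)))
    have ih2 := ih2 (fun x hx => he x (hX₂ x hx)) (fun s hs => hv s (Or.inr (Or.inr hs)))
      (he _ (hX₂ _ (Or.inl rfl)))
    rintro x (rfl | (hx | hx) | ⟨s, ((rfl | rfl | rfl) | hs | hs), rfl⟩)
    · exact J.refl _
    · exact J.trans h4 (ih1 x (Or.inr (Or.inl hx)))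
    · exact J.trans h3 (ih2 x (Or.inr (Or.inl hx)))
    · exact h2
    · exact h3
    · exact h4
    · exact J.trans h4 (ih1 _ (Or.inr (Or.inr ⟨s, hs, rfl⟩)))
    · exact J.trans h3 (ih2 _ (Or.inr (Or.inr ⟨s, hs, rfl⟩)))

/-- The submap with root `r`, vertices in `S` and boundary arcs `Γ` in clockwise order is a part
of a map of genus zero with vertex permutation `σ` and edge permutation `τ`. -/
structure Drawn (M : OpenMap B) (S : Set M.D) (r : M.D ⊕ B) (Γ : List (M.D ⊕ B))
    (σ τ : Perm (M.D ⊕ B)) : Prop where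
  root_ne : ∀ s ∈ S, r ≠ Sum.inl s
  root_notMem : r ∉ Γ
  notMem : ∀ s ∈ S, Sum.inl s ∉ Γ
  nodup : Γ.Nodup
  genus : GenusZero σ τ
  edge : ∀ x ∈ subArcs S r {x | x ∈ Γ}, τ x = M.e x
  vertex : ∀ s ∈ S, σ (Sum.inl s) = Sum.inl (M.rot s)
  path : Path σ (r :: Γ ++ [r])

variable [Finite B] [DecidableEq (M.D ⊕ B)] {σ τ : Perm (M.D ⊕ B)}

/-- Removing the root vertex amounts to contracting the root edge: the other darts of the vertex
enter the boundary cycle, with the predecessor `q` of `d` at its head and the successor of `d` at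
its end. -/
theorem Drawn.contract {S : Set M.D} {r : M.D ⊕ B} {Γ : List (M.D ⊕ B)} (h : Drawn M S r Γ σ τ)
    (hS : RotClosed M S) {d q : M.D} (hr : M.e r = Sum.inl d) (hd : d ∈ S) (hq : M.rot q = d)
    (hqd : q ≠ d) : ∃ ρ, GenusZero ρ (τ * swap r (Sum.inl d)) ∧
      Path ρ (Sum.inl q :: Γ ++ [Sum.inl (M.rot d)]) ∧
      ∀ s ∈ S, s ≠ d → s ≠ q → ρ (Sum.inl s) = Sum.inl (M.rot s) := by
  have := M.finite
  have hrd := h.root_ne d hd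
  have hqS : q ∈ S := hS.of_rot_mem (hq ▸ hd)
  have hdd : M.rot d ≠ d := fun h => hqd (M.rot.injective (hq.trans h.symm))
  have hσd := h.vertex d hd
  -- The cycle of the root consists of `r` and `Γ`, so the root edge is not a loop.
  have h1 : ¬ σ.SameCycle r (Sum.inl d) := by
    intro hs
    have := h.path.mem_of_sameCycle hs
    rcases List.mem_cons.1 this with h2 | h2
    · exact hrd h2.symm
    · exact h.notMem d hd h2
  obtain ⟨ρ, hg, hρ⟩ := h.genus.contract h1 ((h.edge r (Or.inl rfl)).trans hr)
    ((h.edge _ (Or.inr (Or.inr ⟨d, hd, rfl⟩))).trans (by rw [← hr, M.e_invol]))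
    (by rw [hσd]; simpa using hdd)
  refine ⟨ρ, hg, ?_, fun s hs hsd hsq => ?_⟩
  · rw [← hσd]
    exact h.path.contract hrd h.root_notMem (h.notMem d hd) ((h.vertex q hqS).trans (by rw [hq]))
      (h.root_ne q hqS).symm (by simpa using hqd) hρ
  · rw [hρ _ (h.root_ne s hs).symm (by simpa using hsd), h.vertex s hs,
      if_neg (h.root_ne _ (hS s hs)).symm, if_neg]
    intro h2
    exact hsq (M.rot.injective ((Sum.inl.inj h2).trans hq.symm))

/-- In genus zero the recursion preserves the order of the boundary, so no exchange is needed. After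
the contraction the boundary cycle reads: third dart, Γ, second dart. For an abstraction this puts
the new variable last, as a term requires; for an application it falls into an interval for the
function followed by one for the argument. -/
theorem TopologicalAt.topList_of_drawn {S : Set M.D} {r : M.D ⊕ B} {B' : Set (M.D ⊕ B)}
    (h : TopologicalAt M O S r B') {Γ : List (M.D ⊕ B)} (hΓ : ∀ x, x ∈ Γ ↔ x ∈ B')
    (hD : Drawn M S r Γ σ τ) : TopList M O False S r Γ := by
  have := M.finite
  induction h generalizing Γ σ τ with
  | edge r h =>
    have h1 : Γ.Perm [M.e r] := by
      rw [List.perm_ext_iff_of_nodup hD.nodup (by simp)]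
      simpa using hΓ
    rw [List.perm_singleton.1 h1]
    exact .edge r h
  | unit r d h1 h2 h3 =>
    obtain rfl : Γ = [] := List.eq_nil_iff_forall_not_mem.2 (by simpa using hΓ)
    exact .unit r d h1 h2 h3
  | glue r d S B' h1 h2 h3 h4 h5 h6 h7 ih =>
    refine .glue r d S Γ h1 h2 h3 h4 h5 h6 ?_
    have hS : RotClosed M ({d, M.rot d} ∪ S) := (TopologicalAt.glue r d S B' h1 h2 h3 h4 h5 h6 h7).rotClosed
    obtain ⟨ρ, hg, hp, hv⟩ := hD.contract hS h1 (by simp) h3 h2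
    have hn : ∀ s ∈ S, s ≠ d ∧ s ≠ M.rot d := fun s hs =>
      ⟨fun h => Set.disjoint_left.1 h6 (by simp [h]) hs,
        fun h => Set.disjoint_left.1 h6 (by simp [h]) hs⟩
    refine ih hΓ ⟨fun s hs h => (hn s hs).2 (Sum.inl.inj h).symm, hD.notMem _ (by simp),
      fun s hs => hD.notMem s (Or.inr hs), hD.nodup, hg, ?_,
      fun s hs => hv s (Or.inr hs) (hn s hs).1 (hn s hs).2, hp⟩
    have hX : ∀ x ∈ subArcs S (Sum.inl (M.rot d)) {x | x ∈ Γ}, x ≠ r ∧ x ≠ Sum.inl d ∧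
        x ∈ subArcs ({d, M.rot d} ∪ S) r {x | x ∈ Γ} := by
      rintro x (rfl | hx | ⟨s, hs, rfl⟩)
      · exact ⟨(hD.root_ne _ (by simp)).symm, by simpa using h2, Or.inr (Or.inr ⟨_, by simp, rfl⟩)⟩
      · exact ⟨fun h => hD.root_notMem (h ▸ hx), fun h => hD.notMem d (by simp) (h ▸ hx),
          Or.inr (Or.inl hx)⟩
      · exact ⟨(hD.root_ne s (Or.inr hs)).symm, by simpa using (hn s hs).1,
          Or.inr (Or.inr ⟨s, Or.inr hs, rfl⟩)⟩
    intro x hx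
    obtain ⟨i, j, k⟩ := hX x hx
    rw [Perm.mul_apply, swap_apply_of_ne_of_ne i j, hD.edge x k]
  | lam r d S B' h1 h2 h3 h4 h5 h6 h7 h8 h9 ih =>
    refine .lam r d S Γ h1 h2 h3 h4 h5 h6 h7 ?_
    have hS : RotClosed M ({d, M.rot d, M.rot (M.rot d)} ∪ S) :=
      (TopologicalAt.lam r d S B' h1 h2 h3 h4 h5 h6 h7 h8 h9).rotClosed
    obtain ⟨hn1, hn2⟩ := rot_ne h2 h3
    obtain ⟨ρ, hg, hp, hv⟩ := hD.contract hS h1 (by simp) h3 hn1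
    have hn : ∀ s ∈ S, s ≠ d ∧ s ≠ M.rot d ∧ s ≠ M.rot (M.rot d) := fun s hs =>
      ⟨fun h => Set.disjoint_left.1 h7 (by simp [h]) hs,
        fun h => Set.disjoint_left.1 h7 (by simp [h]) hs,
        fun h => Set.disjoint_left.1 h7 (by simp [h]) hs⟩
    have hΓ' : ∀ x, x ∈ Γ ++ [Sum.inl (M.rot d)] ↔ x ∈ insert (Sum.inl (M.rot d)) B' := by
      intro x
      simp [hΓ, or_comm]
    refine ih hΓ' ⟨fun s hs h => (hn s hs).2.2 (Sum.inl.inj h).symm, ?_, ?_, ?_, hg, ?_,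
      fun s hs => hv s (Or.inr hs) (hn s hs).1 (hn s hs).2.2, ?_⟩
    · have := hD.notMem (M.rot (M.rot d)) (by simp)
      simp [this, hn2]
    · intro s hs
      have := hD.notMem s (Or.inr hs)
      simp [this, (hn s hs).2.1]
    · rw [← List.concat_eq_append, List.nodup_concat]
      exact ⟨hD.notMem _ (by simp), hD.nodup⟩
    · have hX : ∀ x ∈ subArcs S (Sum.inl (M.rot (M.rot d))) {x | x ∈ Γ ++ [Sum.inl (M.rot d)]},
          x ≠ r ∧ x ≠ Sum.inl d ∧
          x ∈ subArcs ({d, M.rot d, M.rot (M.rot d)} ∪ S) r {x | x ∈ Γ} := by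
        rintro x (rfl | hx | ⟨s, hs, rfl⟩)
        · exact ⟨(hD.root_ne _ (by simp)).symm, by simpa using hn1,
            Or.inr (Or.inr ⟨_, by simp, rfl⟩)⟩
        · rcases List.mem_append.1 hx with hx | hx
          · exact ⟨fun h => hD.root_notMem (h ▸ hx), fun h => hD.notMem d (by simp) (h ▸ hx),
              Or.inr (Or.inl hx)⟩
          · rw [List.mem_singleton.1 hx]
            exact ⟨(hD.root_ne _ (by simp)).symm, by simpa using h2,
              Or.inr (Or.inr ⟨_, by simp, rfl⟩)⟩
        · exact ⟨(hD.root_ne s (Or.inr hs)).symm, by simpa using (hn s hs).1,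
            Or.inr (Or.inr ⟨s, Or.inr hs, rfl⟩)⟩
      intro x hx
      obtain ⟨i, j, k⟩ := hX x hx
      rw [Perm.mul_apply, swap_apply_of_ne_of_ne i j, hD.edge x k]
    -- The rotation from the second dart to the third closes the new boundary cycle.
    · have h10 := hv (M.rot d) (by simp) h2 hn2.symm
      have : Sum.inl (M.rot (M.rot d)) :: (Γ ++ [Sum.inl (M.rot d)]) ++ [Sum.inl (M.rot (M.rot d))] =
        (Sum.inl (M.rot (M.rot d)) :: Γ) ++ Sum.inl (M.rot d) :: [Sum.inl (M.rot (M.rot d))] := by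
          simp
      rw [this, Path, List.isChain_split, List.isChain_pair]
      exact ⟨hp, h10⟩
  | app r d S₁ S₂ B₁ B₂ h1 h2 h3 h4 h5 h6 h7 h8 h9 h10 h11 ih1 ih2 =>
    have hS : RotClosed M ({d, M.rot d, M.rot (M.rot d)} ∪ (S₁ ∪ S₂)) :=
      (TopologicalAt.app r d S₁ S₂ B₁ B₂ h1 h2 h3 h4 h5 h6 h7 h8 h9 h10 h11).rotClosed
    obtain ⟨hn1, hn2⟩ := rot_ne h2 h3
    obtain ⟨ρ, hg, hp, hv⟩ := hD.contract hS h1 (by simp) h3 hn1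
    have hn : ∀ s ∈ S₁ ∪ S₂, s ≠ d ∧ s ≠ M.rot d ∧ s ≠ M.rot (M.rot d) := fun s hs =>
      ⟨fun h => Set.disjoint_left.1 h7 (by simp [h]) hs,
        fun h => Set.disjoint_left.1 h7 (by simp [h]) hs,
        fun h => Set.disjoint_left.1 h7 (by simp [h]) hs⟩
    have hd₁Γ := hD.notMem (M.rot d) (by simp)
    have hd₂Γ := hD.notMem (M.rot (M.rot d)) (by simp)
    have hX₁ : ∀ x ∈ subArcs S₁ (Sum.inl (M.rot (M.rot d))) B₁, x ≠ r ∧ x ≠ Sum.inl d ∧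
        x ∈ subArcs ({d, M.rot d, M.rot (M.rot d)} ∪ (S₁ ∪ S₂)) r {x | x ∈ Γ} := by
      rintro x (rfl | hx | ⟨s, hs, rfl⟩)
      · exact ⟨(hD.root_ne _ (by simp)).symm, by simpa using hn1,
          Or.inr (Or.inr ⟨_, by simp, rfl⟩)⟩
      · have hx : x ∈ Γ := (hΓ x).2 (Or.inl hx)
        exact ⟨fun h => hD.root_notMem (h ▸ hx), fun h => hD.notMem d (by simp) (h ▸ hx),
          Or.inr (Or.inl hx)⟩
      · exact ⟨(hD.root_ne s (Or.inr (Or.inl hs))).symm, by simpa using (hn s (Or.inl hs)).1,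
          Or.inr (Or.inr ⟨s, Or.inr (Or.inl hs), rfl⟩)⟩
    have hX₂ : ∀ x ∈ subArcs S₂ (Sum.inl (M.rot d)) B₂, x ≠ r ∧ x ≠ Sum.inl d ∧
        x ∈ subArcs ({d, M.rot d, M.rot (M.rot d)} ∪ (S₁ ∪ S₂)) r {x | x ∈ Γ} := by
      rintro x (rfl | hx | ⟨s, hs, rfl⟩)
      · exact ⟨(hD.root_ne _ (by simp)).symm, by simpa using h2,
          Or.inr (Or.inr ⟨_, by simp, rfl⟩)⟩
      · have hx : x ∈ Γ := (hΓ x).2 (Or.inr hx)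
        exact ⟨fun h => hD.root_notMem (h ▸ hx), fun h => hD.notMem d (by simp) (h ▸ hx),
          Or.inr (Or.inl hx)⟩
      · exact ⟨(hD.root_ne s (Or.inr (Or.inr hs))).symm, by simpa using (hn s (Or.inr hs)).1,
          Or.inr (Or.inr ⟨s, Or.inr (Or.inr hs), rfl⟩)⟩
    have hτ₁ : ∀ x ∈ subArcs S₁ (Sum.inl (M.rot (M.rot d))) B₁,
        (τ * swap r (Sum.inl d)) x = M.e x := by
      intro x hx
      obtain ⟨i, j, k⟩ := hX₁ x hx
      rw [Perm.mul_apply, swap_apply_of_ne_of_ne i j, hD.edge x k]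
    have hτ₂ : ∀ x ∈ subArcs S₂ (Sum.inl (M.rot d)) B₂,
        (τ * swap r (Sum.inl d)) x = M.e x := by
      intro x hx
      obtain ⟨i, j, k⟩ := hX₂ x hx
      rw [Perm.mul_apply, swap_apply_of_ne_of_ne i j, hD.edge x k]
    have hB₁ : ∀ s ∈ {d, M.rot d, M.rot (M.rot d)} ∪ (S₁ ∪ S₂), Sum.inl s ∉ B₁ :=
      fun s hs hx => hD.notMem s hs ((hΓ _).2 (Or.inl hx))
    have hB₂ : ∀ s ∈ {d, M.rot d, M.rot (M.rot d)} ∪ (S₁ ∪ S₂), Sum.inl s ∉ B₂ :=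
      fun s hs hx => hD.notMem s hs ((hΓ _).2 (Or.inr hx))
    have hdis : ∀ x ∈ subArcs S₁ (Sum.inl (M.rot (M.rot d))) B₁,
        x ∉ subArcs S₂ (Sum.inl (M.rot d)) B₂ := by
      rintro x (rfl | hx | ⟨s, hs, rfl⟩) (h | h | ⟨t, ht, h⟩)
      · exact hn2 (Sum.inl.inj h)
      · exact hB₂ _ (by simp) h
      · exact (hn t (Or.inr ht)).2.2 (Sum.inl.inj h).symm
      · exact hB₁ _ (by simp) (h ▸ hx)
      · exact Set.disjoint_left.1 h9 hx h
      · exact hB₁ t (Or.inr (Or.inr ht)) (h ▸ hx)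
      · exact (hn s (Or.inl hs)).2.1 (Sum.inl.inj h)
      · exact hB₂ s (Or.inr (Or.inl hs)) h
      · exact Set.disjoint_left.1 h8 hs (Sum.inl.inj h ▸ ht)
    have hl : ∀ s ∈ S₁ ∪ S₂,
        Sum.inl s ∉ Sum.inl (M.rot (M.rot d)) :: Γ ++ [Sum.inl (M.rot d)] := by
      intro s hs
      simp [hn s hs, hD.notMem s (Or.inr hs)]
    have hv₁ : ∀ s ∈ S₁ ∪ S₂, ρ (Sum.inl s) = Sum.inl (M.rot s) := fun s hs =>
      hv s (Or.inr hs) (hn s hs).1 (hn s hs).2.2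
    have hlist : ∀ x, x ∈ Sum.inl (M.rot (M.rot d)) :: Γ ++ [Sum.inl (M.rot d)] ↔
        x = Sum.inl (M.rot (M.rot d)) ∨ x ∈ Γ ∨ x = Sum.inl (M.rot d) := by
      intro x
      simp
    -- The parts `X₁` and `X₂` are the arcs of the function and of the argument, with `a` and `b`
    -- their roots.
    obtain ⟨Γ₁, Γ₂, ρ', rfl, hΓ₁, hΓ₂, hg', hp₁, hp₂, hρ'⟩ := hg.split_path
      (X₁ := subArcs S₁ (Sum.inl (M.rot (M.rot d))) B₁) (X₂ := subArcs S₂ (Sum.inl (M.rot d)) B₂)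
      (a := Sum.inl (M.rot (M.rot d))) (b := Sum.inl (M.rot d)) (Γ := Γ) (Or.inl rfl) (Or.inl rfl)
      (fun x hx => ((hΓ x).1 hx).imp (fun h => Or.inr (Or.inl h)) fun h => Or.inr (Or.inl h))
      hdis
      (by
        rw [List.cons_append, List.nodup_cons, ← List.concat_eq_append, List.nodup_concat]
        exact ⟨by simp [hn2, hd₂Γ], hd₁Γ, hD.nodup⟩)
      (by
        have : Sum.inl (M.rot (M.rot d)) :: Γ ++ [Sum.inl (M.rot d), Sum.inl (M.rot (M.rot d))] =
          (Sum.inl (M.rot (M.rot d)) :: Γ) ++ Sum.inl (M.rot d) ::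
            [Sum.inl (M.rot (M.rot d))] := by simp
        rw [this, Path, List.isChain_split, List.isChain_pair]
        exact ⟨hp, hv (M.rot d) (by simp) h2 hn2.symm⟩)
      (fun x hx => by rw [hτ₂ x hx]; exact h11.e_mem x hx)
      (by
        rintro x (rfl | hx | ⟨s, hs, rfl⟩) hxl
        · exact absurd ((hlist _).2 (Or.inr (Or.inr rfl))) hxl
        · exact absurd ((hlist _).2 (Or.inr (Or.inl ((hΓ x).2 (Or.inr hx))))) hxl
        · rw [hv₁ s (Or.inr hs)]
          exact Or.inr (Or.inr ⟨_, h11.rotClosed s hs, rfl⟩))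
      (fun J hJ hJ' => h10.rel J (fun x hx => hτ₁ x hx ▸ hJ x hx) fun s hs => by
        rw [← hv₁ s (Or.inl hs)]
        exact hJ' _ (Or.inr (Or.inr ⟨s, hs, rfl⟩)) (hl s (Or.inl hs)))
      (fun J hJ hJ' => h11.rel J (fun x hx => hτ₂ x hx ▸ hJ x hx) fun s hs => by
        rw [← hv₁ s (Or.inr hs)]
        exact hJ' _ (Or.inr (Or.inr ⟨s, hs, rfl⟩)) (hl s (Or.inr hs)))
    have hm₁ : ∀ x, x ∈ Γ₁ ↔ x ∈ B₁ := by
      intro x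
      constructor
      · intro hx
        refine ((hΓ x).1 (by simp [hx])).resolve_right fun h => ?_
        exact hdis x (hΓ₁ x hx) (Or.inr (Or.inl h))
      · intro hx
        refine (List.mem_append.1 ((hΓ x).2 (Or.inl hx))).resolve_right fun h => ?_
        exact hdis x (Or.inr (Or.inl hx)) (hΓ₂ x h)
    have hm₂ : ∀ x, x ∈ Γ₂ ↔ x ∈ B₂ := by
      intro x
      constructor
      · intro hx
        refine ((hΓ x).1 (by simp [hx])).resolve_left fun h => ?_
        exact hdis x (Or.inr (Or.inl h)) (hΓ₂ x hx)
      · intro hx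
        refine (List.mem_append.1 ((hΓ x).2 (Or.inr hx))).resolve_left fun h => ?_
        exact hdis x (hΓ₁ x h) (Or.inr (Or.inl hx))
    have hs₁ : {x | x ∈ Γ₁} = B₁ := Set.ext hm₁
    have hs₂ : {x | x ∈ Γ₂} = B₂ := Set.ext hm₂
    have hnd := List.nodup_append.1 hD.nodup
    refine .app r d S₁ S₂ Γ₁ Γ₂ h1 h2 h3 h4 h5 h6 h7 h8
      (ih1 hm₁ ⟨fun s hs h => (hn s (Or.inl hs)).2.2 (Sum.inl.inj h).symm,
        fun h => hd₂Γ (by simp [h]), fun s hs h => hB₁ s (Or.inr (Or.inl hs)) ((hm₁ _).1 h),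
        hnd.1, hg', ?_, fun s hs => ?_, hp₁⟩)
      (ih2 hm₂ ⟨fun s hs h => (hn s (Or.inr hs)).2.1 (Sum.inl.inj h).symm,
        fun h => hd₁Γ (by simp [h]), fun s hs h => hB₂ s (Or.inr (Or.inr hs)) ((hm₂ _).1 h),
        hnd.2.1, hg', ?_, fun s hs => ?_, hp₂⟩)
    · rw [hs₁]
      exact hτ₁
    · rw [hρ' _ (hl s (Or.inl hs)), hv₁ s (Or.inl hs)]
    · rw [hs₂]
      exact hτ₂
    · rw [hρ' _ (hl s (Or.inr hs)), hv₁ s (Or.inr hs)]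

end Planar

/-! ### Planarity of the closed map and its boundary cycle -/

section Closed

open Equiv Equiv.Perm

theorem two_mul_numOrbits_of_involutive {α : Type} [Finite α] {τ : Perm α} (h : ∀ x, τ (τ x) = x)
    (h' : ∀ x, τ x ≠ x) : 2 * numOrbits τ = Nat.card α := by
  classical
  have := Fintype.ofFinite α
  have hrel : ∀ x y, orb τ x y → y = x ∨ y = τ x := by
    rintro x _ ⟨i, rfl⟩
    have h2 : τ ^ 2 = 1 := Equiv.ext fun x => by simp [pow_two, h]
    rcases Int.even_or_odd' i with ⟨k, rfl | rfl⟩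
    · left
      rw [zpow_mul, show τ ^ (2 : ℤ) = 1 from h2, one_zpow, Perm.one_apply]
    · right
      rw [zpow_add, zpow_mul, show τ ^ (2 : ℤ) = 1 from h2, one_zpow, one_mul, zpow_one]
  have hcard : ∀ q : Quotient (orb τ),
      (Finset.univ.filter fun x => Quotient.mk (orb τ) x = q).card = 2 := by
    intro q
    obtain ⟨x, rfl⟩ := Quotient.exists_rep q
    rw [show (Finset.univ.filter fun y => Quotient.mk (orb τ) y = Quotient.mk (orb τ) x) =
      {x, τ x} from ?_, Finset.card_pair (h' x).symm]
    ext y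
    simp only [Finset.mem_filter, Finset.mem_univ, true_and, Finset.mem_insert,
      Finset.mem_singleton]
    constructor
    · exact fun hy => hrel x y (Setoid.symm' _ (Quotient.exact hy))
    · rintro (rfl | rfl)
      · rfl
      · exact Quotient.sound (Setoid.symm' _ (orb_apply τ x))
  have := Finset.card_eq_sum_card_fiberwise (s := (Finset.univ : Finset α))
    (t := (Finset.univ : Finset (Quotient (orb τ)))) (f := Quotient.mk (orb τ)) (by simp)
  rw [Nat.card_eq_fintype_card, ← Finset.card_univ, this, Finset.sum_congr rfl fun q _ => hcard q,
    Finset.sum_const, Finset.card_univ, smul_eq_mul, mul_comm, numOrbits, Nat.card_eq_fintype_card]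

variable {n : ℕ}

/-- Edges have two darts each and the map has one component, so V − E + F = 2 is equivalent to V + E
+ F = 2E + 2. -/
theorem RootedMap.IsPlanar.genusZero {M : RootedMap n} (h : M.IsPlanar) :
    GenusZero M.vertexPerm M.edgePerm := by
  have := M.finite
  have h1 : 2 * numOrbits M.edgePerm = Nat.card (M.D ⊕ Fin (n + 1)) :=
    two_mul_numOrbits_of_involutive M.e_invol M.e_ne
  have h2 : numClasses (orb M.vertexPerm ⊔ orb M.edgePerm) = 1 := by
    have h3 : ∀ x y, Relation.EqvGen M.Adj x y → (orb M.vertexPerm ⊔ orb M.edgePerm) x y := by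
      intro x y h
      induction h with
      | rel x y h =>
        cases h with
        | edge x => exact le_sup_right (a := orb M.vertexPerm) (orb_apply M.edgePerm x)
        | vertex d => exact le_sup_left (a := orb M.vertexPerm) (orb_apply M.vertexPerm (Sum.inl d))
      | refl => exact Setoid.refl' _ _
      | symm _ _ _ ih => exact Setoid.symm' _ ih
      | trans _ _ _ _ _ ih1 ih2 => exact Setoid.trans' _ ih1 ih2
    rw [numClasses, Nat.card_eq_one_iff_unique]
    refine ⟨⟨fun p q => ?_⟩, ⟨Quotient.mk _ (Sum.inr 0)⟩⟩
    obtain ⟨x, rfl⟩ := Quotient.exists_rep p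
    obtain ⟨y, rfl⟩ := Quotient.exists_rep q
    exact Quotient.sound (h3 x y (M.connected x y))
  have h4 : M.eulerChar = 2 := h
  rw [RootedMap.eulerChar, RootedMap.facePerm, numOrbits_inv] at h4
  rw [GenusZero, h2]
  omega

theorem path_finRotate (D : Type) (p : Perm D) : Path (Equiv.sumCongr p (finRotate (n + 1)))
    (Sum.inr 0 :: (List.ofFn fun i : Fin n => (Sum.inr i.succ : D ⊕ Fin (n + 1))) ++
      [Sum.inr 0]) := by
  have h1 : (Sum.inr 0 :: List.ofFn fun i : Fin n => (Sum.inr i.succ : D ⊕ Fin (n + 1))) =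
      List.ofFn fun i : Fin (n + 1) => (Sum.inr i : D ⊕ Fin (n + 1)) := by
    rw [List.ofFn_succ]
  rw [h1, Path, List.isChain_iff_getElem]
  intro i hi
  simp only [List.length_append, List.length_ofFn, List.length_singleton] at hi
  rw [List.getElem_append_left (by simpa using by omega), List.getElem_ofFn]
  simp only [Equiv.sumCongr_apply, Sum.map_inr]
  by_cases hin : i + 1 < n + 1
  · rw [List.getElem_append_left (by simpa using hin), List.getElem_ofFn]
    exact congrArg Sum.inr (finRotate_of_lt (by omega))
  · obtain rfl : i = n := by omega
    rw [List.getElem_append_right (by simp)]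
    simp only [List.length_ofFn, Nat.sub_self, List.getElem_cons_zero]
    exact congrArg Sum.inr finRotate_last'

theorem mem_ofFn_succ (D : Type) (x : D ⊕ Fin (n + 1)) :
    x ∈ List.ofFn (fun i : Fin n => (Sum.inr i.succ : D ⊕ Fin (n + 1))) ↔
      ∃ i : Fin (n + 1), i ≠ 0 ∧ x = Sum.inr i := by
  rw [List.mem_ofFn]
  constructor
  · rintro ⟨i, rfl⟩
    exact ⟨i.succ, Fin.succ_ne_zero i, rfl⟩
  · rintro ⟨i, hi, rfl⟩
    obtain ⟨j, rfl⟩ := Fin.exists_succ_eq.2 hi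
    exact ⟨j, rfl⟩

theorem nodup_ofFn_succ (D : Type) :
    (List.ofFn fun i : Fin n => (Sum.inr i.succ : D ⊕ Fin (n + 1))).Nodup :=
  List.nodup_ofFn.2 (Sum.inr_injective.comp (Fin.succ_injective n))

theorem RootedMap.IsPlanar.topList {M : RootedMap n} (h : M.IsPlanar)
    {o : Orientation M.toOpenMap} (ho : M.IsTopological o) :
    TopList M.toOpenMap o.pos False Set.univ (Sum.inr 0)
      (List.ofFn fun i : Fin n => Sum.inr i.succ) := by
  classical
  refine TopologicalAt.topList_of_drawn ho (mem_ofFn_succ M.D) (σ := M.vertexPerm)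
    (τ := M.edgePerm) ⟨by simp, ?_, ?_, nodup_ofFn_succ M.D, h.genusZero, fun _ _ => rfl,
      fun _ _ => rfl, path_finRotate M.D M.rot⟩
  · rw [mem_ofFn_succ]
    rintro ⟨i, hi, h⟩
    exact hi (Sum.inr.inj h).symm
  · intro s _
    rw [mem_ofFn_succ]
    rintro ⟨i, _, h⟩
    exact Sum.inl_ne_inr h

end Closed

end ImploidMoves

/-! ### The theorem, from ordered and unordered boundary lists -/

open ImploidMoves in
theorem mainTheorem4 :
    (∀ (n : ℕ) (M : ImploidMoves.RootedMap n), M.IsPlanar →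
      (∃ o : ImploidMoves.Orientation M.toOpenMap, M.IsTopological o) ∧
      ∀ o : ImploidMoves.Orientation M.toOpenMap, M.IsTopological o →
        ImploidMoves.GeneratedBy ImploidMoves.imploidMoves (M.withOrientation o)) ∧
    (∀ s ∈ ImploidMoves.symmetricMoves, ∀ (n : ℕ) (M : ImploidMoves.RootedMap n),
      (∃ o : ImploidMoves.Orientation M.toOpenMap, M.IsTopological o) ∧
      ∀ o : ImploidMoves.Orientation M.toOpenMap, M.IsTopological o →
        ImploidMoves.GeneratedBy (insert s ImploidMoves.imploidMoves) (M.withOrientation o)) := by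
  refine ⟨fun n M hM => ⟨M.exists_isTopological, fun o ho => ?_⟩,
    fun s hs n M => ⟨M.exists_isTopological, fun o ho => ?_⟩⟩
  -- For planar maps the exchange rule is excluded by taking `E` to be `False`.
  · exact generatedBy_of_topList subset_rfl False.elim M o ho (hM.topList ho)
  · have hp : imploidMoves ⊆ insert s imploidMoves := Set.subset_insert _ _
    -- For arbitrary genus exchange is allowed, and the remaining goal is that the chosen move
    -- permits swapping arguments.
    refine generatedBy_of_topList hp (fun _ => ?_) M o ho
      (ho.topList _ (nodup_ofFn_succ M.D) (mem_ofFn_succ M.D))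
    rcases hs with rfl | rfl | rfl
    · exact canSwap_chi (Set.mem_insert _ _)
    · exact canSwap_const hp (Set.mem_insert _ _)
    · exact canSwap_gamma hp (Set.mem_insert _ _)
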